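/- Let $n\ge 5$ and let $$K_n=\{\lambda=(\lambda^1,\dots,\lambda^{n-3})\in\mathbb C^{n-3} : \lambda^i\ne 0,1,\ \lambda^i\ne\lambda^j \text{ for } i\ne j\}.$$ For $\lambda\in K_n$ put $z^\lambda_1=0$, $z^\lambda_2=1$, $z^\lambda_3=\infty$, $z^\lambda_{i+3}=\lambda^i$ and $[\lambda]=\{z^\lambda_1,\dots,z^\lambda_n\}\subset\widehat{\mathbb C}$. For $\sigma\in S_n$ let $f^\lambda_\sigma$ be the linear fractional transformation that takes $z^\lambda_{\sigma^{-1}(1)},z^\lambda_{\sigma^{-1}(2)},z^\lambda_{\sigma^{-1}(3)}$ to $0,1,\infty$, and let $g_\sigma:K_n\to K_n$, $g_\sigma(\lambda)=\big(f^\lambda_\sigma(z^\lambda_{\sigma^{-1}(4)}),\dots,f^\lambda_\sigma(z^\lambda_{\sigma^{-1}(n)})\big)$. Let $G=\{g_\sigma:\sigma\in S_n\}$ (a group acting on $K_n$), let $G_\lambda$ be the stabilizer of $\lambda$ in $G$, and let $X_\lambda$ be the representation of $G_\lambda$ on $\mathbb C^{n-3}$ that takes $g_\sigma$ to its Jacobian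 matrix at $\lambda$. Fix a regular dodecahedron inscribed in $S^2$, and let $V$, $F$, $E\subset S^2$ be the sets of its $20$ vertices, of the radial projections of its $12$ face centres and of the radial projections of its $30$ edge midpoints. Let $I$ be its rotation group and, for $a\in S^2\setminus(V\cup F\cup E)$, let $B(a)$ be the $I$-orbit of $a$ (it has $60$ points). For $m\ge 0$, a subset of $S^2$ is of type F+mB, V+mB, E+mB, FV+mB, VE+mB, EF+mB or FVE+mB if it is the union of $F$, $V$, $E$, $F\cup V$, $V\cup E$, $E\cup F$ or $F\cup V\cup E$, respectively, with $m$ different orbits $B(a_1),\dots,B(a_m)$; it is of type (1+m)B if it is the union of $1+m$ different orbits $B(a_0),\dots,B(a_m)$. We say that $\lambda$ is of one of these types if some linear fractional transformation takes a set of that type, regarded as a subset of $\widehat{\mathbb C}$ by stereographic projection, to $[\lambda]$. Suppose that $G_\lambda\cong A_5$. For $\theta\in\{0,\frac{2\pi}5,\frac{4\pi}5,\frac{2\pi}3,\pi\}$ consider the $g_\sigma\in G_\lambda$ such that $f^\lambda_\sigma$ is conjugate, in the group of linear fractional transformations, to $z\mapsto e^{i\theta}z$; these form the five conjugacy classes $K^{(1)},\dots,K^{(5)}$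 of $G_\lambda$, in this order. Let $X^{(1)},\dots,X^{(5)}$ be the irreducible complex representations of $G_\lambda$, numbered so that their characters are $$\begin{array}{c|ccccc} & K^{(1)} & K^{(2)} & K^{(3)} & K^{(4)} & K^{(5)}\\ \hline \chi^{(1)}&1&1&1&1&1\\ \chi^{(2)}&4&-1&-1&1&0\\ \chi^{(3)}&5&0&0&-1&1\\ \chi^{(4)}&3&\frac{1+\sqrt5}2&\frac{1-\sqrt5}2&0&-1\\ \chi^{(5)}&3&\frac{1-\sqrt5}2&\frac{1+\sqrt5}2&0&-1\end{array}$$ The multiplicity vector of $\lambda$ is the $(p_1,\dots,p_5)\in\mathbb N^5$ such that $X_\lambda\cong p_1X^{(1)}\oplus\cdots\oplus p_5X^{(5)}$. **Theorem.** For every $\lambda\in K_n$ such that $G_\lambda\cong A_5$, $\lambda$ is of one of the eight types above for some $m\ge 0$; and the multiplicity vector of $\lambda$ is given by its type as follows: 1. F+mB: $(m,\ 1+4m,\ 1+5m,\ 3m,\ 3m)$; 2. V+mB: $(m,\ 1+4m,\ 2+5m,\ 3m,\ 1+3m)$; 3. E+mB: $(m,\ 2+4m,\ 2+5m,\ 1+3m,\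 2+3m)$; 4. FV+mB: $(m,\ 2+4m,\ 3+5m,\ 1+3m,\ 1+3m)$; 5. VE+mB: $(m,\ 3+4m,\ 4+5m,\ 2+3m,\ 3+3m)$; 6. EF+mB: $(m,\ 3+4m,\ 3+5m,\ 2+3m,\ 2+3m)$; 7. FVE+mB: $(m,\ 4+4m,\ 5+5m,\ 3+3m,\ 3+3m)$; 8. (1+m)B: $(1+m,\ 4+4m,\ 5+5m,\ 2+3m,\ 3+3m)$. -/

import Mathlib

noncomputable section

namespace ModuliZero

/-! ### Linear fractional transformations of the Riemann sphere -/

/-- The Riemann sphere. -/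
abbrev Sphere : Type := OnePoint ℂ

/-- The group of linear fractional transformations, as permutations of the Riemann sphere. -/
def linearFractional : Subgroup (Equiv.Perm Sphere) :=
  (MulAction.toPermHom (GL (Fin 2) ℂ) Sphere).range

/-- First homogeneous coordinate: `z = [z : 1]`, `∞ = [1 : 0]`. -/
def hx (p : Sphere) : ℂ := p.elim 1 (fun t => t)

/-- Second homogeneous coordinate: `z = [z : 1]`, `∞ = [1 : 0]`. -/
def hy (p : Sphere) : ℂ := p.elim 0 (fun _ => 1)

/-- The determinant of the homogeneous coordinates of two points. -/
def br (p q : Sphere) : ℂ := hx p * hy q - hx q * hy p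

@[simp] lemma hx_coe (t : ℂ) : hx (t : Sphere) = t := rfl
@[simp] lemma hy_coe (t : ℂ) : hy (t : Sphere) = 1 := rfl
@[simp] lemma hx_infty : hx (OnePoint.infty : Sphere) = 1 := rfl
@[simp] lemma hy_infty : hy (OnePoint.infty : Sphere) = 0 := rfl

lemma br_eq_zero_iff (p q : Sphere) : br p q = 0 ↔ p = q := by
  induction p using OnePoint.rec <;> induction q using OnePoint.rec <;>
    simp [br, sub_eq_zero, OnePoint.infty_ne_coe, OnePoint.coe_ne_infty]

lemma br_ne_zero {p q : Sphere} (h : p ≠ q) : br p q ≠ 0 := fun h' => h ((br_eq_zero_iff p q).1 h')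

/-- The matrix of `z ↦ (z - a) (b - c) / ((z - c) (b - a))`, in homogeneous coordinates, so that
any of `a`, `b`, `c` may be `∞`. -/
def normMatrix (a b c : Sphere) : Matrix (Fin 2) (Fin 2) ℂ :=
  !![hy a * br b c, -hx a * br b c; hy c * br b a, -hx c * br b a]

lemma normMatrix_det (a b c : Sphere) :
    (normMatrix a b c).det = br b c * br b a * br a c := by
  simp only [normMatrix, Matrix.det_fin_two_of, br]; ring

open Classical in
/-- The linear fractional transformation taking the distinct points `a`, `b`, `c` to `0`, `1`, `∞`
(see `normGL_spec` and `normGL_unique`). -/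
def normGL (a b c : Sphere) : GL (Fin 2) ℂ :=
  if h : (normMatrix a b c).det ≠ 0 then Matrix.GeneralLinearGroup.mkOfDetNeZero _ h else 1

lemma normMatrix_det_ne {a b c : Sphere} (hab : a ≠ b) (hac : a ≠ c) (hbc : b ≠ c) :
    (normMatrix a b c).det ≠ 0 := by
  rw [normMatrix_det]
  exact mul_ne_zero (mul_ne_zero (br_ne_zero hbc) (br_ne_zero hab.symm)) (br_ne_zero hac)

lemma normGL_coe {a b c : Sphere} (hab : a ≠ b) (hac : a ≠ c) (hbc : b ≠ c) :
    ((normGL a b c : GL (Fin 2) ℂ) : Matrix (Fin 2) (Fin 2) ℂ) = normMatrix a b c := by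
  rw [normGL, dif_pos (normMatrix_det_ne hab hac hbc)]; rfl

open Classical in
lemma smul_eq_hom (g : GL (Fin 2) ℂ) (p : Sphere) :
    g • p = if g 1 0 * hx p + g 1 1 * hy p = 0 then OnePoint.infty
      else (((g 0 0 * hx p + g 0 1 * hy p) / (g 1 0 * hx p + g 1 1 * hy p) : ℂ) : Sphere) := by
  induction p using OnePoint.rec with
  | infty => rw [OnePoint.smul_infty_eq_ite]; simp
  | coe t => rw [OnePoint.smul_some_eq_ite]; simp

open Classical in
lemma normGL_smul {a b c : Sphere} (hab : a ≠ b) (hac : a ≠ c) (hbc : b ≠ c) (p : Sphere) :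
    normGL a b c • p = if p = c then OnePoint.infty
      else (((br p a * br b c) / (br p c * br b a) : ℂ) : Sphere) := by
  rw [smul_eq_hom, normGL_coe hab hac hbc]
  have h1 : (normMatrix a b c) 1 0 * hx p + (normMatrix a b c) 1 1 * hy p = br p c * br b a := by
    simp [normMatrix, br]; ring
  have h2 : (normMatrix a b c) 0 0 * hx p + (normMatrix a b c) 0 1 * hy p = br p a * br b c := by
    simp [normMatrix, br]; ring
  rw [h1, h2]
  simp [br_ne_zero hab.symm, br_eq_zero_iff]

lemma normGL_spec {a b c : Sphere} (hab : a ≠ b) (hac : a ≠ c) (hbc : b ≠ c) :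
    normGL a b c • a = ((0 : ℂ) : Sphere) ∧ normGL a b c • b = ((1 : ℂ) : Sphere) ∧
      normGL a b c • c = OnePoint.infty := by
  refine ⟨?_, ?_, ?_⟩
  · rw [normGL_smul hab hac hbc, if_neg hac, (br_eq_zero_iff a a).2 rfl]; simp
  · rw [normGL_smul hab hac hbc, if_neg hbc, mul_comm,
      div_self (mul_ne_zero (br_ne_zero hbc) (br_ne_zero hab.symm))]
  · rw [normGL_smul hab hac hbc, if_pos rfl]

lemma smul_trivial (h : GL (Fin 2) ℂ) (h0 : h • ((0 : ℂ) : Sphere) = ((0 : ℂ) : Sphere))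
    (h1 : h • ((1 : ℂ) : Sphere) = ((1 : ℂ) : Sphere))
    (h2 : h • (OnePoint.infty : Sphere) = OnePoint.infty) (p : Sphere) : h • p = p := by
  have e10 : h 1 0 = 0 := OnePoint.smul_infty_eq_self_iff.1 h2
  have hdet := h.det_ne_zero
  rw [Matrix.det_fin_two, e10, mul_zero, sub_zero] at hdet
  have e11 : h 1 1 ≠ 0 := right_ne_zero_of_mul hdet
  rw [OnePoint.smul_some_eq_ite] at h0 h1
  have e01 : h 0 1 = 0 := by simpa [e10, e11] using h0
  have e00 : h 0 0 = h 1 1 := by simpa [e10, e11, e01, div_eq_one_iff_eq] using h1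
  induction p using OnePoint.rec with
  | infty => exact h2
  | coe t =>
    rw [OnePoint.smul_some_eq_ite, e10, e01, e00]
    simp [e11]

lemma smul_ext {a b c : Sphere} (hab : a ≠ b) (hac : a ≠ c) (hbc : b ≠ c) {f g : GL (Fin 2) ℂ}
    (ha : f • a = g • a) (hb : f • b = g • b) (hc : f • c = g • c) (p : Sphere) :
    f • p = g • p := by
  set n := normGL a b c
  obtain ⟨na, nb, nc⟩ := normGL_spec hab hac hbc
  have key : ∀ q : Sphere, (n * (g⁻¹ * f) * n⁻¹) • q = q := by
    apply smul_trivial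
    · rw [← na]; simp [mul_smul, ha, n]
    · rw [← nb]; simp [mul_smul, hb, n]
    · rw [← nc]; simp [mul_smul, hc, n]
  have := key (n • p)
  simp only [mul_smul, inv_smul_smul] at this
  have h3 := MulAction.injective n this
  rwa [inv_smul_eq_iff] at h3

/-- `normGL a b c` is the unique linear fractional transformation with
`a ↦ 0`, `b ↦ 1`, `c ↦ ∞`. -/
lemma normGL_unique {a b c : Sphere} (hab : a ≠ b) (hac : a ≠ c) (hbc : b ≠ c) {f : GL (Fin 2) ℂ}
    (ha : f • a = ((0 : ℂ) : Sphere)) (hb : f • b = ((1 : ℂ) : Sphere))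
    (hc : f • c = OnePoint.infty) (p : Sphere) : f • p = normGL a b c • p := by
  obtain ⟨na, nb, nc⟩ := normGL_spec hab hac hbc
  exact smul_ext hab hac hbc (ha.trans na.symm) (hb.trans nb.symm) (hc.trans nc.symm) p

/-! ### The space `K_n`, `n = N + 3`, and the maps `g_σ` -/

/-- The configuration space `K_n ⊆ ℂ^(n-3)`, where `n = N + 3`. -/
def K (N : ℕ) : Set (Fin N → ℂ) :=
  {l | (∀ i, l i ≠ 0 ∧ l i ≠ 1) ∧ ∀ i j, i ≠ j → l i ≠ l j}

/-- The `n = N + 3` marked points `0, 1, ∞, λ¹, …, λᴺ` (indexed from `0`). -/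
def mark {N : ℕ} (l : Fin N → ℂ) : Fin (N + 3) → Sphere :=
  Fin.cons ((0 : ℂ) : Sphere) (Fin.cons ((1 : ℂ) : Sphere)
    (Fin.cons (OnePoint.infty : Sphere) (fun i => ((l i : ℂ) : Sphere))))

/-- The set `[λ] = {0, 1, ∞, λ¹, …, λᴺ}`. -/
def markedSet {N : ℕ} (l : Fin N → ℂ) : Set Sphere := Set.range (mark l)

/-- The index in `Fin (N + 3)` of the marked point `λⁱ`. -/
def idx {N : ℕ} (i : Fin N) : Fin (N + 3) := i.succ.succ.succ

@[simp] lemma mark_zero {N : ℕ} (l : Fin N → ℂ) : mark l 0 = ((0 : ℂ) : Sphere) := rfl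
@[simp] lemma mark_one {N : ℕ} (l : Fin N → ℂ) : mark l 1 = ((1 : ℂ) : Sphere) := rfl
@[simp] lemma mark_two {N : ℕ} (l : Fin N → ℂ) : mark l 2 = OnePoint.infty := rfl
@[simp] lemma mark_idx {N : ℕ} (l : Fin N → ℂ) (i : Fin N) : mark l (idx i) = (l i : Sphere) := rfl

lemma idx_cases {N : ℕ} {P : Fin (N + 3) → Prop} (h0 : P 0) (h1 : P 1) (h2 : P 2)
    (h3 : ∀ i, P (idx i)) (k : Fin (N + 3)) : P k := by
  refine Fin.cases h0 (fun k => ?_) k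
  refine Fin.cases h1 (fun k => ?_) k
  exact Fin.cases h2 h3 k

lemma idx_injective {N : ℕ} : Function.Injective (idx : Fin N → Fin (N + 3)) := fun i j h => by
  simpa [idx] using h

lemma idx_ne_zero {N : ℕ} (i : Fin N) : idx i ≠ 0 := Fin.succ_ne_zero _
lemma idx_ne_one {N : ℕ} (i : Fin N) : idx i ≠ 1 := fun h => by
  have := congrArg Fin.val h
  simp [idx] at this
lemma idx_ne_two {N : ℕ} (i : Fin N) : idx i ≠ 2 := fun h => by
  have h2 : 2 % (N + 3) = 2 := Nat.mod_eq_of_lt (by omega)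
  have := congrArg Fin.val h
  simp [idx, h2] at this

lemma mark_injective_iff {N : ℕ} (l : Fin N → ℂ) : Function.Injective (mark l) ↔ l ∈ K N := by
  constructor
  · intro h
    refine ⟨fun i => ⟨fun h0 => idx_ne_zero i (h ?_), fun h1 => idx_ne_one i (h ?_)⟩,
      fun i j hij h2 => hij (idx_injective (h ?_))⟩
    · simp [h0]
    · simp [h1]
    · simp [h2]
  · rintro ⟨h1, h2⟩ k k'
    have h3 : ∀ i j, l i = l j → i = j := fun i j h => by
      by_contra hij
      exact h2 i j hij h
    induction k using idx_cases <;> induction k' using idx_cases <;>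
      intro h <;> first
        | rfl
        | (exfalso; simp [OnePoint.infty_ne_coe, OnePoint.coe_ne_infty] at h; done)
        | (exfalso; simp only [mark_idx, mark_zero, mark_one, OnePoint.coe_eq_coe] at h
           first
            | exact (h1 _).1 h
            | exact (h1 _).2 h
            | exact (h1 _).1 h.symm
            | exact (h1 _).2 h.symm)
        | (simp only [mark_idx, OnePoint.coe_eq_coe] at h
           rw [h3 _ _ h])

lemma mark_ne {N : ℕ} {l : Fin N → ℂ} (hl : l ∈ K N) {j k : Fin (N + 3)} (h : j ≠ k) :
    mark l j ≠ mark l k := fun h' => h ((mark_injective_iff l).2 hl h')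

lemma mark_ext {N : ℕ} {l m : Fin N → ℂ} (h : ∀ k, mark l k = mark m k) : l = m := by
  funext i
  simpa using h (idx i)

/-- The linear fractional transformation `f_σ^λ` taking the marked points with indices
`σ⁻¹(1), σ⁻¹(2), σ⁻¹(3)` to `0, 1, ∞` (indices are written from `0` here). -/
def fGL {N : ℕ} (σ : Equiv.Perm (Fin (N + 3))) (l : Fin N → ℂ) : GL (Fin 2) ℂ :=
  normGL (mark l (σ⁻¹ 0)) (mark l (σ⁻¹ 1)) (mark l (σ⁻¹ 2))

/-- The map `g_σ`, whose `i`-th component is `f_σ^λ` at the marked point with index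
`σ⁻¹(i + 3)`; that value is a finite number for `λ` in `K N` (see `fGL_smul_mark`). -/
def gMap {N : ℕ} (σ : Equiv.Perm (Fin (N + 3))) (l : Fin N → ℂ) : Fin N → ℂ :=
  fun i => (fGL σ l • mark l (σ⁻¹ (idx i))).elim 0 (fun t => t)

lemma perm_ne {N : ℕ} (σ : Equiv.Perm (Fin (N + 3))) {j k : Fin (N + 3)} (h : j ≠ k) :
    σ⁻¹ j ≠ σ⁻¹ k := fun h' => h (σ⁻¹.injective h')

lemma zero_ne_one' {N : ℕ} : (0 : Fin (N + 3)) ≠ 1 := fun h => by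
  have := congrArg Fin.val h
  simp at this
lemma zero_ne_two' {N : ℕ} : (0 : Fin (N + 3)) ≠ 2 := fun h => by
  have h2 : 2 % (N + 3) = 2 := Nat.mod_eq_of_lt (by omega)
  have := congrArg Fin.val h
  simp [h2] at this
lemma one_ne_two' {N : ℕ} : (1 : Fin (N + 3)) ≠ 2 := fun h => by
  have h2 : 2 % (N + 3) = 2 := Nat.mod_eq_of_lt (by omega)
  have := congrArg Fin.val h
  simp [h2] at this

/-- `f_σ^λ` takes the `σ⁻¹(k)`-th marked point of `λ` to the `k`-th marked point of `g_σ(λ)`. -/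
lemma fGL_smul_mark {N : ℕ} (σ : Equiv.Perm (Fin (N + 3))) {l : Fin N → ℂ} (hl : l ∈ K N)
    (k : Fin (N + 3)) : fGL σ l • mark l (σ⁻¹ k) = mark (gMap σ l) k := by
  have h01 := mark_ne hl (perm_ne σ (zero_ne_one' (N := N)))
  have h02 := mark_ne hl (perm_ne σ (zero_ne_two' (N := N)))
  have h12 := mark_ne hl (perm_ne σ (one_ne_two' (N := N)))
  obtain ⟨s0, s1, s2⟩ := normGL_spec h01 h02 h12
  induction k using idx_cases with
  | h0 => exact s0
  | h1 => exact s1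
  | h2 => exact s2
  | h3 i =>
    have h : fGL σ l • mark l (σ⁻¹ (idx i)) ≠ OnePoint.infty := by
      rw [← s2]
      intro h'
      exact mark_ne hl (perm_ne σ (idx_ne_two i)) (MulAction.injective _ h')
    obtain ⟨t, ht⟩ := OnePoint.ne_infty_iff_exists.1 h
    rw [mark_idx, gMap, ← ht]
    rfl

lemma gMap_mem {N : ℕ} (σ : Equiv.Perm (Fin (N + 3))) {l : Fin N → ℂ} (hl : l ∈ K N) :
    gMap σ l ∈ K N := by
  rw [← mark_injective_iff]
  intro j k h
  rw [← fGL_smul_mark σ hl, ← fGL_smul_mark σ hl] at h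
  exact σ⁻¹.injective ((mark_injective_iff l).2 hl (MulAction.injective _ h))

lemma gMap_one {N : ℕ} {l : Fin N → ℂ} (hl : l ∈ K N) : gMap 1 l = l := by
  apply mark_ext
  intro k
  rw [← fGL_smul_mark 1 hl k]
  have h01 := mark_ne hl (zero_ne_one' (N := N))
  have h02 := mark_ne hl (zero_ne_two' (N := N))
  have h12 := mark_ne hl (one_ne_two' (N := N))
  have := normGL_unique h01 h02 h12 (f := 1) (one_smul _ _) (one_smul _ _) (one_smul _ _)
    (mark l k)
  exact this.symm.trans (one_smul _ _)

lemma gMap_mul {N : ℕ} (π σ : Equiv.Perm (Fin (N + 3))) {l : Fin N → ℂ} (hl : l ∈ K N) :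
    gMap (π * σ) l = gMap π (gMap σ l) := by
  have hm := gMap_mem σ hl
  have key : ∀ k, (fGL π (gMap σ l) * fGL σ l) • mark l ((π * σ)⁻¹ k)
      = mark (gMap π (gMap σ l)) k := by
    intro k
    rw [mul_smul, mul_inv_rev, Equiv.Perm.mul_apply, fGL_smul_mark σ hl, fGL_smul_mark π hm]
  apply mark_ext
  intro k
  rw [← key k, ← fGL_smul_mark (π * σ) hl k]
  exact (normGL_unique (mark_ne hl (perm_ne (π * σ) (zero_ne_one' (N := N))))
    (mark_ne hl (perm_ne (π * σ) (zero_ne_two' (N := N))))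
    (mark_ne hl (perm_ne (π * σ) (one_ne_two' (N := N)))) (key 0) (key 1) (key 2) _).symm

/-- The action of `S_n` on `K_n` by the maps `g_σ`. -/
abbrev permAction (N : ℕ) : MulAction (Equiv.Perm (Fin (N + 3))) (K N) where
  smul σ l := ⟨gMap σ l.1, gMap_mem σ l.2⟩
  one_smul l := Subtype.ext (gMap_one l.2)
  mul_smul π σ l := Subtype.ext (gMap_mul π σ l.2)

/-- The homomorphism `σ ↦ g_σ` to the permutations of `K_n`. -/
def gHom (N : ℕ) : Equiv.Perm (Fin (N + 3)) →* Equiv.Perm (K N) :=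
  @MulAction.toPermHom _ _ _ (permAction N)

@[simp] lemma gHom_apply {N : ℕ} (σ : Equiv.Perm (Fin (N + 3))) (l : K N) :
    (gHom N σ l : Fin N → ℂ) = gMap σ l := rfl

/-- The group `G = {g_σ | σ ∈ S_n}` of permutations of `K_n`. -/
def G (N : ℕ) : Subgroup (Equiv.Perm (K N)) := (gHom N).range

/-- The stabilizer `G_λ` of `λ` in `G`. -/
abbrev Stab {N : ℕ} (l : K N) : Subgroup (G N) := MulAction.stabilizer (G N) l

/-! ### The tangent representation -/

open Classical in
/-- A self-map of `K_n`, extended by the identity to `ℂ^(n-3)`; only its values on the open set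
`K_n` matter below. -/
def extend {N : ℕ} (g : Equiv.Perm (K N)) (x : Fin N → ℂ) : Fin N → ℂ :=
  if h : x ∈ K N then g ⟨x, h⟩ else x

lemma extend_coe {N : ℕ} (g : Equiv.Perm (K N)) (l : K N) : extend g l.1 = (g l).1 := by
  rw [extend, dif_pos l.2]

lemma extend_one {N : ℕ} : extend (1 : Equiv.Perm (K N)) = id := by
  funext x
  by_cases h : x ∈ K N <;> simp [extend, h]

lemma extend_mul {N : ℕ} (g h : Equiv.Perm (K N)) : extend (g * h) = extend g ∘ extend h := by
  funext x
  by_cases hx : x ∈ K N <;> simp [extend, hx]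

lemma isOpen_K (N : ℕ) : IsOpen (K N) := by
  have : K N = (⋂ i, {l | l i ≠ 0} ∩ {l | l i ≠ 1}) ∩
      ⋂ i, ⋂ j, {l : Fin N → ℂ | i ≠ j → l i ≠ l j} := by
    ext l; simp [K]
  rw [this]
  refine IsOpen.inter (isOpen_iInter_of_finite fun i => IsOpen.inter ?_ ?_)
    (isOpen_iInter_of_finite fun i => isOpen_iInter_of_finite fun j => ?_)
  · exact isOpen_ne_fun (continuous_apply i) continuous_const
  · exact isOpen_ne_fun (continuous_apply i) continuous_const
  · by_cases h : i = j
    · simp [h]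
    · simpa [h] using isOpen_ne_fun (continuous_apply i) (continuous_apply j)

lemma differentiable_hx {N : ℕ} (k : Fin (N + 3)) :
    Differentiable ℂ (fun l : Fin N → ℂ => hx (mark l k)) := by
  induction k using idx_cases with
  | h0 => simp
  | h1 => simp
  | h2 => simp
  | h3 i => simpa using differentiable_apply i

lemma differentiable_hy {N : ℕ} (k : Fin (N + 3)) :
    Differentiable ℂ (fun l : Fin N → ℂ => hy (mark l k)) := by
  induction k using idx_cases <;> simp

lemma differentiable_br {N : ℕ} (j k : Fin (N + 3)) :
    Differentiable ℂ (fun l : Fin N → ℂ => br (mark l j) (mark l k)) :=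
  ((differentiable_hx j).mul (differentiable_hy k)).sub
    ((differentiable_hx k).mul (differentiable_hy j))

/-- The components of `g_σ` as rational functions. -/
lemma gMap_apply {N : ℕ} (σ : Equiv.Perm (Fin (N + 3))) {l : Fin N → ℂ} (hl : l ∈ K N)
    (i : Fin N) : gMap σ l i =
      (br (mark l (σ⁻¹ (idx i))) (mark l (σ⁻¹ 0)) * br (mark l (σ⁻¹ 1)) (mark l (σ⁻¹ 2))) /
      (br (mark l (σ⁻¹ (idx i))) (mark l (σ⁻¹ 2)) * br (mark l (σ⁻¹ 1)) (mark l (σ⁻¹ 0))) := by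
  rw [gMap, fGL, normGL_smul (mark_ne hl (perm_ne σ zero_ne_one'))
    (mark_ne hl (perm_ne σ zero_ne_two')) (mark_ne hl (perm_ne σ one_ne_two')),
    if_neg (mark_ne hl (perm_ne σ (idx_ne_two i)))]
  rfl

lemma differentiableAt_gMap {N : ℕ} (σ : Equiv.Perm (Fin (N + 3))) {l : Fin N → ℂ}
    (hl : l ∈ K N) : DifferentiableAt ℂ (gMap σ) l := by
  rw [differentiableAt_pi]
  intro i
  have hev : (fun m : Fin N → ℂ => gMap σ m i) =ᶠ[nhds l] fun m =>
      (br (mark m (σ⁻¹ (idx i))) (mark m (σ⁻¹ 0)) * br (mark m (σ⁻¹ 1)) (mark m (σ⁻¹ 2))) /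
      (br (mark m (σ⁻¹ (idx i))) (mark m (σ⁻¹ 2)) * br (mark m (σ⁻¹ 1)) (mark m (σ⁻¹ 0))) := by
    filter_upwards [(isOpen_K N).mem_nhds hl] with m hm using gMap_apply σ hm i
  refine DifferentiableAt.congr_of_eventuallyEq ?_ hev
  have hbr : ∀ a b c d : Fin (N + 3), DifferentiableAt ℂ
      (fun m : Fin N → ℂ => br (mark m a) (mark m b) * br (mark m c) (mark m d)) l := fun a b c d =>
    ((differentiable_br a b).mul (differentiable_br c d)).differentiableAt
  have hne := mul_ne_zero (br_ne_zero (mark_ne hl (perm_ne σ (idx_ne_two i))))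
    (br_ne_zero (mark_ne hl (perm_ne σ zero_ne_one'.symm)))
  simp only [div_eq_mul_inv]
  exact (hbr _ _ _ _).fun_mul ((hbr (σ⁻¹ (idx i)) (σ⁻¹ 2) (σ⁻¹ 1) (σ⁻¹ 0)).fun_inv hne)

lemma extend_gHom_eventuallyEq {N : ℕ} (σ : Equiv.Perm (Fin (N + 3))) {l : Fin N → ℂ}
    (hl : l ∈ K N) : extend (gHom N σ) =ᶠ[nhds l] gMap σ := by
  filter_upwards [(isOpen_K N).mem_nhds hl] with m hm
  exact extend_coe (gHom N σ) ⟨m, hm⟩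

lemma differentiableAt_extend {N : ℕ} (g : G N) (l : K N) :
    DifferentiableAt ℂ (extend g.1) l.1 := by
  obtain ⟨σ, hσ⟩ := g.2
  rw [← hσ]
  exact (differentiableAt_gMap σ l.2).congr_of_eventuallyEq (extend_gHom_eventuallyEq σ l.2)

/-- The representation `X_λ` of `G_λ` on `ℂ^(n-3)`: an element acts by its Jacobian at `λ`. -/
def tangentRep {N : ℕ} (l : K N) : Representation ℂ (Stab l) (Fin N → ℂ) where
  toFun g := (fderiv ℂ (extend g.1.1) l.1 : (Fin N → ℂ) →ₗ[ℂ] (Fin N → ℂ))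
  map_one' := by
    change ((fderiv ℂ (extend (1 : Equiv.Perm (K N))) l.1 :
      (Fin N → ℂ) →L[ℂ] (Fin N → ℂ)) : (Fin N → ℂ) →ₗ[ℂ] (Fin N → ℂ)) = 1
    rw [extend_one, fderiv_id]
    rfl
  map_mul' g h := by
    have hfix : extend h.1.1 l.1 = l.1 := by
      rw [extend_coe]
      exact congrArg Subtype.val (MulAction.mem_stabilizer_iff.1 h.2)
    change ((fderiv ℂ (extend (g.1.1 * h.1.1)) l.1 :
      (Fin N → ℂ) →L[ℂ] (Fin N → ℂ)) : (Fin N → ℂ) →ₗ[ℂ] (Fin N → ℂ)) = _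
    rw [extend_mul, fderiv_comp l.1 (by rw [hfix]; exact differentiableAt_extend g.1 l)
      (differentiableAt_extend h.1 l), hfix]
    rfl

/-- `X_λ(g_σ)` is the derivative of the rational map `g_σ` at `λ`. -/
lemma tangentRep_apply {N : ℕ} (l : K N) (g : Stab l) (σ : Equiv.Perm (Fin (N + 3)))
    (h : gHom N σ = g.1.1) :
    tangentRep l g = (fderiv ℂ (gMap σ) l.1 : (Fin N → ℂ) →ₗ[ℂ] (Fin N → ℂ)) := by
  change ((fderiv ℂ (extend g.1.1) l.1 :
      (Fin N → ℂ) →L[ℂ] (Fin N → ℂ)) : (Fin N → ℂ) →ₗ[ℂ] (Fin N → ℂ)) = _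
  rw [← h, (extend_gHom_eventuallyEq σ l.2).fderiv_eq]

/-! ### Conjugacy classes, irreducible representations and multiplicity vectors -/

/-- The rotation `z ↦ exp(iθ) z` of the Riemann sphere. -/
def rotation (θ : ℝ) : GL (Fin 2) ℂ :=
  Matrix.GeneralLinearGroup.mkOfDetNeZero !![Complex.exp (θ * Complex.I), 0; 0, 1]
    (by simp [Matrix.det_fin_two_of, Complex.exp_ne_zero])

/-- `g ∈ G_λ` is `g_σ` for some `σ` whose linear fractional transformation `f_σ^λ` is conjugate,
in the group of linear fractional transformations, to the rotation of angle `θ`. -/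
def IsRotationOfAngle {N : ℕ} {l : K N} (θ : ℝ) (g : Stab l) : Prop :=
  ∃ σ : Equiv.Perm (Fin (N + 3)), gHom N σ = g.1.1 ∧
    ∃ ψ ∈ linearFractional,
      ψ * MulAction.toPerm (fGL σ l.1) * ψ⁻¹ = MulAction.toPerm (rotation θ)

/-- The rotation angles of the five conjugacy classes `K⁽¹⁾, …, K⁽⁵⁾`. -/
def classAngle : Fin 5 → ℝ :=
  ![0, 2 * Real.pi / 5, 4 * Real.pi / 5, 2 * Real.pi / 3, Real.pi]

/-- The degrees of the irreducible representations `X⁽¹⁾, …, X⁽⁵⁾`. -/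
def irrDegree : Fin 5 → ℕ := ![1, 4, 5, 3, 3]

/-- The character table of `A₅`; rows are the irreducible characters, columns the classes. -/
def charTable : Matrix (Fin 5) (Fin 5) ℝ :=
  !![1, 1, 1, 1, 1;
     4, -1, -1, 1, 0;
     5, 0, 0, -1, 1;
     3, (1 + √5) / 2, (1 - √5) / 2, 0, -1;
     3, (1 - √5) / 2, (1 + √5) / 2, 0, -1]

/-- `X` is the list `X⁽¹⁾, …, X⁽⁵⁾` of the irreducible representations of `G_λ ≅ A₅`, in the order
of the character table. -/
structure IsIrreducibleList {N : ℕ} (l : K N)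
    (X : ∀ i : Fin 5, Representation ℂ (Stab l) (Fin (irrDegree i) → ℂ)) : Prop where
  irreducible : ∀ i, (X i).IsIrreducible
  character : ∀ (i c : Fin 5) (g : Stab l), IsRotationOfAngle (classAngle c) g →
    (X i).character g = (charTable i c : ℂ)

/-- `p = (p₁, …, p₅)` is the multiplicity vector of `λ`: `X_λ` is isomorphic to
`p₁ X⁽¹⁾ ⊕ ⋯ ⊕ p₅ X⁽⁵⁾`. -/
def IsMultiplicityVector {N : ℕ} (l : K N) (p : Fin 5 → ℕ) : Prop :=
  ∃ X : ∀ i : Fin 5, Representation ℂ (Stab l) (Fin (irrDegree i) → ℂ),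
    IsIrreducibleList l X ∧
      Nonempty ((tangentRep l).Equiv
        (Representation.directSum fun j : (Σ i : Fin 5, Fin (p i)) => X j.1))

/-! ### The regular dodecahedron and the orbits of the icosahedral group on the sphere -/

/-- The unit sphere `S²` in `ℝ³`. -/
def S2 : Set (Fin 3 → ℝ) := {v | v 0 ^ 2 + v 1 ^ 2 + v 2 ^ 2 = 1}

/-- Stereographic projection `S² → ℂ ∪ {∞}` from the north pole. -/
def stereo (v : Fin 3 → ℝ) : Sphere :=
  if v 2 = 1 then OnePoint.infty else (((v 0 + v 1 * Complex.I) / (1 - v 2) : ℂ) : Sphere)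

/-- Signs. -/
def IsSign (s : ℝ) : Prop := s = 1 ∨ s = -1

/-- Cyclic permutation of coordinates. -/
def cyc (k : Fin 3) (v : Fin 3 → ℝ) : Fin 3 → ℝ := fun i => v (i + k)

/-- The 20 vertices of a regular dodecahedron inscribed in `S²`: the points `(±1, ±1, ±1) / √3`
and the cyclic permutations of `(0, ±φ⁻¹, ±φ) / √3`, where `φ` is the golden ratio. -/
def dodecVertices : Set (Fin 3 → ℝ) :=
  {v | (∃ r s t, IsSign r ∧ IsSign s ∧ IsSign t ∧ v = (√3)⁻¹ • ![r, s, t]) ∨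
    ∃ k s t, IsSign s ∧ IsSign t ∧
      v = cyc k ((√3)⁻¹ • ![0, s * Real.goldenRatio⁻¹, t * Real.goldenRatio])}

/-- The projections to `S²` of the 12 face centres of this dodecahedron: the cyclic permutations of
`(±1, 0, ±φ) / √(1 + φ²)`. -/
def dodecFaces : Set (Fin 3 → ℝ) :=
  {v | ∃ k s t, IsSign s ∧ IsSign t ∧
    v = cyc k ((√(1 + Real.goldenRatio ^ 2))⁻¹ • ![s, 0, t * Real.goldenRatio])}

/-- The projections to `S²` of the midpoints of the 30 edges of this dodecahedron: the points
`±e₁, ±e₂, ±e₃` and the cyclic permutations of `(±1, ±φ, ±φ²) / (2φ)`. -/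
def dodecEdges : Set (Fin 3 → ℝ) :=
  {v | (∃ k s, IsSign s ∧ v = cyc k ![0, 0, s]) ∨
    ∃ k r s t, IsSign r ∧ IsSign s ∧ IsSign t ∧
      v = cyc k ((2 * Real.goldenRatio)⁻¹ •
        ![r, s * Real.goldenRatio, t * Real.goldenRatio ^ 2])}

/-- The icosahedral group: the rotations about the origin that preserve the dodecahedron. -/
def icosahedralRotations : Set (Matrix (Fin 3) (Fin 3) ℝ) :=
  {A | A ∈ Matrix.specialOrthogonalGroup (Fin 3) ℝ ∧
    (fun v => A.mulVec v) '' dodecVertices = dodecVertices}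

/-- The orbit `B(a)` of a point under the icosahedral group. -/
def orbit (a : Fin 3 → ℝ) : Set (Fin 3 → ℝ) := {v | ∃ A ∈ icosahedralRotations, v = A.mulVec a}

/-- The points of `S²` that are neither vertices, nor face centres, nor edge midpoints. -/
def genericPoints : Set (Fin 3 → ℝ) := S2 \ (dodecVertices ∪ dodecFaces ∪ dodecEdges)

/-- The eight types `F+mB`, `V+mB`, `E+mB`, `FV+mB`, `VE+mB`, `EF+mB`, `FVE+mB`, `(1+m)B`. -/
inductive OrbitType
  | F | V | E | FV | VE | EF | FVE | B

namespace OrbitType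

/-- The union of the exceptional orbits in a set of the given type. -/
def exceptional : OrbitType → Set (Fin 3 → ℝ)
  | F => dodecFaces
  | V => dodecVertices
  | E => dodecEdges
  | FV => dodecFaces ∪ dodecVertices
  | VE => dodecVertices ∪ dodecEdges
  | EF => dodecEdges ∪ dodecFaces
  | FVE => dodecFaces ∪ dodecVertices ∪ dodecEdges
  | B => ∅

/-- The number of orbits of order 60 in a set of the given type with parameter `m`. -/
def numGeneric : OrbitType → ℕ → ℕ
  | B, m => 1 + m
  | _, m => m

/-- The multiplicity vector attached to a type with parameter `m`. -/
def multiplicity : OrbitType → ℕ → Fin 5 → ℕ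
  | F, m => ![m, 1 + 4 * m, 1 + 5 * m, 3 * m, 3 * m]
  | V, m => ![m, 1 + 4 * m, 2 + 5 * m, 3 * m, 1 + 3 * m]
  | E, m => ![m, 2 + 4 * m, 2 + 5 * m, 1 + 3 * m, 2 + 3 * m]
  | FV, m => ![m, 2 + 4 * m, 3 + 5 * m, 1 + 3 * m, 1 + 3 * m]
  | VE, m => ![m, 3 + 4 * m, 4 + 5 * m, 2 + 3 * m, 3 + 3 * m]
  | EF, m => ![m, 3 + 4 * m, 3 + 5 * m, 2 + 3 * m, 2 + 3 * m]
  | FVE, m => ![m, 4 + 4 * m, 5 + 5 * m, 3 + 3 * m, 3 + 3 * m]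
  | B, m => ![1 + m, 4 + 4 * m, 5 + 5 * m, 2 + 3 * m, 3 + 3 * m]

end OrbitType

/-- A subset of `S²` is of type `t` with parameter `m` if it is the union of the exceptional orbits
named by `t` and of `t.numGeneric m` different orbits of generic points. -/
def IsOfType (t : OrbitType) (m : ℕ) (α : Set (Fin 3 → ℝ)) : Prop :=
  ∃ a : Fin (t.numGeneric m) → (Fin 3 → ℝ), (∀ i, a i ∈ genericPoints) ∧
    (∀ i j, i ≠ j → orbit (a i) ≠ orbit (a j)) ∧ α = t.exceptional ∪ ⋃ i, orbit (a i)

/-- `λ` is of type `t` with parameter `m` if a linear fractional transformation takes a set of that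
type (moved to the Riemann sphere by stereographic projection) to `[λ]`. -/
def HasType {N : ℕ} (l : K N) (t : OrbitType) (m : ℕ) : Prop :=
  ∃ α, IsOfType t m α ∧ ∃ φ ∈ linearFractional, φ '' (stereo '' α) = markedSet l.1

end ModuliZero

end

/-! The transformation `f_σ` permutes the marked points exactly when `g_σ` fixes `λ`, and for `n ≥
5` different `σ` give different `g_σ` (`gHom_injective`). So the group of linear fractional
transformations preserving `[λ]` is isomorphic to `G_λ`, and an isomorphism `G_λ ≅ A₅` is a copy of
`A₅` in `PGL₂(ℂ)`. The invariant `tr² / det` separates its conjugacy classes, and two generators of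
orders 2 and 3 with product of order 5 are determined up to simultaneous conjugation by the
invariants of the pair and of the product (`exists_simultaneous_conj`). Hence one transformation
carries this copy of `A₅` to the rotations of the dodecahedron and `[λ]` to a finite invariant
subset of `S²` (`exists_realizes`). Such a subset is a union of orbits, namely some of `F`, `V`, `E`
and free orbits, and this is the type (`exists_isOfType`).

The multiplicities follow from the character of `X_λ`. Cross ratios present `K_n` as configurations
of `n` vectors in `ℂ²` modulo matrices and rescalings. At a fixed point of `g_σ` this gives an
equivariant exact sequence `0 → sl₂ ⊕ ℂⁿ → (ℂ²)ⁿ → ℂⁿ⁻³ → 0`, hence a fixed point formula for the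
trace (`trace_fderiv_gMap`). A nontrivial rotation has trace `-1` if the ends of its axis are marked
and `1 - tr² / det` if neither is (`Realizes.tangentCharacter_eq`). The identity has trace `n - 3`,
found by counting points in orbits. The axes of orders 5, 3, 2 end in `F`, `V`, `E`, so the
character depends only on the type and `m`, and the invertibility of the character table gives the
vector (`sum_multiplicity`, `eq_of_sum_charTable_eq`).

The irreducible representations themselves also have to be produced. The adjoint representation on
`sl₂` is `X⁽⁴⁾`; its twist by the outer automorphism is `X⁽⁵⁾`, and the others split off from tensor
products (`exists_irreducibles`). The condition `IsAdapted` settles which of the two classes of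
five-cycles has angle `2π/5`. -/

noncomputable section

/-! ### Representations of finite groups: complements and splittings -/

namespace Representation

variable {G k V W U : Type*} [Group G] [Field k] [AddCommGroup V] [Module k V]
  [AddCommGroup W] [Module k W] [AddCommGroup U] [Module k U]

/-- A representation is the product of two complementary subrepresentations. -/
def prodEquivOfIsCompl (ρ : Representation k G V) (P Q : Subrepresentation ρ)
    (h : IsCompl P.toSubmodule Q.toSubmodule) :
    (P.toRepresentation.prod Q.toRepresentation).Equiv ρ :=
  Equiv.mk (Submodule.prodEquivOfIsCompl _ _ h) fun g => by
    ext x <;> simp [Subrepresentation.toRepresentation]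

/-- Maschke's theorem: the module over the group algebra is semisimple, so the lattice of
subrepresentations is complemented. -/
lemma exists_isCompl_subrepresentation [Finite G] [NeZero (Nat.card G : k)]
    (ρ : Representation k G V) (P : Subrepresentation ρ) :
    ∃ Q : Subrepresentation ρ, IsCompl P.toSubmodule Q.toSubmodule := by
  have : IsSemisimpleRepresentation ρ :=
    (isSemisimpleRepresentation_iff_isSemisimpleModule_asModule ρ).2 inferInstance
  obtain ⟨Q, hQ⟩ := exists_isCompl P
  refine ⟨Q, ?_, ?_⟩
  · rw [disjoint_iff, ← Subrepresentation.toSubmodule_inf, hQ.inf_eq_bot]; rfl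
  · rw [codisjoint_iff, ← Subrepresentation.toSubmodule_sup, hQ.sup_eq_top]; rfl

lemma char_prod [FiniteDimensional k V] [FiniteDimensional k W] (ρ : Representation k G V)
    (σ : Representation k G W) (g : G) :
    (ρ.prod σ).character g = ρ.character g + σ.character g :=
  LinearMap.trace_prodMap' (ρ g) (σ g)

/-- The product of two equivalences of representations. -/
def Equiv.prodCongr {V' W' : Type*} [AddCommGroup V'] [Module k V'] [AddCommGroup W']
    [Module k W'] {ρ : Representation k G V} {ρ' : Representation k G V'}
    {σ : Representation k G W} {σ' : Representation k G W'} (e : ρ.Equiv ρ') (f : σ.Equiv σ') :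
    (ρ.prod σ).Equiv (ρ'.prod σ') :=
  Equiv.mk (e.toLinearEquiv.prodCongr f.toLinearEquiv) fun g => by
    ext x
    · simpa using! IntertwiningMap.isIntertwining _ _ e.toIntertwiningMap g x
    · simp
    · simp
    · simpa using! IntertwiningMap.isIntertwining _ _ f.toIntertwiningMap g x

/-- An injective intertwining map is an equivalence onto its range. -/
def IntertwiningMap.equivRange {ρ : Representation k G V} {σ : Representation k G W}
    (f : IntertwiningMap ρ σ) (hf : Function.Injective f) :
    ρ.Equiv f.range.toRepresentation :=
  Equiv.mk (LinearEquiv.ofInjective f.toLinearMap hf) fun g => by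
    exact LinearMap.ext fun x => Subtype.ext (IntertwiningMap.isIntertwining _ _ f g x)

lemma exists_prod_equiv_of_injective [Finite G] [NeZero (Nat.card G : k)]
    {ρ : Representation k G V} {σ : Representation k G W}
    (f : IntertwiningMap ρ σ) (hf : Function.Injective f) :
    ∃ Q : Subrepresentation σ, Nonempty ((ρ.prod Q.toRepresentation).Equiv σ) := by
  obtain ⟨Q, hQ⟩ := exists_isCompl_subrepresentation σ f.range
  exact ⟨Q, ⟨(Equiv.prodCongr (f.equivRange hf) (Equiv.refl _)).trans
    (prodEquivOfIsCompl σ _ _ hQ)⟩⟩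

lemma exists_equiv_fin [FiniteDimensional k V] (ρ : Representation k G V) {d : ℕ}
    (hd : Module.finrank k V = d) :
    ∃ σ : Representation k G (Fin d → k), Nonempty (ρ.Equiv σ) := by
  let e : V ≃ₗ[k] (Fin d → k) := (Module.finBasisOfFinrankEq k V hd).equivFun
  refine ⟨(e.conjRingEquiv.toMonoidHom).comp ρ, ⟨Equiv.mk e fun g => ?_⟩⟩
  ext x
  simp [LinearEquiv.conjRingEquiv]

/-! ### Orthogonality of characters in characteristic zero -/

section CharZero

variable [Finite G] [CharZero k] [FiniteDimensional k V] [FiniteDimensional k W]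

/-- Orthogonality cleared of the division by the group order, which suits sums over conjugacy
classes. -/
lemma sum_char_mul_char_inv [Fintype G] (ρ : Representation k G V) (σ : Representation k G W) :
    ∑ g : G, σ.character g * ρ.character g⁻¹ =
      Nat.card G * (Module.finrank k (IntertwiningMap ρ σ) : k) := by
  have h0 : (Nat.card G : k) ≠ 0 := Nat.cast_ne_zero.2 Nat.card_pos.ne'
  have := invertibleOfNonzero h0
  rw [← card_inv_mul_sum_char_mul_char_eq_finrank, mul_inv_cancel_left₀ h0]

lemma exists_ne_zero_of_sum_ne_zero [Fintype G] {ρ : Representation k G V}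
    {σ : Representation k G W} (h : ∑ g : G, σ.character g * ρ.character g⁻¹ ≠ 0) :
    ∃ f : IntertwiningMap ρ σ, f ≠ 0 := by
  by_contra! h0
  have : Subsingleton (IntertwiningMap ρ σ) := ⟨fun a b => (h0 a).trans (h0 b).symm⟩
  exact h (by rw [sum_char_mul_char_inv, Module.finrank_zero_of_subsingleton]; simp)

/-- A representation with endomorphism ring of rank one is irreducible. -/
lemma isIrreducible_of_sum_char [Fintype G] (ρ : Representation k G V)
    (h : ∑ g : G, ρ.character g * ρ.character g⁻¹ = Nat.card G) : ρ.IsIrreducible := by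
  have h0 : (Nat.card G : k) ≠ 0 := Nat.cast_ne_zero.2 Nat.card_pos.ne'
  have : NeZero (Nat.card G : k) := ⟨h0⟩
  rw [sum_char_mul_char_inv] at h
  have h1 : Module.finrank k (IntertwiningMap ρ ρ) = 1 := by
    have := mul_left_cancel₀ h0 (h.trans (mul_one _).symm)
    exact_mod_cast this
  have hid : (IntertwiningMap.id ρ) ≠ 0 := by
    intro hid
    have : Subsingleton (IntertwiningMap ρ ρ) := ⟨fun a b => by
      have h2 : ∀ c : IntertwiningMap ρ ρ, c = 0 := fun c => by
        ext v
        have := congrArg (fun f : IntertwiningMap ρ ρ => c (f v)) hid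
        simpa using this
      rw [h2 a, h2 b]⟩
    rw [Module.finrank_zero_of_subsingleton] at h1
    exact zero_ne_one h1
  have hspan := (finrank_eq_one_iff_of_nonzero' _ hid).1 h1
  have hnt : ∃ v : V, v ≠ 0 := by
    by_contra! hv
    exact hid (IntertwiningMap.ext (LinearMap.ext fun v => by simp [hv v]))
  refine { exists_pair_ne := ⟨⊥, ⊤, fun hbt => ?_⟩, eq_bot_or_eq_top := fun P => ?_ }
  · obtain ⟨v, hv⟩ := hnt
    have : v ∈ (⊤ : Subrepresentation ρ).toSubmodule := Submodule.mem_top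
    rw [← hbt] at this
    exact hv ((Submodule.mem_bot k).1 this)
  · obtain ⟨Q, hQ⟩ := exists_isCompl_subrepresentation ρ P
    let e := prodEquivOfIsCompl ρ P Q hQ
    -- The projection onto `P` along `Q` is an endomorphism, hence a scalar: scalar zero forces `P =
    -- 0`, any other forces `Q = 0`.
    let π : IntertwiningMap ρ ρ := e.toIntertwiningMap.comp
      (((IntertwiningMap.inl k _ _).comp (IntertwiningMap.fst k _ _)).comp
        e.symm.toIntertwiningMap)
    have hP : ∀ x ∈ P.toSubmodule, π x = x := fun x hx => by
      have h3 : e.symm x = (⟨x, hx⟩, 0) := by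
        rw [← e.symm_apply_apply (⟨x, hx⟩, 0)]
        congr 1
        simp [e, prodEquivOfIsCompl]
      simp only [π, IntertwiningMap.comp_apply, Equiv.coe_toIntertwiningMap, h3]
      simp [e, prodEquivOfIsCompl, IntertwiningMap.inl, IntertwiningMap.prod]
    have hQ' : ∀ x ∈ Q.toSubmodule, π x = 0 := fun x hx => by
      have h3 : e.symm x = (0, ⟨x, hx⟩) := by
        rw [← e.symm_apply_apply (0, ⟨x, hx⟩)]
        congr 1
        simp [e, prodEquivOfIsCompl]
      simp only [π, IntertwiningMap.comp_apply, Equiv.coe_toIntertwiningMap, h3]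
      simp [e, prodEquivOfIsCompl, IntertwiningMap.inl, IntertwiningMap.prod]
    obtain ⟨c, hc⟩ := hspan π
    have hc' : ∀ x, π x = c • x := fun x => by rw [← hc]; rfl
    by_cases hc0 : c = 0
    · left
      apply Subrepresentation.toSubmodule_injective
      refine (Submodule.eq_bot_iff _).2 fun x hx => ?_
      rw [← hP x hx, hc', hc0, zero_smul]
    · right
      apply Subrepresentation.toSubmodule_injective
      have : Q.toSubmodule = ⊥ := (Submodule.eq_bot_iff _).2 fun x hx => by
        have := hQ' x hx
        rw [hc'] at this
        exact (smul_eq_zero.1 this).resolve_left hc0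
      rw [this] at hQ
      exact eq_top_of_isCompl_bot hQ

/-- An irreducible representation whose character is not orthogonal to that of `σ` splits off
from `σ`. -/
lemma exists_character_sub [Fintype G] {ρ : Representation k G V} [ρ.IsIrreducible]
    {σ : Representation k G W} (h : ∑ g : G, σ.character g * ρ.character g⁻¹ ≠ 0) {d : ℕ}
    (hd : Module.finrank k W = Module.finrank k V + d) :
    ∃ τ : Representation k G (Fin d → k),
      ∀ g, τ.character g = σ.character g - ρ.character g := by
  have : NeZero (Nat.card G : k) := ⟨Nat.cast_ne_zero.2 Nat.card_pos.ne'⟩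
  obtain ⟨f, hf⟩ := exists_ne_zero_of_sum_ne_zero h
  obtain ⟨Q, ⟨e⟩⟩ := exists_prod_equiv_of_injective f
    ((IsIrreducible.injective_or_eq_zero f).resolve_right hf)
  have hd' : Module.finrank k Q.toSubmodule = d := by
    have := e.toLinearEquiv.finrank_eq
    rw [Module.finrank_prod] at this
    omega
  obtain ⟨τ, ⟨e'⟩⟩ := exists_equiv_fin Q.toRepresentation hd'
  refine ⟨τ, fun g => ?_⟩
  rw [← char_iso e, ← char_iso e', char_prod, add_sub_cancel_left]

end CharZero

/-- Finite-dimensional representations of a finite group in characteristic zero are determined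
by their characters. -/
theorem nonempty_equiv_of_character_eq [Finite G] [CharZero k] :
    ∀ (n : ℕ) {V : Type*} {W : Type*} [AddCommGroup V] [Module k V] [FiniteDimensional k V]
      [AddCommGroup W] [Module k W] [FiniteDimensional k W] (ρ : Representation k G V)
      (σ : Representation k G W), Module.finrank k V = n → ρ.character = σ.character →
      Nonempty (ρ.Equiv σ) := by
  have := Fintype.ofFinite G
  have h0 : (Nat.card G : k) ≠ 0 := Nat.cast_ne_zero.2 Nat.card_pos.ne'
  have : NeZero (Nat.card G : k) := ⟨h0⟩
  intro n
  induction n using Nat.strong_induction_on with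
  | _ n ih =>
  intro V W _ _ _ _ _ _ ρ σ hn hχ
  have hdim : Module.finrank k V = Module.finrank k W := by
    have := congrFun hχ 1
    rw [char_one, char_one] at this
    exact_mod_cast this
  rcases Nat.eq_zero_or_pos n with rfl | hpos
  · have hV : Subsingleton V := Module.finrank_zero_iff.1 hn
    have hW : Subsingleton W := Module.finrank_zero_iff.1 (hdim ▸ hn)
    exact ⟨Equiv.mk (LinearEquiv.ofFinrankEq V W hdim) fun g => Subsingleton.elim _ _⟩
  have hVn : Nontrivial V := Module.nontrivial_of_finrank_pos (R := k) (hn ▸ hpos)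
  have hidne : (Module.finrank k (IntertwiningMap ρ ρ) : k) ≠ 0 := by
    have : Module.Finite k (IntertwiningMap ρ ρ) :=
      FiniteDimensional.of_injective (IntertwiningMap.toLinearMapl ρ ρ)
        (IntertwiningMap.toLinearMap_injective ρ ρ)
    have : Nontrivial (IntertwiningMap ρ ρ) := by
      obtain ⟨v, hv⟩ := exists_ne (0 : V)
      exact ⟨IntertwiningMap.id ρ, 0, fun h => hv (by
        have := congrArg (fun f : IntertwiningMap ρ ρ => f v) h
        simpa using this)⟩
    exact Nat.cast_ne_zero.2 Module.finrank_pos.ne'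
  -- Since the characters agree, the sum for the pair `ρ`, `σ` equals the one for `ρ`, `ρ`, which is
  -- nonzero because the identity is a nonzero endomorphism.
  obtain ⟨f, hf⟩ := exists_ne_zero_of_sum_ne_zero (ρ := ρ) (σ := σ) (by
    rw [← hχ, sum_char_mul_char_inv]
    exact mul_ne_zero h0 hidne)
  obtain ⟨P, hP⟩ := exists_isCompl_subrepresentation ρ f.ker
  obtain ⟨Q, hQ⟩ := exists_isCompl_subrepresentation σ f.range
  let e1 := prodEquivOfIsCompl ρ _ _ hP
  let e2 := prodEquivOfIsCompl σ _ _ hQ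
  -- the complement of the kernel is equivalent to the range
  have e3 : Nonempty (P.toRepresentation.Equiv f.range.toRepresentation) := by
    let e : P.toSubmodule ≃ₗ[k] f.toLinearMap.range :=
      LinearEquiv.ofBijective (f.toLinearMap.rangeRestrict.comp P.toSubmodule.subtype) (by
        constructor
        · rw [← LinearMap.ker_eq_bot, LinearMap.ker_comp, LinearMap.ker_rangeRestrict,
            Submodule.eq_bot_iff]
          rintro ⟨x, hx⟩ hx'
          have h1 : x ∈ f.ker.toSubmodule := hx'
          have h2 := hP.disjoint.le_bot ⟨h1, hx⟩
          simpa using h2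
        · rintro ⟨_, v, rfl⟩
          have hv : v ∈ f.ker.toSubmodule ⊔ P.toSubmodule := by
            rw [hP.sup_eq_top]; exact Submodule.mem_top
          obtain ⟨y, hy, z, hz, rfl⟩ := Submodule.mem_sup.1 hv
          refine ⟨⟨z, hz⟩, Subtype.ext ?_⟩
          have hy' : f y = 0 := hy
          simp [hy'])
    exact ⟨Equiv.mk e fun g =>
      LinearMap.ext fun x => Subtype.ext (IntertwiningMap.isIntertwining _ _ f g x.1)⟩
  obtain ⟨e3⟩ := e3
  have hlt : Module.finrank k f.ker.toSubmodule < n := by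
    rw [← hn]
    apply Submodule.finrank_lt
    intro htop
    apply hf
    ext v
    have : v ∈ f.ker.toSubmodule := htop ▸ Submodule.mem_top
    exact this
  -- Cancelling the common image of `f` leaves equal characters on the kernel of `f` and on `Q`, and
  -- the kernel is proper because `f ≠ 0`.
  obtain ⟨e4⟩ := ih _ hlt f.ker.toRepresentation Q.toRepresentation rfl (by
    ext g
    have h1 := congrFun hχ g
    rw [← char_iso e1, ← char_iso e2, char_prod, char_prod, char_iso e3, add_comm] at h1
    exact add_left_cancel h1)
  exact ⟨e1.symm.trans ((Equiv.prodCongr e4 e3).trans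
    ((Equiv.mk (LinearEquiv.prodComm k _ _) fun g => by ext x <;> simp).trans e2))⟩

/-- The operator is the sum of its blocks (inclusion after `ρ i g` after projection), and cyclicity
of the trace reduces each block to `ρ i g`. -/
lemma char_directSum {ι : Type*} [Fintype ι] [DecidableEq ι] {V : ι → Type*}
    [∀ i, AddCommGroup (V i)] [∀ i, Module k (V i)] [∀ i, FiniteDimensional k (V i)]
    (ρ : ∀ i, Representation k G (V i)) (g : G) :
    (directSum ρ).character g = ∑ i, (ρ i).character g := by
  have : directSum ρ g = ∑ i, (DirectSum.lof k ι V i).comp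
      ((ρ i g).comp (DirectSum.component k ι V i)) := by
    refine DirectSum.linearMap_ext k fun i => LinearMap.ext fun v => ?_
    rw [LinearMap.comp_apply, LinearMap.comp_apply, LinearMap.sum_apply,
      Finset.sum_eq_single i]
    · simp [directSum, DirectSum.component.lof_self]
    · intro j _ hj
      simp [DirectSum.component.of, hj.symm]
    · simp
  rw [character, this, map_sum]
  refine Finset.sum_congr rfl fun i _ => ?_
  rw [LinearMap.trace_comp_comm', LinearMap.comp_assoc]
  rw [DirectSum.component_comp_lof_same]
  rfl

end Representation

end

noncomputable section
namespace ModuliZero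

/-! ### The alternating group on five letters -/

/-- The alternating group `A₅`. -/
abbrev A5 : Type := alternatingGroup (Fin 5)

/-- A double transposition. -/
def involution : A5 :=
  ⟨Equiv.swap 0 1 * Equiv.swap 2 3, Equiv.Perm.mem_alternatingGroup.2 (by decide)⟩

/-- A three-cycle whose product with `involution` is a five-cycle. -/
def threeCycle : A5 :=
  ⟨Equiv.swap 0 2 * Equiv.swap 2 4, Equiv.Perm.mem_alternatingGroup.2 (by decide)⟩

/-- A five-cycle. -/
def fiveCycle : A5 := involution * threeCycle

/-- Representatives of the conjugacy classes of `A₅`. -/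
def classRep : Fin 5 → A5 := ![1, fiveCycle, fiveCycle ^ 2, threeCycle, involution]

/-- The cardinalities of the conjugacy classes of `A₅`. -/
def classCard : Fin 5 → ℕ := ![1, 12, 12, 20, 15]

/-- The index of the conjugacy class of an element of `A₅`. -/
def classIndex (g : A5) : Fin 5 :=
  if g = 1 then 0 else if g ^ 2 = 1 then 4 else if g ^ 3 = 1 then 3 else
    if ∃ h, h * fiveCycle * h⁻¹ = g then 1 else 2

set_option maxRecDepth 100000 in
lemma exists_conj_classRep : ∀ g : A5, ∃ h, h * classRep (classIndex g) * h⁻¹ = g := by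
  decide +kernel

set_option maxRecDepth 100000 in
lemma card_classIndex_eq :
    ∀ c, (Finset.univ.filter fun g : A5 => classIndex g = c).card = classCard c := by
  decide +kernel

lemma classIndex_classRep : ∀ c, classIndex (classRep c) = c := by
  decide +kernel

/-- Every element of `A₅` is conjugate to its inverse; this removes the inverse from the
orthogonality sums. -/
lemma classRep_inv : ∀ c, ∃ h, h * classRep c * h⁻¹ = (classRep c)⁻¹ := by
  decide +kernel

/-- The outer automorphism of `A₅` given by conjugation with a transposition. -/
def outerAut : A5 ≃* A5 := MulAut.conjNormal (Equiv.swap 0 1)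

/-- Conjugation by an odd permutation exchanges the two classes of five-cycles. It produces the
second character of degree three and lets an identification of the stabilizer with `A₅` be
corrected. -/
lemma outerAut_classRep :
    ∀ c, ∃ h, h * classRep (Equiv.swap 1 2 c) * h⁻¹ = outerAut (classRep c) := by
  decide +kernel

lemma classRep_pow_ne_one : involution ≠ 1 ∧ threeCycle ≠ 1 ∧ fiveCycle ≠ 1 ∧
    fiveCycle ^ 2 ≠ 1 := by
  decide +kernel

lemma classRep_pow : involution ^ 2 = 1 ∧ threeCycle ^ 3 = 1 ∧ fiveCycle ^ 5 = 1 := by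
  decide +kernel

/-! ### The irreducible characters of `A₅` -/

section Characters

open Representation

variable {V W : Type*} [AddCommGroup V] [Module ℂ V] [AddCommGroup W] [Module ℂ W]

lemma character_eq_classRep (ρ : Representation ℂ A5 V) (g : A5) :
    ρ.character g = ρ.character (classRep (classIndex g)) := by
  obtain ⟨h, hh⟩ := exists_conj_classRep g
  conv_lhs => rw [← hh, char_conj]

lemma character_inv_classRep (ρ : Representation ℂ A5 V) (c : Fin 5) :
    ρ.character (classRep c)⁻¹ = ρ.character (classRep c) := by
  obtain ⟨h, hh⟩ := classRep_inv c
  rw [← hh, char_conj]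

lemma character_inv (ρ : Representation ℂ A5 V) (g : A5) :
    ρ.character g⁻¹ = ρ.character g := by
  obtain ⟨h, hh⟩ := exists_conj_classRep g
  rw [← hh, conj_inv, char_conj, char_conj, character_inv_classRep]

lemma sum_char_mul_char (ρ : Representation ℂ A5 V) (σ : Representation ℂ A5 W) :
    ∑ g : A5, σ.character g * ρ.character g⁻¹ =
      ∑ c, (classCard c : ℂ) * (σ.character (classRep c) * ρ.character (classRep c)) := by
  have h1 : ∀ g : A5, σ.character g * ρ.character g⁻¹ =
      (fun c => σ.character (classRep c) * ρ.character (classRep c)) (classIndex g) := fun g => by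
    rw [character_inv, character_eq_classRep ρ, character_eq_classRep σ]
  rw [Finset.sum_congr rfl fun g _ => h1 g, ← Finset.sum_fiberwise (s := Finset.univ)
    (g := classIndex)]
  refine Finset.sum_congr rfl fun c _ => ?_
  rw [Finset.sum_congr rfl (g := fun _ => σ.character (classRep c) * ρ.character (classRep c))
    (fun g hg => by rw [(Finset.mem_filter.1 hg).2]), Finset.sum_const, card_classIndex_eq,
    nsmul_eq_mul]

lemma natCard_A5 : Nat.card A5 = 60 := by
  rw [Nat.card_eq_fintype_card, ← Finset.card_univ,
    Finset.card_eq_sum_card_fiberwise (f := classIndex) (t := Finset.univ) (fun _ _ => by simp)]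
  simp only [card_classIndex_eq, Fin.sum_univ_five, classCard]
  rfl

/-- The representation `ρ` has the `i`-th character of the character table. -/
def HasCharacter (ρ : Representation ℂ A5 V) (i : Fin 5) : Prop :=
  ∀ c, ρ.character (classRep c) = (charTable i c : ℂ)

lemma sqrt_five_sq : ((√5 : ℝ) : ℂ) ^ 2 = 5 := by
  rw [← Complex.ofReal_pow, Real.sq_sqrt (by norm_num)]; norm_num

/-- Each row of the table, weighted by the class sizes, has square sum 60. -/
lemma HasCharacter.isIrreducible [FiniteDimensional ℂ V] {ρ : Representation ℂ A5 V} {i : Fin 5}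
    (h : HasCharacter ρ i) : ρ.IsIrreducible := by
  apply isIrreducible_of_sum_char
  have := sqrt_five_sq
  rw [sum_char_mul_char, natCard_A5]
  simp only [h _]
  fin_cases i <;> simp [Fin.sum_univ_five, classCard, charTable] <;> grind

lemma exists_hasCharacter_four (ρ : Representation ℂ A5 (Fin 3 → ℂ)) (h : HasCharacter ρ 3) :
    HasCharacter (ρ.comp outerAut.toMonoidHom : Representation ℂ A5 (Fin 3 → ℂ)) 4 := by
  intro c
  obtain ⟨k, hk⟩ := outerAut_classRep c
  have : Representation.character (ρ.comp outerAut.toMonoidHom) (classRep c)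
      = ρ.character (outerAut (classRep c)) := rfl
  rw [this, ← hk, char_conj, h]
  fin_cases c <;> simp [charTable, Equiv.swap_apply_def]

/-- All irreducible representations of `A₅` arise from one of degree three. -/
theorem exists_irreducibles (ρ : Representation ℂ A5 (Fin 3 → ℂ)) (h : HasCharacter ρ 3) :
    ∃ X : ∀ i, Representation ℂ A5 (Fin (irrDegree i) → ℂ), ∀ i, HasCharacter (X i) i := by
  have hsq := sqrt_five_sq
  obtain ⟨ρ', h'⟩ : ∃ ρ' : Representation ℂ A5 (Fin 3 → ℂ), HasCharacter ρ' 4 :=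
    ⟨_, exists_hasCharacter_four ρ h⟩
  let τ : Representation ℂ A5 (Fin 1 → ℂ) := 1
  have hτ : HasCharacter τ 0 := fun c => by
    have h1 : τ.character (classRep c) = τ.character 1 := rfl
    rw [h1, char_one]
    fin_cases c <;> simp [charTable]
  have irr3 := h.isIrreducible
  have irr1 := hτ.isIrreducible
  -- The square of `ρ` decomposes as `1 + 3 + 5`: removing the trivial part leaves dimension 8, and
  -- then removing `ρ` leaves 5.
  obtain ⟨σ, hσ⟩ := exists_character_sub (ρ := τ) (σ := ρ.tprod ρ) (d := 8) (by
    rw [sum_char_mul_char]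
    simp only [char_tensor, Pi.mul_apply, h _, hτ _]
    simp [Fin.sum_univ_five, classCard, charTable]
    grind) (by simp)
  obtain ⟨X5, hX5⟩ := exists_character_sub (ρ := ρ) (σ := σ) (d := 5) (by
    rw [sum_char_mul_char]
    simp only [hσ, char_tensor, Pi.mul_apply, h _, hτ _]
    simp [Fin.sum_univ_five, classCard, charTable]
    grind) (by simp)
  have h5 : HasCharacter X5 2 := fun c => by
    rw [hX5, hσ, char_tensor, Pi.mul_apply, h, hτ]
    fin_cases c <;> simp [charTable] <;> grind
  have irr5 := h5.isIrreducible
  -- The product of the two representations of degree three is `4 + 5`.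
  obtain ⟨X4, hX4⟩ := exists_character_sub (ρ := X5) (σ := ρ.tprod ρ') (d := 4) (by
    rw [sum_char_mul_char]
    simp only [char_tensor, Pi.mul_apply, h _, h' _, h5 _]
    simp [Fin.sum_univ_five, classCard, charTable]
    grind) (by simp)
  have h4 : HasCharacter X4 1 := fun c => by
    rw [hX4, char_tensor, Pi.mul_apply, h, h', h5]
    fin_cases c <;> simp [charTable] <;> grind
  refine ⟨fun i => match i with
    | 0 => τ | 1 => X4 | 2 => X5 | 3 => ρ | 4 => ρ', fun i => ?_⟩
  fin_cases i
  exacts [hτ, h4, h5, h, h']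

end Characters

end ModuliZero
end

noncomputable section
namespace ModuliZero

/-! ### The trace of the tangent representation -/

/-! ### Traces in split exact sequences and on products -/

section LinearAlgebra

variable {k : Type*} [Field k] {A E F : Type*} [AddCommGroup A] [Module k A]
  [AddCommGroup E] [Module k E] [AddCommGroup F] [Module k F]
  [FiniteDimensional k A] [FiniteDimensional k E] [FiniteDimensional k F]

/-- Additivity of the trace in a split short exact sequence `0 → A → E → F → 0`. -/
lemma trace_eq_of_split_exact (L : A →ₗ[k] E) (D : E →ₗ[k] F) (S : F →ₗ[k] E)
    (T : E →ₗ[k] E) (R : A →ₗ[k] A) (hL : Function.Injective L) (hDS : D ∘ₗ S = LinearMap.id)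
    (hker : LinearMap.ker D ≤ LinearMap.range L) (hDL : D ∘ₗ L = 0) (hTL : T ∘ₗ L = L ∘ₗ R) :
    LinearMap.trace k F (D ∘ₗ T ∘ₗ S) = LinearMap.trace k E T - LinearMap.trace k A R := by
  obtain ⟨r, hr⟩ := L.exists_leftInverse_of_injective (LinearMap.ker_eq_bot.2 hL)
  -- `q` is the retraction of `L` vanishing on the image of `S`, so that `S ∘ D + L ∘ q` is the
  -- identity of `E`.
  set q : E →ₗ[k] A := r ∘ₗ (LinearMap.id - S ∘ₗ D) with hq
  have hDS' : ∀ x, D (S x) = x := fun x => LinearMap.congr_fun hDS x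
  have hr' : ∀ x, r (L x) = x := fun x => LinearMap.congr_fun hr x
  have hDL' : ∀ x, D (L x) = 0 := fun x => LinearMap.congr_fun hDL x
  have hqL : q ∘ₗ L = LinearMap.id := by ext x; simp [hq, hDL', hr']
  have hLq : ∀ x, L (q x) = x - S (D x) := fun x => by
    have : x - S (D x) ∈ LinearMap.ker D := by simp [hDS']
    obtain ⟨a, ha⟩ := hker this
    simp [hq, ← ha, hr']
  -- Cyclicity turns the two summands into the traces on the quotient `F` and on the subspace `A`.
  have hT : T = (T ∘ₗ S) ∘ₗ D + (T ∘ₗ L) ∘ₗ q := by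
    ext x
    simp [hLq]
  have h1 : LinearMap.trace k E ((T ∘ₗ S) ∘ₗ D) = LinearMap.trace k F (D ∘ₗ T ∘ₗ S) :=
    LinearMap.trace_comp_comm' _ _
  have h2 : LinearMap.trace k E ((T ∘ₗ L) ∘ₗ q) = LinearMap.trace k A R := by
    rw [hTL, LinearMap.comp_assoc, LinearMap.trace_comp_comm', LinearMap.comp_assoc, hqL,
      LinearMap.comp_id]
  conv_rhs => rw [hT, map_add, h1, h2]
  ring

/-- A block permutation matrix has diagonal blocks only at the fixed indices of `s`. -/
lemma trace_pi_reindex {ι V : Type*} [Fintype ι] [DecidableEq ι] [AddCommGroup V] [Module k V]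
    [FiniteDimensional k V] (f : (ι → V) →ₗ[k] (ι → V)) (s : ι → ι) (B : ι → V →ₗ[k] V)
    (hf : ∀ v i, f v i = B i (v (s i))) :
    LinearMap.trace k _ f = ∑ i, if s i = i then LinearMap.trace k V (B i) else 0 := by
  have : f = ∑ i, (LinearMap.single k (fun _ : ι => V) i).comp
      ((B i).comp (LinearMap.proj (s i))) := by
    ext j v i
    simp [hf, Finset.sum_apply, Pi.single_apply]
  rw [this, map_sum]
  refine Finset.sum_congr rfl fun i _ => ?_
  rw [LinearMap.trace_comp_comm', LinearMap.comp_assoc]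
  split_ifs with h
  · congr 1
    ext v
    simp [h]
  · have h0 : B i ∘ₗ LinearMap.proj (s i) ∘ₗ LinearMap.single k (fun _ : ι => V) i = 0 := by
      ext v
      simp [h]
    rw [h0, map_zero]

end LinearAlgebra

/-- The traceless matrix with the given coordinates. -/
def slMatrix : (Fin 3 → ℂ) →ₗ[ℂ] Matrix (Fin 2) (Fin 2) ℂ where
  toFun v := !![v 0, v 1; v 2, -v 0]
  map_add' u v := by
    ext i j; fin_cases i <;> fin_cases j <;> simp; ring
  map_smul' c v := by ext i j; fin_cases i <;> fin_cases j <;> simp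

/-- The coordinates of a traceless matrix. -/
def slCoord : Matrix (Fin 2) (Fin 2) ℂ →ₗ[ℂ] (Fin 3 → ℂ) where
  toFun X := ![X 0 0, X 0 1, X 1 0]
  map_add' u v := by ext i; fin_cases i <;> simp
  map_smul' c v := by ext i; fin_cases i <;> simp

lemma slCoord_slMatrix (v : Fin 3 → ℂ) : slCoord (slMatrix v) = v := by
  ext i; fin_cases i <;> simp [slCoord, slMatrix]

lemma slMatrix_slCoord {X : Matrix (Fin 2) (Fin 2) ℂ} (h : X.trace = 0) :
    slMatrix (slCoord X) = X := by
  rw [Matrix.trace_fin_two] at h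
  ext i j
  fin_cases i <;> fin_cases j <;> simp [slCoord, slMatrix]
  linear_combination -h

/-- The adjoint representation of `GL₂` on the traceless matrices. -/
def adjoint : Representation ℂ (GL (Fin 2) ℂ) (Fin 3 → ℂ) where
  toFun M := slCoord ∘ₗ LinearMap.mulLeft ℂ (M : Matrix (Fin 2) (Fin 2) ℂ) ∘ₗ
    LinearMap.mulRight ℂ ((M⁻¹ : GL (Fin 2) ℂ) : Matrix (Fin 2) (Fin 2) ℂ) ∘ₗ slMatrix
  map_one' := by ext; simp [slCoord_slMatrix]
  map_mul' M M' := by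
    refine LinearMap.ext fun v => ?_
    simp only [LinearMap.comp_apply, LinearMap.mulLeft_apply, LinearMap.mulRight_apply,
      Module.End.mul_apply]
    rw [slMatrix_slCoord]
    · simp [mul_assoc]
    · rw [← mul_assoc, Matrix.trace_mul_comm, ← mul_assoc]
      simp [slMatrix, Matrix.trace_fin_two]

lemma slMatrix_adjoint (M : GL (Fin 2) ℂ) (v : Fin 3 → ℂ) :
    slMatrix (adjoint M v) = (M : Matrix (Fin 2) (Fin 2) ℂ) * slMatrix v *
      ((M⁻¹ : GL (Fin 2) ℂ) : Matrix (Fin 2) (Fin 2) ℂ) := by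
  change slMatrix (slCoord (_ * (_ * _))) = _
  rw [slMatrix_slCoord, mul_assoc]
  rw [← mul_assoc, Matrix.trace_mul_comm, ← mul_assoc]
  simp [slMatrix, Matrix.trace_fin_two]

/-- The conjugation invariant `tr² / det` of a matrix up to scalars. -/
def invariant (M : GL (Fin 2) ℂ) : ℂ :=
  (M : Matrix (Fin 2) (Fin 2) ℂ).trace ^ 2 / (M : Matrix (Fin 2) (Fin 2) ℂ).det

/-- For `M` with eigenvalues `a`, `b` the adjoint action has eigenvalues `a/b`, `1`, `b/a`, while
`tr² / det` is `a/b + 2 + b/a`. -/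
lemma character_adjoint (M : GL (Fin 2) ℂ) : adjoint.character M = invariant M - 1 := by
  have hd := M.det_ne_zero
  rw [Representation.character, LinearMap.trace_eq_matrix_trace ℂ (Pi.basisFun ℂ (Fin 3)),
    Matrix.trace, Fin.sum_univ_three, invariant]
  simp only [Matrix.diag_apply, LinearMap.toMatrix_apply, Pi.basisFun_apply, Pi.basisFun_repr]
  simp only [adjoint, MonoidHom.coe_mk, OneHom.coe_mk, LinearMap.comp_apply,
    LinearMap.mulLeft_apply, LinearMap.mulRight_apply, Matrix.coe_units_inv, Matrix.inv_def,
    Matrix.adjugate_fin_two]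
  simp [slCoord, slMatrix, Matrix.mul_apply, Fin.sum_univ_two, Matrix.trace_fin_two,
    Ring.inverse_eq_inv']
  rw [Matrix.det_fin_two] at hd ⊢
  field_simp
  ring


/-! ### The tangent space of `K_n` as a quotient of configurations of vectors -/

section TangentTrace

variable {N : ℕ}

/-- Homogeneous coordinates of the marked points. -/
def homMark (l : Fin N → ℂ) (k : Fin (N + 3)) : Fin 2 → ℂ := ![hx (mark l k), hy (mark l k)]

/-- The determinant of two vectors. -/
def vdet (u v : Fin 2 → ℂ) : ℂ := u 0 * v 1 - v 0 * u 1

lemma vdet_smul_mulVec (M : Matrix (Fin 2) (Fin 2) ℂ) (a b : ℂ) (u v : Fin 2 → ℂ) :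
    vdet (a • M.mulVec u) (b • M.mulVec v) = a * b * M.det * vdet u v := by
  simp [vdet, Matrix.det_fin_two]
  ring

/-- The cross ratios of a configuration of points in homogeneous coordinates. -/
def crossRatios (w : Fin (N + 3) → Fin 2 → ℂ) (i : Fin N) : ℂ :=
  (vdet (w (idx i)) (w 0) * vdet (w 1) (w 2)) / (vdet (w (idx i)) (w 2) * vdet (w 1) (w 0))

/-- `homMark` is a section of `crossRatios`; its derivative splits the tangent sequence. -/
lemma crossRatios_homMark (l : Fin N → ℂ) : crossRatios (homMark l) = l := by
  ext i
  simp [crossRatios, vdet, homMark]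

lemma gMap_eq_crossRatios (σ : Equiv.Perm (Fin (N + 3))) {l : Fin N → ℂ} (hl : l ∈ K N) :
    gMap σ l = crossRatios (fun k => homMark l (σ⁻¹ k)) :=
  funext fun i => gMap_apply σ hl i

/-- Each of the four vectors occurs once in the numerator and once in the denominator, so all
scalars and determinants cancel. -/
lemma crossRatios_smul (M : Matrix (Fin 2) (Fin 2) ℂ) (hM : M.det ≠ 0) (a : Fin (N + 3) → ℂ)
    (ha : ∀ k, a k ≠ 0) (w : Fin (N + 3) → Fin 2 → ℂ) :
    crossRatios (fun k => a k • M.mulVec (w k)) = crossRatios w := by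
  ext i
  simp only [crossRatios, vdet_smul_mulVec]
  have := ha 0
  have := ha 1
  have := ha 2
  have := ha (idx i)
  have h : a (idx i) * a 0 * a 1 * a 2 * M.det ^ 2 ≠ 0 := by simp [*]
  refine Eq.trans ?_ (mul_div_mul_left _ _ h)
  congr 1 <;> ring

lemma differentiableAt_crossRatios {l : Fin N → ℂ} (hl : l ∈ K N) :
    DifferentiableAt ℂ (crossRatios (N := N)) (homMark l) := by
  rw [differentiableAt_pi]
  intro i
  have hv : ∀ j k : Fin (N + 3),
      Differentiable ℂ (fun w : Fin (N + 3) → Fin 2 → ℂ => vdet (w j) (w k)) := fun j k => by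
    unfold vdet; fun_prop
  have hne : vdet (homMark l (idx i)) (homMark l 2) * vdet (homMark l 1) (homMark l 0) ≠ 0 :=
    mul_ne_zero (br_ne_zero (mark_ne hl (idx_ne_two i)))
      (br_ne_zero (mark_ne hl zero_ne_one'.symm))
  have h1 := ((hv (idx i) 0).fun_mul (hv 1 2)) (homMark l)
  have h2 := ((hv (idx i) 2).fun_mul (hv 1 0)) (homMark l)
  have h3 := h1.fun_mul (h2.fun_inv hne)
  simp only [← div_eq_mul_inv] at h3
  exact h3

lemma differentiable_homMark : Differentiable ℂ (homMark (N := N)) := by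
  refine differentiable_pi.2 fun k => differentiable_pi.2 fun j => ?_
  fin_cases j
  · exact differentiable_hx k
  · exact differentiable_hy k

/-- The infinitesimal action of `sl₂` and of the rescalings on configurations of vectors. -/
def infinitesimal (l : Fin N → ℂ) :
    ((Fin 3 → ℂ) × (Fin (N + 3) → ℂ)) →ₗ[ℂ] (Fin (N + 3) → Fin 2 → ℂ) where
  toFun p k := (slMatrix p.1).mulVec (homMark l k) + p.2 k • homMark l k
  map_add' p q := by
    ext k : 1
    simp only [Prod.fst_add, Prod.snd_add, map_add, Matrix.add_mulVec, Pi.add_apply, add_smul]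
    abel
  map_smul' c p := by
    ext k : 1
    simp only [Prod.smul_fst, Prod.smul_snd, map_smul, Matrix.smul_mulVec, Pi.smul_apply,
      smul_eq_mul, mul_smul, smul_add, RingHom.id_apply]

/-- In the kernel, the traceless matrix has the lines `0`, `1`, `∞` as eigenlines and is therefore
zero; then the rescalings vanish because the vectors do not. -/
lemma infinitesimal_injective (l : Fin N → ℂ) : Function.Injective (infinitesimal l) := by
  rw [← LinearMap.ker_eq_bot, LinearMap.ker_eq_bot']
  rintro ⟨v, d⟩ h
  have h' : ∀ k i, ((slMatrix v).mulVec (homMark l k) + d k • homMark l k) i = 0 :=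
    fun k i => congrFun (congrFun h k) i
  have h00 := h' 0 0
  have h21 := h' 2 1
  have h10 := h' 1 0
  have h11 := h' 1 1
  simp [slMatrix, homMark] at h00 h21 h10 h11
  rw [h00] at h10
  rw [h21] at h11
  have hv0 : v 0 = 0 := by linear_combination (h10 - h11) / 2
  have hv : v = 0 := by
    ext i; fin_cases i <;> simp [hv0, h00, h21]
  have hd : d = 0 := by
    ext k
    have a := h' k 0
    have b := h' k 1
    rw [hv] at a b
    simp [homMark] at a b
    rcases a with a | a
    · simpa using a
    · rcases b with b | b
      · simpa using b
      · exfalso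
        generalize mark l k = p at a b
        induction p using OnePoint.rec <;> simp at a b
  rw [hv, hd]; rfl

/-- The cross ratios are constant on orbits of matrices and rescalings, so their derivative kills
the directions tangent to the orbits. -/
lemma fderiv_crossRatios_infinitesimal {l : Fin N → ℂ} (hl : l ∈ K N) (v : Fin 3 → ℂ)
    (d : Fin (N + 3) → ℂ) :
    fderiv ℂ crossRatios (homMark l) (infinitesimal l (v, d)) = 0 := by
  have key : ∀ u : Fin (N + 3) → Fin 2 → ℂ,
      (∀ᶠ t in nhds (0 : ℂ), crossRatios (homMark l + t • u) = crossRatios (homMark l)) →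
      fderiv ℂ crossRatios (homMark l) u = 0 := by
    intro u hu
    have h1 : HasDerivAt (fun t : ℂ => homMark l + t • u) u 0 := by
      simpa using ((hasDerivAt_id (0 : ℂ)).smul_const u).const_add (homMark l)
    have hd := (differentiableAt_crossRatios hl).hasFDerivAt
    have h0 : homMark l = homMark l + (0 : ℂ) • u := by simp
    rw [h0] at hd
    have h2 := hd.comp_hasDerivAt (0 : ℂ) h1
    rw [← h0] at h2
    exact h2.unique ((hasDerivAt_const (0 : ℂ) (crossRatios (homMark l))).congr_of_eventuallyEq hu)
  -- In a pure direction the straight line stays in one orbit for small `t`, through `1 + t X` or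
  -- through the factors `1 + t d k`; a line in a mixed direction need not.
  have hsplit : infinitesimal l (v, d) = infinitesimal l (v, 0) + infinitesimal l (0, d) := by
    rw [← map_add]; simp
  rw [hsplit, map_add, key, key, add_zero]
  · have hc : ∀ k, ∀ᶠ t in nhds (0 : ℂ), 1 + t * d k ≠ 0 := fun k => by
      have : ContinuousAt (fun t : ℂ => 1 + t * d k) 0 := by fun_prop
      exact this.eventually_ne (by simp)
    filter_upwards [Filter.eventually_all.2 hc] with t ht
    rw [← crossRatios_smul 1 (by simp) (fun k => 1 + t * d k) ht (homMark l)]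
    congr 1
    ext k : 1
    simp only [infinitesimal, LinearMap.coe_mk, AddHom.coe_mk, map_zero, Matrix.zero_mulVec,
      zero_add, Pi.add_apply, Pi.smul_apply, Matrix.one_mulVec, add_smul, one_smul, mul_smul]
  · have hc : ∀ᶠ t in nhds (0 : ℂ), (1 + t • slMatrix v).det ≠ 0 := by
      have : ContinuousAt (fun t : ℂ => (1 + t • slMatrix v).det) 0 := by fun_prop
      exact this.eventually_ne (by simp)
    filter_upwards [hc] with t ht
    rw [← crossRatios_smul _ ht (fun _ => 1) (by simp) (homMark l)]
    congr 1
    ext k : 1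
    simp only [infinitesimal, LinearMap.coe_mk, AddHom.coe_mk, Pi.zero_apply, zero_smul,
      add_zero, Pi.add_apply, Pi.smul_apply, Matrix.add_mulVec, Matrix.one_mulVec,
      Matrix.smul_mulVec, one_smul]

/-- The trace of the derivative of `g_σ` at a fixed point `λ`, when the linear fractional
transformation `M` permutes the marked points by `σ`. -/
theorem trace_fderiv_gMap {l : Fin N → ℂ} (hl : l ∈ K N) (σ : Equiv.Perm (Fin (N + 3)))
    (M : GL (Fin 2) ℂ) (c : Fin (N + 3) → ℂ) (hc0 : ∀ k, c k ≠ 0)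
    (hc : ∀ k, (M : Matrix (Fin 2) (Fin 2) ℂ).mulVec (homMark l k) = c k • homMark l (σ k)) :
    LinearMap.trace ℂ _ (fderiv ℂ (gMap σ) l : (Fin N → ℂ) →ₗ[ℂ] (Fin N → ℂ)) =
      (∑ k, if σ k = k then (M : Matrix (Fin 2) (Fin 2) ℂ).trace / c k - 1 else 0) -
        (invariant M - 1) := by
  set A : Matrix (Fin 2) (Fin 2) ℂ := M.val with hA
  have hAdet : A.det ≠ 0 := M.det_ne_zero
  set D : (Fin (N + 3) → Fin 2 → ℂ) →L[ℂ] (Fin N → ℂ) := fderiv ℂ crossRatios (homMark l)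
  set S : (Fin N → ℂ) →L[ℂ] (Fin (N + 3) → Fin 2 → ℂ) := fderiv ℂ homMark l
  -- A linear lift of `g_σ` to vectors. The scalars are chosen so that `homMark l` itself is fixed,
  -- and not merely its lines.
  let T : (Fin (N + 3) → Fin 2 → ℂ) →ₗ[ℂ] (Fin (N + 3) → Fin 2 → ℂ) :=
    LinearMap.pi fun k => ((c (σ⁻¹ k))⁻¹ • A.mulVecLin) ∘ₗ LinearMap.proj (σ⁻¹ k)
  have hTapp : ∀ w k, T w k = (c (σ⁻¹ k))⁻¹ • A.mulVec (w (σ⁻¹ k)) := fun w k => rfl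
  let P : (Fin (N + 3) → ℂ) →ₗ[ℂ] (Fin (N + 3) → ℂ) := LinearMap.funLeft ℂ ℂ (fun k => σ⁻¹ k)
  have hTw : T (homMark l) = homMark l := by
    ext k : 1
    rw [hTapp, hc, smul_smul, inv_mul_cancel₀ (hc0 _), one_smul]
    simp
  have hDS : D.toLinearMap ∘ₗ S.toLinearMap = LinearMap.id := by
    have h1 := ((differentiableAt_crossRatios hl).hasFDerivAt).comp l
      (differentiable_homMark l).hasFDerivAt
    have h2 : crossRatios ∘ homMark (N := N) = id := funext crossRatios_homMark
    rw [h2] at h1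
    have h3 := h1.unique (hasFDerivAt_id l)
    exact LinearMap.ext fun x => congrArg (fun f => f x) h3
  have hDL : D.toLinearMap ∘ₗ infinitesimal l = 0 := by
    refine LinearMap.ext fun p => fderiv_crossRatios_infinitesimal hl p.1 p.2
  -- Exactness in the middle is a count of dimensions: `2 (N + 3) - N = 3 + (N + 3)`.
  have hker : LinearMap.ker D.toLinearMap ≤ LinearMap.range (infinitesimal l) := by
    refine (Submodule.eq_of_le_of_finrank_eq ?_ ?_).ge
    · rintro _ ⟨p, rfl⟩
      exact LinearMap.congr_fun hDL p
    · have hsurj : Function.Surjective D.toLinearMap :=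
        fun x => ⟨S x, LinearMap.congr_fun hDS x⟩
      have h1 := LinearMap.finrank_range_add_finrank_ker
        D.toLinearMap
      rw [LinearMap.range_eq_top.2 hsurj, finrank_top] at h1
      rw [LinearMap.finrank_range_of_inj (infinitesimal_injective l)]
      simp [Module.finrank_pi_fintype] at h1 ⊢
      omega
  -- `T` acts on the orbit directions by conjugation on matrices and by permutation on rescalings.
  have hTL : T ∘ₗ infinitesimal l = infinitesimal l ∘ₗ (adjoint M).prodMap P := by
    refine LinearMap.ext fun p => funext fun k => ?_
    have h1 : A.mulVec (homMark l (σ⁻¹ k)) = c (σ⁻¹ k) • homMark l k := by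
      rw [hc]; simp
    have h2 : ((M⁻¹ : GL (Fin 2) ℂ) : Matrix (Fin 2) (Fin 2) ℂ).mulVec (homMark l k) =
        (c (σ⁻¹ k))⁻¹ • homMark l (σ⁻¹ k) := by
      have h3 : homMark l k = (c (σ⁻¹ k))⁻¹ • A.mulVec (homMark l (σ⁻¹ k)) := by
        rw [h1, smul_smul, inv_mul_cancel₀ (hc0 _), one_smul]
      rw [h3, Matrix.mulVec_smul, Matrix.mulVec_mulVec, hA, ← Units.val_mul]
      simp
    simp only [LinearMap.comp_apply, hTapp, LinearMap.prodMap_apply]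
    change _ = (slMatrix (adjoint M p.1)).mulVec (homMark l k) + p.2 (σ⁻¹ k) • homMark l k
    change (c (σ⁻¹ k))⁻¹ • A.mulVec ((slMatrix p.1).mulVec (homMark l (σ⁻¹ k)) +
      p.2 (σ⁻¹ k) • homMark l (σ⁻¹ k)) = _
    rw [slMatrix_adjoint, ← Matrix.mulVec_mulVec, h2, Matrix.mulVec_add, Matrix.mulVec_smul,
      Matrix.mulVec_smul, h1, smul_add, smul_comm (p.2 _), smul_smul (c _)⁻¹ (c _),
      inv_mul_cancel₀ (hc0 _), one_smul, ← Matrix.mulVec_mulVec]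
  -- By invariance of the cross ratios, `g_σ` is the section, followed by the linear map `T`,
  -- followed by the cross ratios.
  have hfd : (fderiv ℂ (gMap σ) l : (Fin N → ℂ) →ₗ[ℂ] (Fin N → ℂ)) =
      D.toLinearMap ∘ₗ T ∘ₗ S.toLinearMap := by
    have hev : gMap σ =ᶠ[nhds l] crossRatios ∘ (LinearMap.toContinuousLinearMap T) ∘ homMark := by
      filter_upwards [(isOpen_K N).mem_nhds hl] with m hm
      rw [gMap_eq_crossRatios σ hm, Function.comp_apply, Function.comp_apply,
        ← crossRatios_smul A hAdet (fun k => (c (σ⁻¹ k))⁻¹) (fun k => inv_ne_zero (hc0 _))]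
      rfl
    have h1 : HasFDerivAt crossRatios D (LinearMap.toContinuousLinearMap T (homMark l)) := by
      rw [LinearMap.coe_toContinuousLinearMap', hTw]
      exact (differentiableAt_crossRatios hl).hasFDerivAt
    have h2 := h1.comp l ((LinearMap.toContinuousLinearMap T).hasFDerivAt.comp l
      (differentiable_homMark l).hasFDerivAt)
    rw [hev.fderiv_eq, h2.fderiv]
    rfl
  rw [hfd, trace_eq_of_split_exact _ _ _ _ _ (infinitesimal_injective l) hDS hker hDL hTL,
    LinearMap.trace_prodMap', trace_pi_reindex T (fun k => σ⁻¹ k)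
      (fun k => (c (σ⁻¹ k))⁻¹ • A.mulVecLin) hTapp,
    trace_pi_reindex P (fun k => σ⁻¹ k) (fun _ => LinearMap.id) (fun _ _ => rfl)]
  have h4 := character_adjoint M
  rw [Representation.character] at h4
  rw [h4, sub_add_eq_sub_sub_swap, ← Finset.sum_sub_distrib]
  congr 1
  refine Finset.sum_congr rfl fun k _ => ?_
  have h5 : σ⁻¹ k = k ↔ σ k = k := by
    rw [Equiv.Perm.inv_eq_iff_eq, eq_comm]
  by_cases h : σ k = k
  · have h' := h5.2 h
    rw [if_pos h', if_pos h', if_pos h, h', map_smul, smul_eq_mul]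
    have h6 : LinearMap.trace ℂ _ A.mulVecLin = A.trace := by
      rw [← Matrix.toLin'_apply', Matrix.trace_toLin'_eq]
    rw [h6]
    simp
    ring
  · have h' := fun h6 => h (h5.1 h6)
    rw [if_neg h', if_neg h', if_neg h, sub_zero]

end TangentTrace

end ModuliZero
end

noncomputable section
namespace ModuliZero

/-! ### Faithfulness of the action of `S_n` on `K_n` -/

lemma exists_perm_of_ne {α : Type*} [DecidableEq α] {x y a b : α} (hxy : x ≠ y) (hab : a ≠ b) :
    ∃ π : Equiv.Perm α, π x = a ∧ π y = b := by
  refine ⟨Equiv.swap (Equiv.swap x a y) b * Equiv.swap x a, ?_, by simp⟩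
  rw [Equiv.Perm.mul_apply, Equiv.swap_apply_left]
  refine Equiv.swap_apply_of_ne_of_ne (fun h => hxy ?_) hab
  exact (Equiv.swap x a).injective ((Equiv.swap_apply_left x a).trans h)

/-- The component of `g_σ` at `i0` is a cross ratio in which the point with index `i1` occurs.
Moving that point alone would leave this component unchanged if `g_σ` were the identity, but a cross
ratio is injective in each entry. Two coordinates are needed, whence `2 ≤ N`. -/
lemma gHom_apply_ne {N : ℕ} (hN : 2 ≤ N) {σ : Equiv.Perm (Fin (N + 3))}
    (hσ : σ (idx ⟨1, hN⟩) = 0) : gHom N σ ≠ 1 := by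
  intro h
  set i1 : Fin N := ⟨1, hN⟩
  set i0 : Fin N := ⟨0, by omega⟩
  have hs : σ⁻¹ 0 = idx i1 := by rw [Equiv.Perm.inv_eq_iff_eq, hσ]
  let m : Fin N → ℂ := fun i => (i : ℂ) + 2
  let m' : Fin N → ℂ := Function.update m i1 (-1)
  have hm : m ∈ K N := by
    refine ⟨fun i => ⟨?_, ?_⟩, fun i j hij hm => hij ?_⟩
    · change (i : ℂ) + 2 ≠ 0
      exact_mod_cast (by omega : (i : ℕ) + 2 ≠ 0)
    · change (i : ℂ) + 2 ≠ 1
      exact_mod_cast (by omega : (i : ℕ) + 2 ≠ 1)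
    · change (i : ℂ) + 2 = (j : ℂ) + 2 at hm
      have : (i : ℕ) + 2 = (j : ℕ) + 2 := by exact_mod_cast hm
      exact Fin.ext (by omega)
  have hne : ∀ i : Fin N, m i ≠ -1 := fun i hi => by
    have h2 : ((((i : ℕ) + 3 : ℕ) : ℂ)) = 0 := by
      push_cast
      linear_combination hi
    exact absurd (Nat.cast_eq_zero.1 h2) (by omega)
  have hm' : m' ∈ K N := by
    refine ⟨fun i => ?_, fun i j hij => ?_⟩
    · by_cases hi : i = i1
      · subst hi; simp [m']; norm_num
      · simpa [m', hi] using hm.1 i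
    · by_cases hi : i = i1 <;> by_cases hj : j = i1
      · exact absurd (hi.trans hj.symm) hij
      · subst hi; simpa [m', hj] using (hne j).symm
      · subst hj; simpa [m', hi] using hne i
      · simpa [m', hi, hj] using hm.2 i j hij
  have hfix : ∀ x ∈ K N, gMap σ x = x := fun x hx => by
    have := congrArg (fun f => (f ⟨x, hx⟩ : Fin N → ℂ)) h
    simpa using this
  have hmark : ∀ k, k ≠ idx i1 → mark m' k = mark m k := by
    intro k
    induction k using idx_cases with
    | h0 => simp
    | h1 => simp
    | h2 => simp
    | h3 i =>
      intro hi
      have : i ≠ i1 := fun h => hi (by rw [h])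
      simp [m', this]
  have h01 : i0 ≠ i1 := by simp [i0, i1, Fin.ext_iff]
  have e1 := gMap_apply σ hm i0
  have e2 := gMap_apply σ hm' i0
  rw [hfix _ hm] at e1
  rw [hfix _ hm', show m' i0 = m i0 by simp [m', h01]] at e2
  have hsk : ∀ k, k ≠ 0 → σ⁻¹ k ≠ idx i1 := fun k hk h => hk (σ⁻¹.injective (h.trans hs.symm))
  rw [hmark _ (hsk _ (idx_ne_zero i0)), hmark _ (hsk _ zero_ne_one'.symm),
    hmark _ (hsk _ zero_ne_two'.symm)] at e2
  have n1 := br_ne_zero (mark_ne hm (perm_ne σ (zero_ne_one' (N := N)).symm))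
  have n2 := br_ne_zero (mark_ne hm (perm_ne σ (idx_ne_two i0)))
  have n3 := br_ne_zero (mark_ne hm (perm_ne σ (one_ne_two' (N := N))))
  have n4 := br_ne_zero (mark_ne hm' (perm_ne σ (zero_ne_one' (N := N)).symm))
  rw [hmark _ (hsk _ zero_ne_one'.symm)] at n4
  have n5 := br_ne_zero (mark_ne hm (perm_ne σ (idx_ne_one i0)))
  rw [hs] at e1 e2 n1 n4
  have n6 : br (mark m (idx i1)) (mark m' (idx i1)) ≠ 0 := by
    apply br_ne_zero
    simpa [m'] using hne i1
  rw [e1] at e2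
  generalize mark m (idx i1) = a at *
  generalize mark m' (idx i1) = a' at *
  generalize mark m (σ⁻¹ (idx i0)) = p at *
  generalize mark m (σ⁻¹ 1) = b at *
  generalize mark m (σ⁻¹ 2) = c at *
  rw [div_eq_div_iff (mul_ne_zero n2 n1) (mul_ne_zero n2 n4)] at e2
  -- The Plücker relation factors the difference of the two cross ratios into brackets of distinct
  -- points.
  have e3 : br b c * br p c * (br p b * br a a') = 0 := by
    have : br p b * br a a' = br p a * br b a' - br p a' * br b a := by simp only [br]; ring
    rw [this]
    linear_combination e2
  simp [n2, n3, n5, n6] at e3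

/-- The kernel is normal, so a nontrivial element of it can be conjugated to one that moves the
index `idx 1` to `0`. -/
lemma gHom_injective {N : ℕ} (hN : 2 ≤ N) : Function.Injective (gHom N) := by
  rw [injective_iff_map_eq_one]
  intro σ hσ
  by_contra hne
  obtain ⟨x, hx⟩ : ∃ x, σ x ≠ x := by
    by_contra! h
    exact hne (Equiv.ext h)
  obtain ⟨π, h1, h2⟩ := exists_perm_of_ne hx.symm (idx_ne_zero (⟨1, hN⟩ : Fin N))
  refine gHom_apply_ne hN (σ := π * σ * π⁻¹) ?_ (by simp [hσ])
  have : π⁻¹ (idx ⟨1, hN⟩) = x := by rw [Equiv.Perm.inv_eq_iff_eq, h1]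
  rw [Equiv.Perm.mul_apply, Equiv.Perm.mul_apply, this, h2]

/-! ### Matrices acting on the sphere -/

/-- Homogeneous coordinates of a point of the sphere. -/
def hom (p : Sphere) : Fin 2 → ℂ := ![hx p, hy p]

lemma exists_mulVec_hom (M : GL (Fin 2) ℂ) (p : Sphere) :
    ∃ c : ℂ, c ≠ 0 ∧ M.val.mulVec (hom p) = c • hom (M • p) := by
  have hd := M.det_ne_zero
  rw [Matrix.det_fin_two] at hd
  rw [smul_eq_hom]
  have h0 : M.val.mulVec (hom p) =
      ![M 0 0 * hx p + M 0 1 * hy p, M 1 0 * hx p + M 1 1 * hy p] := by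
    ext i; fin_cases i <;> simp [hom]
  rw [h0]
  split_ifs with h
  · refine ⟨M 0 0 * hx p + M 0 1 * hy p, fun h1 => ?_, by ext i; fin_cases i <;> simp [hom, h]⟩
    have hx0 : (M 0 0 * M 1 1 - M 0 1 * M 1 0) * hx p = 0 := by
      linear_combination M 1 1 * h1 - M 0 1 * h
    have hy0 : (M 0 0 * M 1 1 - M 0 1 * M 1 0) * hy p = 0 := by
      linear_combination M 0 0 * h - M 1 0 * h1
    have hx0 := (mul_eq_zero.1 hx0).resolve_left hd
    have hy0 := (mul_eq_zero.1 hy0).resolve_left hd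
    induction p using OnePoint.rec <;> simp at hx0 hy0
  · refine ⟨_, h, ?_⟩
    ext i
    generalize M 1 0 * hx p + M 1 1 * hy p = d at h ⊢
    fin_cases i <;> simp [hom]
    field_simp

lemma hom_ne_zero (p : Sphere) : hom p ≠ 0 := by
  intro h
  have h0 := congrFun h 0
  have h1 := congrFun h 1
  induction p using OnePoint.rec <;> simp [hom] at h0 h1

lemma eq_of_hom_eq_smul {p q : Sphere} {c : ℂ} (h : hom p = c • hom q) : p = q := by
  have h0 := congrFun h 0
  have h1 := congrFun h 1
  simp [hom] at h0 h1
  rw [← br_eq_zero_iff, br, h0, h1]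
  ring

lemma smul_eq_of_mulVec_hom {M : GL (Fin 2) ℂ} {p q : Sphere} {c : ℂ}
    (h : M.val.mulVec (hom p) = c • hom q) : M • p = q := by
  obtain ⟨d, hd, h'⟩ := exists_mulVec_hom M p
  refine eq_of_hom_eq_smul (c := d⁻¹ * c) ?_
  rw [mul_smul, ← h, h', smul_smul, inv_mul_cancel₀ hd, one_smul]

/-- The matrix is a scalar. -/
def IsScalar (M : GL (Fin 2) ℂ) : Prop := ∃ c : ℂ, M.val = c • (1 : Matrix (Fin 2) (Fin 2) ℂ)

lemma isScalar_of_smul {M : GL (Fin 2) ℂ} (h : ∀ p : Sphere, M • p = p) : IsScalar M := by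
  have h0 := h ((0 : ℂ) : Sphere)
  have h1 := h ((1 : ℂ) : Sphere)
  have e10 : M 1 0 = 0 := OnePoint.smul_infty_eq_self_iff.1 (h OnePoint.infty)
  have hdet := M.det_ne_zero
  rw [Matrix.det_fin_two, e10, mul_zero, sub_zero] at hdet
  have e11 : M 1 1 ≠ 0 := right_ne_zero_of_mul hdet
  rw [OnePoint.smul_some_eq_ite] at h0 h1
  have e01 : M 0 1 = 0 := by simpa [e10, e11] using h0
  have e00 : M 0 0 = M 1 1 := by simpa [e10, e11, e01, div_eq_one_iff_eq] using h1
  refine ⟨M 1 1, ?_⟩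
  ext i j
  fin_cases i <;> fin_cases j <;> simp [e10, e01, e00]

lemma IsScalar.smul {M : GL (Fin 2) ℂ} (h : IsScalar M) (p : Sphere) : M • p = p := by
  obtain ⟨c, hc⟩ := h
  refine smul_eq_of_mulVec_hom (c := c) ?_
  rw [hc]
  simp [Matrix.smul_mulVec]

/-- Matrices with the same action on the sphere are proportional. -/
lemma exists_smul_eq_of_smul_eq {M M' : GL (Fin 2) ℂ} (h : ∀ p : Sphere, M • p = M' • p) :
    ∃ c : ℂ, c ≠ 0 ∧ M.val = c • M'.val := by
  obtain ⟨c, hc⟩ := isScalar_of_smul (M := M'⁻¹ * M) (fun p => by rw [mul_smul, h, inv_smul_smul])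
  have h1 : M.val = c • M'.val := by
    have : M = M' * (M'⁻¹ * M) := by group
    conv_lhs => rw [this, Units.val_mul, hc]
    simp
  refine ⟨c, fun h0 => ?_, h1⟩
  have := M.det_ne_zero
  rw [h1, h0] at this
  simp at this

lemma smul_eq_of_val_eq_smul {M M' : GL (Fin 2) ℂ} {c : ℂ} (h : M.val = c • M'.val)
    (p : Sphere) : M • p = M' • p := by
  obtain ⟨d, -, hd⟩ := exists_mulVec_hom M' p
  refine smul_eq_of_mulVec_hom (c := c * d) ?_
  rw [h, Matrix.smul_mulVec, hd, smul_smul]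

lemma invariant_eq_of_val_eq_smul {M M' : GL (Fin 2) ℂ} {c : ℂ} (hc : c ≠ 0)
    (h : M.val = c • M'.val) : invariant M = invariant M' := by
  have := M'.det_ne_zero
  rw [invariant, invariant, h, Matrix.trace_smul, Matrix.det_smul]
  simp
  field_simp

lemma invariant_eq_of_smul_eq {M M' : GL (Fin 2) ℂ} (h : ∀ p : Sphere, M • p = M' • p) :
    invariant M = invariant M' := by
  obtain ⟨c, hc, h⟩ := exists_smul_eq_of_smul_eq h
  exact invariant_eq_of_val_eq_smul hc h

lemma invariant_conj (M h : GL (Fin 2) ℂ) : invariant (h * M * h⁻¹) = invariant M := by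
  rw [invariant, invariant, Units.val_mul, Units.val_mul, Matrix.trace_mul_comm,
    ← mul_assoc, ← Units.val_mul, inv_mul_cancel, Matrix.det_mul_right_comm]
  simp

/-- Scalars act trivially by conjugation, so the adjoint representation depends only on the linear
fractional transformation. -/
lemma adjoint_eq_of_smul_eq {M M' : GL (Fin 2) ℂ} (h : ∀ p : Sphere, M • p = M' • p) :
    adjoint M = adjoint M' := by
  obtain ⟨c, hc⟩ := isScalar_of_smul (M := M'⁻¹ * M) (fun p => by rw [mul_smul, h, inv_smul_smul])
  have h1 : adjoint (M'⁻¹ * M) = 1 := by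
    refine LinearMap.ext fun v => ?_
    rw [← slCoord_slMatrix (adjoint _ v), slMatrix_adjoint]
    have h2 : (M'⁻¹ * M).val * slMatrix v = slMatrix v * (M'⁻¹ * M).val := by rw [hc]; simp
    rw [h2, mul_assoc, ← Units.val_mul, mul_inv_cancel, Units.val_one, mul_one, slCoord_slMatrix]
    rfl
  have h2 : M = M' * (M'⁻¹ * M) := by group
  rw [h2, map_mul, h1, mul_one]

end ModuliZero
end

noncomputable section
namespace ModuliZero

/-! ### The group of linear fractional transformations preserving the marked points -/

section MarkGroup

variable {N : ℕ}

/-- The matrices whose linear fractional transformations permute the marked points. -/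
def markGroup (l : K N) : Subgroup (GL (Fin 2) ℂ) where
  carrier := {M | ∃ σ : Equiv.Perm (Fin (N + 3)), ∀ k, M • mark l.1 k = mark l.1 (σ k)}
  one_mem' := ⟨1, fun k => by simp⟩
  mul_mem' := by
    rintro M M' ⟨σ, h⟩ ⟨σ', h'⟩
    exact ⟨σ * σ', fun k => by rw [mul_smul, h', h]; rfl⟩
  inv_mem' := by
    rintro M ⟨σ, h⟩
    exact ⟨σ⁻¹, fun k => by rw [inv_smul_eq_iff, h]; simp⟩

variable {l : K N}

lemma mark_inj {j k : Fin (N + 3)} (h : mark l.1 j = mark l.1 k) : j = k :=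
  (mark_injective_iff l.1).2 l.2 h

/-- The permutation of the marked points by an element of `markGroup`. -/
def markPerm (l : K N) : markGroup l →* Equiv.Perm (Fin (N + 3)) where
  toFun M := M.2.choose
  map_one' := by
    ext k : 1
    apply mark_inj (l := l)
    rw [← (1 : markGroup l).2.choose_spec]
    simp
  map_mul' M M' := by
    ext k : 1
    apply mark_inj (l := l)
    rw [← (M * M').2.choose_spec, Equiv.Perm.mul_apply, ← M.2.choose_spec, ← M'.2.choose_spec]
    exact mul_smul M.1 M'.1 _

lemma smul_mark (M : markGroup l) (k : Fin (N + 3)) :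
    M.1 • mark l.1 k = mark l.1 (markPerm l M k) := M.2.choose_spec k

lemma markPerm_eq {M : markGroup l} {σ : Equiv.Perm (Fin (N + 3))}
    (h : ∀ k, M.1 • mark l.1 k = mark l.1 (σ k)) : markPerm l M = σ := by
  ext k : 1
  apply mark_inj (l := l)
  rw [← smul_mark, h]

lemma fGL_markPerm_smul (M : markGroup l) (p : Sphere) :
    fGL (markPerm l M) l.1 • p = M.1 • p := by
  have h : ∀ k, M.1 • mark l.1 ((markPerm l M)⁻¹ k) = mark l.1 k := fun k => by
    rw [smul_mark]; simp
  exact (normGL_unique (mark_ne l.2 (perm_ne _ zero_ne_one')) (mark_ne l.2 (perm_ne _ zero_ne_two'))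
    (mark_ne l.2 (perm_ne _ one_ne_two')) (h 0) (h 1) (h 2) p).symm

lemma gMap_markPerm (M : markGroup l) : gMap (markPerm l M) l.1 = l.1 := by
  apply mark_ext
  intro k
  rw [← fGL_smul_mark _ l.2, fGL_markPerm_smul, smul_mark]
  simp

/-- The homomorphism to the stabilizer of `λ`. -/
def toStab (l : K N) : markGroup l →* Stab l where
  toFun M := ⟨⟨gHom N (markPerm l M), ⟨_, rfl⟩⟩, Subtype.ext (gMap_markPerm M)⟩
  map_one' := by simp
  map_mul' M M' := by simp; rfl

lemma coe_toStab (M : markGroup l) : (toStab l M).1.1 = gHom N (markPerm l M) := rfl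

/-- When `g_σ` fixes `λ`, the transformation `f_σ` carries the marked points of `λ` to themselves,
by the permutation `σ`. -/
lemma exists_toStab_eq {g : Stab l} {σ : Equiv.Perm (Fin (N + 3))} (h : gHom N σ = g.1.1) :
    ∃ M : markGroup l, toStab l M = g ∧ M.1 = fGL σ l.1 := by
  have hfix : gMap σ l.1 = l.1 := by
    have h1 : (g.1.1 l) = l := g.2
    rw [← h] at h1
    exact congrArg Subtype.val h1
  have hk : ∀ k, fGL σ l.1 • mark l.1 k = mark l.1 (σ k) := fun k => by
    have := fGL_smul_mark σ l.2 (σ k)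
    rwa [hfix, Equiv.Perm.inv_def, Equiv.symm_apply_apply] at this
  obtain ⟨M, hM⟩ : ∃ M : markGroup l, M.1 = fGL σ l.1 := ⟨⟨fGL σ l.1, σ, hk⟩, rfl⟩
  have h0 : markPerm l M = σ := markPerm_eq (by rwa [hM])
  have h1 : (toStab l M).1.1 = g.1.1 := by rw [coe_toStab, h0]; exact h
  exact ⟨M, Subtype.val_injective (Subtype.val_injective h1), hM⟩

lemma toStab_surjective (l : K N) : Function.Surjective (toStab l) := fun g => by
  obtain ⟨σ, hσ⟩ := g.1.2
  obtain ⟨M, hM, -⟩ := exists_toStab_eq hσ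
  exact ⟨M, hM⟩

/-- Faithfulness of `gHom` enters here: a trivial `g_σ` has `σ = 1`, and then `M` fixes `0`, `1`,
`∞`. -/
lemma toStab_eq_one_iff (hN : 2 ≤ N) (M : markGroup l) :
    toStab l M = 1 ↔ ∀ p : Sphere, M.1 • p = p := by
  constructor
  · intro h
    have h1 : gHom N (markPerm l M) = gHom N 1 := by
      rw [← coe_toStab, h, map_one]; rfl
    have h2 := gHom_injective hN h1
    have h3 : ∀ k, M.1 • mark l.1 k = mark l.1 k := fun k => by rw [smul_mark, h2]; rfl
    exact fun p => smul_trivial M.1 (h3 0) (h3 1) (h3 2) p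
  · intro h
    have h2 : markPerm l M = 1 := markPerm_eq fun k => h _
    exact Subtype.ext (Subtype.ext (by rw [coe_toStab, h2, map_one]; rfl))

lemma isRotationOfAngle_toStab_iff (hN : 2 ≤ N) (M : markGroup l) (θ : ℝ) :
    IsRotationOfAngle θ (toStab l M) ↔
      ∃ h : GL (Fin 2) ℂ, ∀ p : Sphere, (h * M.1 * h⁻¹) • p = rotation θ • p := by
  constructor
  · rintro ⟨σ, hσ, ψ, ⟨h, rfl⟩, hψ⟩
    have h1 : σ = markPerm l M := gHom_injective hN hσ
    refine ⟨h, fun p => ?_⟩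
    have := congrArg (fun f : Equiv.Perm Sphere => f p) hψ
    rw [h1] at this
    rw [mul_smul, mul_smul, ← fGL_markPerm_smul]
    exact this
  · rintro ⟨h, hh⟩
    refine ⟨markPerm l M, rfl, MulAction.toPermHom _ _ h, ⟨h, rfl⟩, ?_⟩
    ext p : 1
    rw [← map_inv]
    change h • fGL (markPerm l M) l.1 • h⁻¹ • p = rotation θ • p
    rw [fGL_markPerm_smul, ← hh, mul_smul, mul_smul]

end MarkGroup

/-! ### Invariants of matrices of finite order modulo scalars -/

lemma mul_self_eq (A : Matrix (Fin 2) (Fin 2) ℂ) : A * A = A.trace • A - A.det • 1 := by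
  ext i j
  fin_cases i <;> fin_cases j <;>
    simp [Matrix.mul_apply, Matrix.trace_fin_two, Matrix.det_fin_two] <;> ring

/-- By Cayley–Hamilton a power of `M` has the form `a M + b`; if it is scalar and `M` is not, then
`a = 0`. With `t` the trace and `d` the determinant, `a` is `t` for squares, `t² - d` for cubes and
`t⁴ - 3t²d + d²` for fifth powers. -/
lemma isScalar_of_linear {M : GL (Fin 2) ℂ} {a b : ℂ} (ha : a ≠ 0)
    (h : a • M.val = b • (1 : Matrix (Fin 2) (Fin 2) ℂ)) : IsScalar M :=
  ⟨a⁻¹ * b, by rw [mul_smul, ← h, smul_smul, inv_mul_cancel₀ ha, one_smul]⟩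

lemma trace_eq_zero_of_sq {M : GL (Fin 2) ℂ} (h : IsScalar (M ^ 2)) (hM : ¬ IsScalar M) :
    M.val.trace = 0 := by
  by_contra ht
  obtain ⟨c, hc⟩ := h
  refine hM (isScalar_of_linear ht (b := c + M.val.det) ?_)
  rw [Units.val_pow_eq_pow_val, sq, mul_self_eq] at hc
  rw [add_smul, ← hc]; abel

lemma trace_sq_eq_det_of_cube {M : GL (Fin 2) ℂ} (h : IsScalar (M ^ 3)) (hM : ¬ IsScalar M) :
    M.val.trace ^ 2 = M.val.det := by
  by_contra ht
  obtain ⟨c, hc⟩ := h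
  refine hM (isScalar_of_linear (sub_ne_zero.2 ht) (b := c + M.val.trace * M.val.det) ?_)
  have h3 : M.val ^ 3 = (M.val * M.val) * M.val := by noncomm_ring
  rw [Units.val_pow_eq_pow_val, h3, mul_self_eq, sub_mul, smul_mul_assoc, smul_mul_assoc, one_mul,
    mul_self_eq] at hc
  rw [add_smul, ← hc]
  module

lemma trace_relation_of_fifth {M : GL (Fin 2) ℂ} (h : IsScalar (M ^ 5)) (hM : ¬ IsScalar M) :
    M.val.trace ^ 4 - 3 * M.val.trace ^ 2 * M.val.det + M.val.det ^ 2 = 0 := by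
  by_contra ht
  obtain ⟨c, hc⟩ := h
  set A := M.val with hA
  set t := A.trace
  set d := A.det
  refine hM (isScalar_of_linear ht (b := c + t ^ 3 * d - 2 * t * d ^ 2) ?_)
  have h2 : A * A = t • A - d • 1 := mul_self_eq A
  have h3 : A * A * A = (t ^ 2 - d) • A - (t * d) • 1 := by
    rw [h2, sub_mul, smul_mul_assoc, h2, smul_mul_assoc, one_mul]; module
  have h5 : A ^ 5 = (A * A * A) * (A * A) := by noncomm_ring
  have h6 : (A * A * A) * (A * A) =
      (t ^ 4 - 3 * t ^ 2 * d + d ^ 2) • A - (t ^ 3 * d - 2 * t * d ^ 2) • 1 := by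
    rw [h3, h2, sub_mul, mul_sub, mul_sub, smul_mul_smul_comm, h2]
    simp only [smul_mul_assoc, mul_smul_comm, mul_one, one_mul]
    module
  rw [Units.val_pow_eq_pow_val, h5, h6] at hc
  rw [show c + t ^ 3 * d - 2 * t * d ^ 2 = c + (t ^ 3 * d - 2 * t * d ^ 2) by ring,
    add_smul c, ← hc]
  module

/-- With `q` the ratio of the eigenvalues, `invariant M - 2 = q + q⁻¹` and `invariant (M ^ 2) = q² +
2 + q⁻²`. -/
lemma invariant_sq (M : GL (Fin 2) ℂ) : invariant (M ^ 2) = (invariant M - 2) ^ 2 := by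
  have hd := M.det_ne_zero
  rw [invariant, invariant, Units.val_pow_eq_pow_val, sq M.val, mul_self_eq, ← mul_self_eq,
    Matrix.det_mul, mul_self_eq]
  simp only [Matrix.trace_sub, Matrix.trace_smul, Matrix.trace_one, smul_eq_mul]
  simp
  field_simp

/-- The square root of five, as a complex number. -/
abbrev rootFive : ℂ := ((√5 : ℝ) : ℂ)

lemma invariant_of_fifth {M : GL (Fin 2) ℂ} (h : IsScalar (M ^ 5)) (hM : ¬ IsScalar M) :
    invariant M = (3 + rootFive) / 2 ∨ invariant M = (3 - rootFive) / 2 := by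
  have hd := M.det_ne_zero
  have h1 : invariant M ^ 2 - 3 * invariant M + 1 = 0 := by
    have := trace_relation_of_fifth h hM
    rw [invariant]
    field_simp
    linear_combination this
  have h5 := sqrt_five_sq
  have h2 : (invariant M - (3 + rootFive) / 2) * (invariant M - (3 - rootFive) / 2) = 0 := by
    linear_combination h1 - h5 / 4
  rcases mul_eq_zero.1 h2 with h3 | h3
  · exact Or.inl (sub_eq_zero.1 h3)
  · exact Or.inr (sub_eq_zero.1 h3)

/-- The value of `invariant` on the conjugacy classes of `A₅`. -/
def classInvariant : Fin 5 → ℂ := ![4, (3 + rootFive) / 2, (3 - rootFive) / 2, 1, 0]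

lemma rootFive_ne : rootFive ≠ 0 ∧ rootFive ≠ 1 ∧ rootFive ≠ -1 ∧ rootFive ≠ 3 ∧
    rootFive ≠ -3 ∧ rootFive ≠ 5 ∧ rootFive ≠ -5 := by
  have h := sqrt_five_sq
  change rootFive ^ 2 = 5 at h
  refine ⟨?_, ?_, ?_, ?_, ?_, ?_, ?_⟩ <;> intro h' <;> rw [h'] at h <;> norm_num at h

lemma classInvariant_injective : Function.Injective classInvariant := by
  obtain ⟨h0, h1, h2, h3, h4, h5, h6⟩ := rootFive_ne
  intro i j h
  fin_cases i <;> fin_cases j <;> simp [classInvariant] at h ⊢ <;> grind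

lemma invariant_rotation (θ : ℝ) : invariant (rotation θ) = 2 + 2 * Complex.cos θ := by
  have h0 := Complex.exp_ne_zero (θ * Complex.I)
  have h1 : Complex.exp (-θ * Complex.I) = (Complex.exp (θ * Complex.I))⁻¹ := by
    rw [← Complex.exp_neg]; ring_nf
  rw [invariant, Complex.cos, h1]
  simp [rotation, Matrix.trace_fin_two, Matrix.det_fin_two]
  field_simp
  ring

lemma cos_classAngle (c : Fin 5) : 2 + 2 * Complex.cos (classAngle c) = classInvariant c := by
  have h5 : (√5 : ℝ) ^ 2 = 5 := Real.sq_sqrt (by norm_num)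
  have h1 : Real.cos (2 * Real.pi / 5) = (√5 - 1) / 4 := by
    rw [mul_div_assoc, Real.cos_two_mul, Real.cos_pi_div_five]; grind
  have h2 : Real.cos (4 * Real.pi / 5) = -(1 + √5) / 4 := by
    rw [show 4 * Real.pi / 5 = Real.pi - Real.pi / 5 by ring, Real.cos_pi_sub,
      Real.cos_pi_div_five]; ring
  have h3 : Real.cos (2 * Real.pi / 3) = -1 / 2 := by
    rw [show 2 * Real.pi / 3 = Real.pi - Real.pi / 3 by ring, Real.cos_pi_sub,
      Real.cos_pi_div_three]; ring
  rw [← Complex.ofReal_cos]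
  fin_cases c
  · simp [classAngle, classInvariant]; norm_num
  · change 2 + 2 * ((Real.cos (2 * Real.pi / 5) : ℝ) : ℂ) = (3 + rootFive) / 2
    rw [h1]; push_cast; ring
  · change 2 + 2 * ((Real.cos (4 * Real.pi / 5) : ℝ) : ℂ) = (3 - rootFive) / 2
    rw [h2]; push_cast; ring
  · change 2 + 2 * ((Real.cos (2 * Real.pi / 3) : ℝ) : ℂ) = 1
    rw [h3]; push_cast; ring
  · simp [classAngle, classInvariant]

end ModuliZero
end

noncomputable section
namespace ModuliZero

/-! ### Simultaneous conjugation of matrices -/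

/-- The matrix with the given independent columns. -/
def columns (u v : Fin 2 → ℂ) (h : vdet u v ≠ 0) : GL (Fin 2) ℂ :=
  Matrix.GeneralLinearGroup.mkOfDetNeZero !![u 0, v 0; u 1, v 1]
    (by rw [Matrix.det_fin_two_of]; exact h)

lemma mul_columns {u v : Fin 2 → ℂ} (h : vdet u v ≠ 0) (A : Matrix (Fin 2) (Fin 2) ℂ)
    (a b c d : ℂ) (hu : A.mulVec u = a • u + c • v) (hv : A.mulVec v = b • u + d • v) :
    A * (columns u v h).val = (columns u v h).val * !![a, b; c, d] := by
  have u0 := congrFun hu 0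
  have u1 := congrFun hu 1
  have v0 := congrFun hv 0
  have v1 := congrFun hv 1
  simp [Matrix.mulVec, dotProduct, Fin.sum_univ_two] at u0 u1 v0 v1
  have hc : (columns u v h).val = !![u 0, v 0; u 1, v 1] := rfl
  rw [hc]
  ext i j
  fin_cases i <;> fin_cases j <;> simp [Matrix.mul_apply, Fin.sum_univ_two] <;> grind

lemma exists_eigenvector (A : Matrix (Fin 2) (Fin 2) ℂ) (μ : ℂ)
    (h : μ ^ 2 - A.trace * μ + A.det = 0) : ∃ v ≠ 0, A.mulVec v = μ • v := by
  have hd : (A - μ • 1).det = 0 := by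
    rw [Matrix.det_fin_two]
    rw [Matrix.det_fin_two, Matrix.trace_fin_two] at h
    simp
    linear_combination h
  obtain ⟨v, hv, h0⟩ := Matrix.exists_mulVec_eq_zero_iff.2 hd
  refine ⟨v, hv, ?_⟩
  rw [Matrix.sub_mulVec, Matrix.smul_mulVec, Matrix.one_mulVec] at h0
  exact sub_eq_zero.1 h0

lemma exists_smul_of_vdet_eq_zero {u v : Fin 2 → ℂ} (hu : u ≠ 0) (h : vdet u v = 0) :
    ∃ c : ℂ, v = c • u := by
  rw [vdet] at h
  by_cases h0 : u 0 = 0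
  · have h1 : u 1 ≠ 0 := fun h1 => hu (by ext i; fin_cases i <;> simp [h0, h1])
    refine ⟨v 1 / u 1, ?_⟩
    ext i
    fin_cases i
    · simp [h0] at h ⊢
      exact h.resolve_right h1
    · simp
      field_simp
  · refine ⟨v 0 / u 0, ?_⟩
    ext i
    fin_cases i
    · simp
      field_simp
    · simp
      field_simp
      linear_combination h

/-- A nonscalar matrix with the invariant of a rotation is conjugate to it up to scalars. -/
lemma exists_conj_rotation {M : GL (Fin 2) ℂ} {θ : ℝ} (h : invariant M = invariant (rotation θ))
    (hθ : invariant (rotation θ) ≠ 4) :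
    ∃ g : GL (Fin 2) ℂ, ∀ p : Sphere, (g * M * g⁻¹) • p = rotation θ • p := by
  set ω := Complex.exp (θ * Complex.I) with hω
  have hω0 : ω ≠ 0 := Complex.exp_ne_zero _
  have hd := M.det_ne_zero
  have hinv : invariant (rotation θ) = (ω + 1) ^ 2 / ω := by
    simp [invariant, rotation, Matrix.trace_fin_two, Matrix.det_fin_two, hω]
  have hω1 : ω ≠ 1 := fun h1 => hθ (by rw [hinv, h1]; norm_num)
  rw [hinv, invariant, div_eq_div_iff hd hω0] at h
  -- The eigenvalues are to be `μ ω` and `μ`. The trace determines `μ` unless `ω = -1`, where the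
  -- trace vanishes and `μ` is a square root taken from the determinant.
  obtain ⟨μ, hμt, hμd⟩ : ∃ μ : ℂ, M.val.trace = μ * (ω + 1) ∧ M.val.det = μ ^ 2 * ω := by
    by_cases h1 : ω + 1 = 0
    · obtain ⟨μ, hμ⟩ := IsAlgClosed.exists_pow_nat_eq (M.val.det / ω) (n := 2) (by norm_num)
      refine ⟨μ, ?_, by rw [hμ]; field_simp⟩
      rw [h1] at h ⊢
      simpa [hω0] using h
    · refine ⟨M.val.trace / (ω + 1), by field_simp, ?_⟩
      field_simp
      linear_combination -h
  have hμ0 : μ ≠ 0 := fun h0 => hd (by rw [hμd, h0]; ring)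
  obtain ⟨u, hu0, hu⟩ := exists_eigenvector M.val (μ * ω) (by rw [hμt, hμd]; ring)
  obtain ⟨v, hv0, hv⟩ := exists_eigenvector M.val μ (by rw [hμt, hμd]; ring)
  have huv : vdet u v ≠ 0 := fun h0 => by
    obtain ⟨c, hc⟩ := exists_smul_of_vdet_eq_zero hu0 h0
    rw [hc, Matrix.mulVec_smul, hu, smul_smul, smul_smul, ← sub_eq_zero, ← sub_smul] at hv
    have hc0 : c ≠ 0 := fun h0 => hv0 (by rw [hc, h0, zero_smul])
    have h1 := (smul_eq_zero.1 hv).resolve_right hu0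
    have h2 : c * μ * (ω - 1) = 0 := by linear_combination h1
    simp [hc0, hμ0, sub_eq_zero, hω1] at h2
  set Q := columns u v huv
  have hQ := mul_columns huv M.val (μ * ω) 0 0 μ (by simp [hu]) (by simp [hv])
  refine ⟨Q⁻¹, fun p => ?_⟩
  refine smul_eq_of_val_eq_smul (c := μ) ?_ p
  rw [inv_inv, mul_assoc, Units.val_mul, Units.val_mul, hQ, ← mul_assoc, ← Units.val_mul,
    inv_mul_cancel, Units.val_one, one_mul]
  ext i j
  fin_cases i <;> fin_cases j <;> simp [rotation, hω]

/-- A pair of matrices of determinant one with `tr A = 0`, `tr B = 1` and `tr (A B) = s`, where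
`s² ≠ 3`, is determined up to simultaneous conjugation. -/
lemma exists_normal_form {A B : GL (Fin 2) ℂ} {s : ℂ} (hs : s ^ 2 ≠ 3) (hAd : A.val.det = 1)
    (hBd : B.val.det = 1) (hA : A.val.trace = 0) (hB : B.val.trace = 1)
    (hAB : (A.val * B.val).trace = s) :
    ∃ Q : GL (Fin 2) ℂ, A.val * Q.val = Q.val * !![Complex.I, s + Complex.I; 0, -Complex.I] ∧
      B.val * Q.val = Q.val * !![0, -1; 1, 1] := by
  have hI := Complex.I_sq
  -- In the basis of an eigenvector `v` of `A` and its image `B v`, the entries of both matrices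
  -- depend on `s` alone.
  obtain ⟨v, hv0, hv⟩ := exists_eigenvector A.val Complex.I (by rw [hA, hAd, hI]; ring)
  set w := B.val.mulVec v with hw
  have hBw : B.val.mulVec w = -v + w := by
    rw [hw, Matrix.mulVec_mulVec, mul_self_eq, hB, hBd, Matrix.sub_mulVec, one_smul, one_smul,
      Matrix.one_mulVec]
    abel
  -- `A B + B A = tr (A) B + tr (B) A + (tr (A B) - tr A tr B)`
  have hAw : A.val.mulVec w = (s + Complex.I) • v + (-Complex.I) • w := by
    have h1 : A.val * B.val = A.val + s • 1 - B.val * A.val := by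
      ext i j
      simp [Matrix.trace_fin_two, Matrix.mul_apply, Fin.sum_univ_two] at hA hB hAB
      fin_cases i <;> fin_cases j <;> simp [Matrix.mul_apply, Fin.sum_univ_two] <;> grind
    rw [hw, Matrix.mulVec_mulVec, h1, Matrix.sub_mulVec, Matrix.add_mulVec, Matrix.smul_mulVec,
      Matrix.one_mulVec, ← Matrix.mulVec_mulVec, hv, Matrix.mulVec_smul]
    module
  -- A common eigenvector, with `B v = c v`, would give `c² - c + 1 = 0` and `s = i (2c - 1)`, hence
  -- `s² = 3`.
  have hvw : vdet v w ≠ 0 := fun h0 => by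
    obtain ⟨c, hc⟩ := exists_smul_of_vdet_eq_zero hv0 h0
    rw [hc, Matrix.mulVec_smul, hv] at hAw
    rw [hc, Matrix.mulVec_smul, ← hw, hc] at hBw
    have e1 : (2 * Complex.I * c - s - Complex.I) • v = 0 := by
      have h2 : (2 * Complex.I * c - s - Complex.I) • v = c • Complex.I • v -
        ((s + Complex.I) • v + -Complex.I • c • v) := by module
      rw [h2, hAw, sub_self]
    have e2 : (c ^ 2 - c + 1) • v = 0 := by
      have h2 : (c ^ 2 - c + 1) • v = c • c • v - (-v + c • v) := by module
      rw [h2, hBw, sub_self]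
    have e1 := (smul_eq_zero.1 e1).resolve_right hv0
    have e2 := (smul_eq_zero.1 e2).resolve_right hv0
    apply hs
    have e3 : s = Complex.I * (2 * c - 1) := by linear_combination -e1
    rw [e3, mul_pow, hI]
    linear_combination -4 * e2
  exact ⟨columns v w hvw, mul_columns hvw _ _ _ _ _ (by simp [hv]) hAw,
    mul_columns hvw _ _ _ _ _ (by simp [hw]) (by rw [hBw]; module)⟩

lemma exists_smul_det_eq_one (A : GL (Fin 2) ℂ) :
    ∃ A' : GL (Fin 2) ℂ, A'.val.det = 1 ∧ ∃ c : ℂ, c ≠ 0 ∧ A'.val = c • A.val := by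
  have hd := A.det_ne_zero
  obtain ⟨c, hc⟩ := IsAlgClosed.exists_pow_nat_eq (A.val.det)⁻¹ (n := 2) (by norm_num)
  have hdet : (c • A.val).det = 1 := by
    rw [Matrix.det_smul, Fintype.card_fin, hc, inv_mul_cancel₀ hd]
  refine ⟨Matrix.GeneralLinearGroup.mkOfDetNeZero _ (by rw [hdet]; exact one_ne_zero), hdet, c,
    fun h0 => ?_, rfl⟩
  rw [h0] at hc
  exact inv_ne_zero hd (by rw [← hc]; ring)

/-- Normalisation of the traces of a pair by signs. -/
lemma exists_normalized_pair {A B : GL (Fin 2) ℂ} {s : ℂ} (hA : invariant A = 0)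
    (hB : invariant B = 1) (hAB : invariant (A * B) = s ^ 2) :
    ∃ A' B' : GL (Fin 2) ℂ, A'.val.det = 1 ∧ B'.val.det = 1 ∧ A'.val.trace = 0 ∧
      B'.val.trace = 1 ∧ (A'.val * B'.val).trace = s ∧ (∀ p : Sphere, A' • p = A • p) ∧
      (∀ p : Sphere, B' • p = B • p) := by
  obtain ⟨A₁, hA₁, a, ha, hA₁a⟩ := exists_smul_det_eq_one A
  obtain ⟨B₁, hB₁, b, hb, hB₁b⟩ := exists_smul_det_eq_one B
  have iA := invariant_eq_of_val_eq_smul ha hA₁a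
  have iB := invariant_eq_of_val_eq_smul hb hB₁b
  have iAB : invariant (A₁ * B₁) = invariant (A * B) :=
    invariant_eq_of_val_eq_smul (mul_ne_zero ha hb) (by
      rw [Units.val_mul, hA₁a, hB₁b, Units.val_mul, smul_mul_smul_comm])
  rw [hA, invariant, hA₁, div_one, sq_eq_zero_iff] at iA
  rw [hB, invariant, hB₁, div_one, sq_eq_one_iff] at iB
  rw [hAB, invariant, Units.val_mul, Matrix.det_mul, hA₁, hB₁, mul_one, div_one,
    sq_eq_sq_iff_eq_or_eq_neg] at iAB
  have key : ∀ M : GL (Fin 2) ℂ, M.val.det = 1 → (-M).val.det = 1 := fun M hM => by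
    rw [Units.val_neg, Matrix.det_neg, hM]; simp
  obtain ⟨B₂, hB₂d, hB₂t, hB₂s, ε, hε, hB₂ε⟩ : ∃ B₂ : GL (Fin 2) ℂ, B₂.val.det = 1 ∧
      B₂.val.trace = 1 ∧ (∀ p : Sphere, B₂ • p = B • p) ∧
      ∃ ε : ℂ, (ε = 1 ∨ ε = -1) ∧ B₂.val = ε • B₁.val := by
    rcases iB with h | h
    · exact ⟨B₁, hB₁, h, smul_eq_of_val_eq_smul hB₁b, 1, Or.inl rfl, by simp⟩
    · refine ⟨-B₁, key _ hB₁, by rw [Units.val_neg, Matrix.trace_neg, h, neg_neg],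
        smul_eq_of_val_eq_smul (c := -b) (by rw [Units.val_neg, hB₁b, neg_smul]), -1, Or.inr rfl,
        by simp⟩
  -- The sign of `B` is spent on making its trace `1`. The sign of `A`, whose trace is zero, is
  -- still free to correct the trace of the product.
  have iAB₂ : (A₁.val * B₂.val).trace = s ∨ (A₁.val * B₂.val).trace = -s := by
    rw [hB₂ε, mul_smul_comm, Matrix.trace_smul]
    rcases hε with rfl | rfl <;> rcases iAB with h | h <;> simp [h]
  rcases iAB₂ with h | h
  · exact ⟨A₁, B₂, hA₁, hB₂d, iA, hB₂t, h, smul_eq_of_val_eq_smul hA₁a, hB₂s⟩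
  · refine ⟨-A₁, B₂, key _ hA₁, hB₂d, by rw [Units.val_neg, Matrix.trace_neg, iA, neg_zero], hB₂t,
      by rw [Units.val_neg, neg_mul, Matrix.trace_neg, h, neg_neg],
      smul_eq_of_val_eq_smul (c := -a) (by rw [Units.val_neg, hA₁a, neg_smul]), hB₂s⟩

/-- Two pairs with the same invariants `0`, `1`, `s²` of `A`, `B`, `A B` are simultaneously
conjugate up to scalars. -/
theorem exists_simultaneous_conj {A B A₀ B₀ : GL (Fin 2) ℂ} {s : ℂ} (hs : s ^ 2 ≠ 3)
    (hA : invariant A = 0) (hB : invariant B = 1) (hAB : invariant (A * B) = s ^ 2)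
    (hA₀ : invariant A₀ = 0) (hB₀ : invariant B₀ = 1) (hAB₀ : invariant (A₀ * B₀) = s ^ 2) :
    ∃ h : GL (Fin 2) ℂ, (∀ p : Sphere, h • A • p = A₀ • h • p) ∧
      ∀ p : Sphere, h • B • p = B₀ • h • p := by
  obtain ⟨A', B', h1, h2, h3, h4, h5, h6, h7⟩ := exists_normalized_pair hA hB hAB
  obtain ⟨A₀', B₀', k1, k2, k3, k4, k5, k6, k7⟩ := exists_normalized_pair hA₀ hB₀ hAB₀
  obtain ⟨Q, q1, q2⟩ := exists_normal_form hs h1 h2 h3 h4 h5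
  obtain ⟨R, r1, r2⟩ := exists_normal_form hs k1 k2 k3 k4 k5
  have key : ∀ (M M₀ : GL (Fin 2) ℂ) (C : Matrix (Fin 2) (Fin 2) ℂ), M.val * Q.val = Q.val * C →
      M₀.val * R.val = R.val * C → (R * Q⁻¹) * M = M₀ * (R * Q⁻¹) := by
    intro M M₀ C hM hM₀
    have e1 : (Q⁻¹ * M * Q).val = C := by
      rw [Units.val_mul, Units.val_mul, mul_assoc, hM, ← mul_assoc, ← Units.val_mul,
        inv_mul_cancel, Units.val_one, one_mul]
    have e2 : (R⁻¹ * M₀ * R).val = C := by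
      rw [Units.val_mul, Units.val_mul, mul_assoc, hM₀, ← mul_assoc, ← Units.val_mul,
        inv_mul_cancel, Units.val_one, one_mul]
    have e3 : Q⁻¹ * M * Q = R⁻¹ * M₀ * R := Units.ext (e1.trans e2.symm)
    calc R * Q⁻¹ * M = R * (Q⁻¹ * M * Q) * Q⁻¹ := by group
      _ = M₀ * (R * Q⁻¹) := by rw [e3]; group
  refine ⟨R * Q⁻¹, fun p => ?_, fun p => ?_⟩
  · rw [← h6, ← k6, ← mul_smul, ← mul_smul, key A' A₀' _ q1 r1]
  · rw [← h7, ← k7, ← mul_smul, ← mul_smul, key B' B₀' _ q2 r2]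

end ModuliZero
end

noncomputable section
namespace ModuliZero

/-! ### The stabilizer as the alternating group -/

section Marked

variable {N : ℕ} {l : K N}

/-- The homomorphism from `markGroup l` to `A₅` given by an identification of the stabilizer. -/
def markHom (e : Stab l ≃* A5) : markGroup l →* A5 := e.toMonoidHom.comp (toStab l)

lemma markHom_surjective (e : Stab l ≃* A5) : Function.Surjective (markHom e) :=
  e.surjective.comp (toStab_surjective l)

lemma markHom_eq_one_iff (hN : 2 ≤ N) (e : Stab l ≃* A5) (M : markGroup l) :
    markHom e M = 1 ↔ ∀ p : Sphere, M.1 • p = p := by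
  rw [← toStab_eq_one_iff hN]
  exact map_eq_one_iff e e.injective

lemma markHom_eq_iff (hN : 2 ≤ N) (e : Stab l ≃* A5) (M M' : markGroup l) :
    markHom e M = markHom e M' ↔ ∀ p : Sphere, M.1 • p = M'.1 • p := by
  rw [← inv_mul_eq_one, ← map_inv, ← map_mul, markHom_eq_one_iff hN]
  refine forall_congr' fun p => ?_
  rw [Subgroup.coe_mul, Subgroup.coe_inv, mul_smul, inv_smul_eq_iff, eq_comm]

lemma isScalar_iff (hN : 2 ≤ N) (e : Stab l ≃* A5) (M : markGroup l) :
    IsScalar M.1 ↔ markHom e M = 1 := by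
  rw [markHom_eq_one_iff hN]
  exact ⟨fun h => h.smul, isScalar_of_smul⟩

lemma isScalar_pow_iff (hN : 2 ≤ N) (e : Stab l ≃* A5) (M : markGroup l) (n : ℕ) :
    IsScalar (M.1 ^ n) ↔ markHom e M ^ n = 1 := by
  rw [← map_pow, ← isScalar_iff hN, Subgroup.coe_pow]

lemma invariant_eq_of_isConj (hN : 2 ≤ N) (e : Stab l ≃* A5) {M M' : markGroup l} {g : A5}
    (h : g * markHom e M * g⁻¹ = markHom e M') : invariant M'.1 = invariant M.1 := by
  obtain ⟨P, rfl⟩ := markHom_surjective e g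
  rw [← map_inv, ← map_mul, ← map_mul, markHom_eq_iff hN] at h
  rw [← invariant_eq_of_smul_eq h, Subgroup.coe_mul, Subgroup.coe_mul, Subgroup.coe_inv,
    invariant_conj]

lemma invariant_of_markHom_eq_fiveCycle (hN : 2 ≤ N) (e : Stab l ≃* A5) {M : markGroup l}
    (h : markHom e M = fiveCycle) :
    invariant M.1 = (3 + rootFive) / 2 ∨ invariant M.1 = (3 - rootFive) / 2 := by
  apply invariant_of_fifth
  · rw [isScalar_pow_iff hN e, h, classRep_pow.2.2]
  · rw [isScalar_iff hN e, h]; exact classRep_pow_ne_one.2.2.1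

/-- An identification of the stabilizer with `A₅` under which the chosen five-cycle is a rotation
of angle `2π/5`. -/
def IsAdapted (e : Stab l ≃* A5) : Prop :=
  ∀ M : markGroup l, markHom e M = fiveCycle → invariant M.1 = (3 + rootFive) / 2

/-- If the five-cycle has the other value, compose with the outer automorphism. It moves the
five-cycle to the class of its square, and `x ↦ (x - 2)²` exchanges the two values `(3 ± √5) / 2`.
-/
lemma exists_isAdapted (hN : 2 ≤ N) (e : Stab l ≃* A5) : ∃ e' : Stab l ≃* A5, IsAdapted e' := by
  obtain ⟨M₀, hM₀⟩ := markHom_surjective e fiveCycle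
  rcases invariant_of_markHom_eq_fiveCycle hN e hM₀ with h | h
  · refine ⟨e, fun M hM => ?_⟩
    rw [← h]
    exact invariant_eq_of_smul_eq ((markHom_eq_iff hN e _ _).1 (hM.trans hM₀.symm))
  · refine ⟨e.trans outerAut.symm, fun M hM => ?_⟩
    have h1 : markHom e M = outerAut fiveCycle := by
      rw [← hM]
      exact (outerAut.apply_symm_apply _).symm
    obtain ⟨g, hg⟩ := outerAut_classRep 1
    have h2 : g * markHom e (M₀ ^ 2) * g⁻¹ = markHom e M := by
      rw [h1, map_pow, hM₀]
      exact hg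
    have h5 := sqrt_five_sq
    rw [invariant_eq_of_isConj hN e h2, Subgroup.coe_pow, invariant_sq, h]
    linear_combination h5 / 4

/-- The order of an element determines its invariant except for order five, where adaptedness gives
one class and squaring the other. -/
lemma invariant_eq_classInvariant (hN : 2 ≤ N) {e : Stab l ≃* A5} (he : IsAdapted e)
    (M : markGroup l) : invariant M.1 = classInvariant (classIndex (markHom e M)) := by
  obtain ⟨g, hg⟩ := exists_conj_classRep (markHom e M)
  generalize classIndex (markHom e M) = c at hg ⊢
  obtain ⟨P, hP⟩ := markHom_surjective e (classRep c)
  rw [← hP] at hg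
  rw [invariant_eq_of_isConj hN e hg]
  have hs : ∀ n, IsScalar (P.1 ^ n) ↔ classRep c ^ n = 1 := fun n => by
    rw [← hP, isScalar_pow_iff hN]
  have hs1 : IsScalar P.1 ↔ classRep c = 1 := by
    rw [← hP, isScalar_iff hN]
  obtain ⟨n1, n2, n3, n4⟩ := classRep_pow_ne_one
  obtain ⟨p1, p2, p3⟩ := classRep_pow
  fin_cases c
  · obtain ⟨c, hc⟩ := hs1.2 rfl
    have hc0 : c ≠ 0 := fun h0 => P.1.det_ne_zero (by rw [hc, h0]; simp)
    rw [invariant, hc]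
    simp [classInvariant]
    field_simp
    norm_num
  · exact he P hP
  · obtain ⟨M₁, hM₁⟩ := markHom_surjective e fiveCycle
    have h1 : markHom e P = markHom e (M₁ ^ 2) := by rw [hP, map_pow, hM₁]; rfl
    have h5 := sqrt_five_sq
    rw [invariant_eq_of_smul_eq ((markHom_eq_iff hN e _ _).1 h1), Subgroup.coe_pow, invariant_sq,
      he M₁ hM₁]
    change _ = (3 - rootFive) / 2
    linear_combination h5 / 4
  · have h1 := trace_sq_eq_det_of_cube ((hs 3).2 p2) (fun h => n2 (hs1.1 h))
    rw [invariant, h1, div_self P.1.det_ne_zero]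
    rfl
  · have h1 := trace_eq_zero_of_sq ((hs 2).2 p1) (fun h => n1 (hs1.1 h))
    rw [invariant, h1]
    simp [classInvariant]

/-- The five values `2 + 2 cos θ` are distinct, so the angle determines the class. -/
lemma classIndex_eq_of_isRotationOfAngle (hN : 2 ≤ N) {e : Stab l ≃* A5} (he : IsAdapted e)
    {g : Stab l} {c : Fin 5} (h : IsRotationOfAngle (classAngle c) g) : classIndex (e g) = c := by
  obtain ⟨M, rfl⟩ := toStab_surjective l g
  obtain ⟨k, hk⟩ := (isRotationOfAngle_toStab_iff hN M _).1 h
  have h1 := invariant_eq_of_smul_eq hk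
  rw [invariant_conj, invariant_rotation, cos_classAngle, invariant_eq_classInvariant hN he] at h1
  exact classInvariant_injective h1

lemma isRotationOfAngle_of_classIndex (hN : 2 ≤ N) {e : Stab l ≃* A5} (he : IsAdapted e)
    {M : markGroup l} {c : Fin 5} (h : classIndex (markHom e M) = c) :
    IsRotationOfAngle (classAngle c) (toStab l M) := by
  rw [isRotationOfAngle_toStab_iff hN]
  by_cases hc : c = 0
  · refine ⟨1, fun p => ?_⟩
    obtain ⟨g, hg⟩ := exists_conj_classRep (markHom e M)
    have h1 : markHom e M = 1 := by
      rw [← hg, h, hc]; simp [classRep]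
    rw [one_mul, inv_one, mul_one, (markHom_eq_one_iff hN e M).1 h1]
    refine (IsScalar.smul ⟨1, ?_⟩ p).symm
    ext i j
    fin_cases i <;> fin_cases j <;> simp [rotation, hc, classAngle]
  · have h1 : invariant (rotation (classAngle c)) = classInvariant c := by
      rw [invariant_rotation, cos_classAngle]
    refine exists_conj_rotation ?_ ?_
    · rw [h1, invariant_eq_classInvariant hN he, h]
    · rw [h1]
      exact fun h4 => hc (classInvariant_injective h4)

/-! ### The irreducible representations of the stabilizer -/

/-- The adjoint representation of the stabilizer on the traceless matrices. -/
def stabAdjoint (hN : 2 ≤ N) (e : Stab l ≃* A5) : Representation ℂ A5 (Fin 3 → ℂ) where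
  toFun g := adjoint (Function.surjInv (markHom_surjective e) g).1
  map_one' := by
    rw [← map_one adjoint]
    refine adjoint_eq_of_smul_eq fun p => ?_
    have := Function.surjInv_eq (markHom_surjective e) 1
    rw [markHom_eq_one_iff hN] at this
    rw [this, one_smul]
  map_mul' g g' := by
    rw [← map_mul]
    refine adjoint_eq_of_smul_eq ?_
    rw [← Subgroup.coe_mul, ← markHom_eq_iff hN e, map_mul]
    simp only [Function.surjInv_eq (markHom_surjective e)]

/-- Subtracting 1 from the class invariants gives `3, (1 ± √5)/2, 0, -1`, the fourth row of the
table. -/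
lemma hasCharacter_stabAdjoint (hN : 2 ≤ N) {e : Stab l ≃* A5} (he : IsAdapted e) :
    HasCharacter (stabAdjoint hN e) 3 := by
  intro c
  have h1 : (stabAdjoint hN e).character (classRep c) =
      adjoint.character (Function.surjInv (markHom_surjective e) (classRep c)).1 := rfl
  rw [h1, character_adjoint, invariant_eq_classInvariant hN he,
    Function.surjInv_eq (markHom_surjective e), classIndex_classRep]
  fin_cases c <;> simp [classInvariant, charTable] <;> ring

/-- Pulling back the irreducible representations of `A₅`. -/
lemma isIrreducibleList_comp (hN : 2 ≤ N) {e : Stab l ≃* A5} (he : IsAdapted e)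
    {X : ∀ i, Representation ℂ A5 (Fin (irrDegree i) → ℂ)} (hX : ∀ i, HasCharacter (X i) i) :
    IsIrreducibleList l (fun i => (X i).comp e.toMonoidHom) := by
  have : Finite (Stab l) := Finite.of_equiv _ e.symm.toEquiv
  have := Fintype.ofFinite (Stab l)
  have hchar : ∀ (i : Fin 5) (g : Stab l),
      Representation.character ((X i).comp e.toMonoidHom) g = (X i).character (e g) :=
    fun _ _ => rfl
  refine ⟨fun i => ?_, fun i c g hg => ?_⟩
  · apply Representation.isIrreducible_of_sum_char
    have irr := (hX i).isIrreducible
    have h1 := Representation.sum_char_mul_char_inv (X i) (X i)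
    rw [Representation.IsIrreducible.finrank_intertwiningMap_self, Nat.cast_one, mul_one] at h1
    rw [Nat.card_congr e.toEquiv, ← h1]
    refine Fintype.sum_equiv e.toEquiv _ _ fun g => ?_
    rw [hchar, hchar, map_inv]
    rfl
  · rw [hchar, character_eq_classRep, hX, classIndex_eq_of_isRotationOfAngle hN he hg]

/-- The character of the tangent representation, as a function on the conjugacy classes. -/
def tangentCharacter (e : Stab l ≃* A5) (c : Fin 5) : ℂ :=
  (tangentRep l).character (e.symm (classRep c))

/-- The multiplicity vectors are the solutions of a system of linear equations. -/
theorem isMultiplicityVector_iff (hN : 2 ≤ N) {e : Stab l ≃* A5} (he : IsAdapted e)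
    (p : Fin 5 → ℕ) : IsMultiplicityVector l p ↔
      ∀ c, ∑ i, (p i : ℂ) * (charTable i c : ℂ) = tangentCharacter e c := by
  have hfin : Finite (Stab l) := Finite.of_equiv _ e.symm.toEquiv
  have hsum : ∀ (X : ∀ i : Fin 5, Representation ℂ (Stab l) (Fin (irrDegree i) → ℂ)) (g : Stab l),
      (Representation.directSum fun j : (Σ i : Fin 5, Fin (p i)) => X j.1).character g =
        ∑ i, (p i : ℂ) * (X i).character g := fun X g => by
    rw [Representation.char_directSum, Fintype.sum_sigma]
    refine Finset.sum_congr rfl fun i _ => ?_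
    change ∑ _ : Fin (p i), (X i).character g = _
    rw [Finset.sum_const, Finset.card_univ, Fintype.card_fin, nsmul_eq_mul]
  -- An irreducible list prescribes characters only on rotations of the given angles, so every class
  -- representative must be shown to be one.
  have hrot : ∀ c, IsRotationOfAngle (classAngle c) (e.symm (classRep c)) := fun c => by
    obtain ⟨M, hM⟩ := toStab_surjective l (e.symm (classRep c))
    rw [← hM]
    apply isRotationOfAngle_of_classIndex hN he
    have : markHom e M = classRep c := by
      change e (toStab l M) = _
      rw [hM, e.apply_symm_apply]
    rw [this, classIndex_classRep]
  constructor
  · rintro ⟨X, hX, ⟨f⟩⟩ c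
    rw [tangentCharacter, Representation.char_iso f, hsum]
    exact Finset.sum_congr rfl fun i _ => by rw [hX.character i c _ (hrot c)]
  · intro h
    -- The adjoint representation of the stabilizer supplies the representation of degree three from
    -- which the others are built.
    obtain ⟨X, hX⟩ := exists_irreducibles _ (hasCharacter_stabAdjoint hN he)
    refine ⟨_, isIrreducibleList_comp hN he hX, ?_⟩
    refine Representation.nonempty_equiv_of_character_eq _ _ _ rfl (funext fun g => ?_)
    refine Eq.trans ?_ (hsum (fun i => (X i).comp e.toMonoidHom) g).symm
    obtain ⟨k, hk⟩ := exists_conj_classRep (e g)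
    have hg : g = e.symm k * e.symm (classRep (classIndex (e g))) * (e.symm k)⁻¹ := by
      rw [← map_inv, ← map_mul, ← map_mul, hk, e.symm_apply_apply]
    conv_lhs => rw [hg, Representation.char_conj]
    refine (h _).symm.trans (Finset.sum_congr rfl fun i _ => ?_)
    have h3 : Representation.character ((X i).comp e.toMonoidHom) g = (X i).character (e g) := rfl
    rw [h3, character_eq_classRep, hX]

end Marked

end ModuliZero
end

noncomputable section
namespace ModuliZero

/-! ### Stereographic projection and half turns -/

/-- The Hermitian traceless matrix of a vector. -/
def pauli (u : Fin 3 → ℝ) : Matrix (Fin 2) (Fin 2) ℂ :=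
  !![(u 2 : ℂ), u 0 + u 1 * Complex.I; u 0 - u 1 * Complex.I, -u 2]

lemma pauli_det (u : Fin 3 → ℝ) :
    (pauli u).det = -((u 0 ^ 2 + u 1 ^ 2 + u 2 ^ 2 : ℝ) : ℂ) := by
  rw [pauli, Matrix.det_fin_two_of]
  push_cast
  linear_combination (u 1 : ℂ) ^ 2 * Complex.I_sq

lemma pauli_det_of_mem {u : Fin 3 → ℝ} (hu : u ∈ S2) : (pauli u).det = -1 := by
  rw [pauli_det, show u 0 ^ 2 + u 1 ^ 2 + u 2 ^ 2 = 1 from hu]; simp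

/-- `pauli (v - w)` has determinant `-|v - w|²`, so it is singular only when `v = w`. -/
lemma eq_of_pauli_mulVec {v w : Fin 3 → ℝ} {x : Fin 2 → ℂ} (hx : x ≠ 0)
    (h : (pauli v).mulVec x = (pauli w).mulVec x) : v = w := by
  have h1 : (pauli (v - w)).mulVec x = 0 := by
    have : pauli (v - w) = pauli v - pauli w := by
      ext i j; fin_cases i <;> fin_cases j <;> simp [pauli] <;> ring
    rw [this, Matrix.sub_mulVec, h, sub_self]
  have h2 := Matrix.exists_mulVec_eq_zero_iff.1 ⟨x, hx, h1⟩
  rw [pauli_det, neg_eq_zero, Complex.ofReal_eq_zero] at h2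
  simp only [Pi.sub_apply] at h2
  ext i
  fin_cases i <;> simp only [Fin.zero_eta, Fin.mk_one, Fin.reduceFinMk] <;>
    nlinarith [sq_nonneg (v 0 - w 0), sq_nonneg (v 1 - w 1), sq_nonneg (v 2 - w 2)]

/-- Stereographic projection is the eigenline of `pauli v` for the eigenvalue `1`. This description
makes projection compatible with rotations. -/
lemma pauli_mulVec_hom_stereo {v : Fin 3 → ℝ} (hv : v ∈ S2) :
    (pauli v).mulVec (hom (stereo v)) = hom (stereo v) := by
  have hv' : v 0 ^ 2 + v 1 ^ 2 + v 2 ^ 2 = 1 := hv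
  rw [stereo]
  split_ifs with h
  · rw [h] at hv'
    have h0 : v 0 = 0 := by nlinarith [sq_nonneg (v 0), sq_nonneg (v 1)]
    have h1 : v 1 = 0 := by nlinarith [sq_nonneg (v 0), sq_nonneg (v 1)]
    ext i
    fin_cases i <;> simp [pauli, hom, h, h0, h1]
  · have h2 : (1 - v 2 : ℂ) ≠ 0 := by
      rw [sub_ne_zero]
      exact_mod_cast Ne.symm h
    have hc : (v 0 : ℂ) ^ 2 + v 1 ^ 2 + v 2 ^ 2 = 1 := by exact_mod_cast hv'
    ext i
    fin_cases i <;> simp [pauli, hom] <;> field_simp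
    · ring
    · linear_combination hc - (v 1 : ℂ) ^ 2 * Complex.I_sq

/-- The determinant of `pauli v` is `-1`, so its fixed vectors form a single line. -/
lemma stereo_eq_of_mulVec {v : Fin 3 → ℝ} (hv : v ∈ S2) {p : Sphere} {c : ℂ} (hc : c ≠ 0)
    (h : (pauli v).mulVec (c • hom p) = c • hom p) : stereo v = p := by
  have h1 : (pauli v).mulVec (hom p) = hom p := by
    rw [Matrix.mulVec_smul] at h
    exact smul_right_injective _ hc h
  have h2 := pauli_mulVec_hom_stereo hv
  have h3 : vdet (hom (stereo v)) (hom p) = 0 := by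
    have := vdet_smul_mulVec (pauli v) 1 1 (hom (stereo v)) (hom p)
    rw [one_smul, one_smul, h1, h2, pauli_det_of_mem hv] at this
    linear_combination this / 2
  exact (br_eq_zero_iff _ _).1 h3

lemma stereo_injOn : Set.InjOn stereo S2 := by
  intro v hv w hw h
  refine eq_of_pauli_mulVec (hom_ne_zero (stereo v)) ?_
  rw [pauli_mulVec_hom_stereo hv, h, pauli_mulVec_hom_stereo hw]

lemma exists_stereo_eq (p : Sphere) : ∃ v ∈ S2, stereo v = p := by
  induction p using OnePoint.rec with
  | infty => exact ⟨![0, 0, 1], by simp [S2], by simp [stereo]⟩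
  | coe z =>
    have h : 0 < z.re ^ 2 + z.im ^ 2 + 1 := by positivity
    refine ⟨![2 * z.re / (z.re ^ 2 + z.im ^ 2 + 1), 2 * z.im / (z.re ^ 2 + z.im ^ 2 + 1),
      1 - 2 / (z.re ^ 2 + z.im ^ 2 + 1)], ?_, ?_⟩
    · simp [S2]
      field_simp
      ring
    · have h0 : ((z.re ^ 2 + z.im ^ 2 + 1 : ℝ) : ℂ) ≠ 0 := by exact_mod_cast h.ne'
      rw [stereo, if_neg]
      · congr 1
        simp
        push_cast at h0
        field_simp
        simp
      · simp
        exact h.ne'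

/-- The half turn about the axis through a unit vector. -/
def halfTurn (u : Fin 3 → ℝ) : Matrix (Fin 3) (Fin 3) ℝ :=
  Matrix.of fun i j => 2 * u i * u j - if i = j then 1 else 0

/-- The linear fractional transformation `M` corresponds to the rotation `R` of the sphere. -/
def Lifts (M : GL (Fin 2) ℂ) (R : Matrix (Fin 3) (Fin 3) ℝ) : Prop :=
  ∀ v ∈ S2, R.mulVec v ∈ S2 ∧ stereo (R.mulVec v) = M • stereo v

lemma Lifts.one : Lifts 1 1 := fun v hv => by simpa using hv

lemma Lifts.mul {M M' : GL (Fin 2) ℂ} {R R' : Matrix (Fin 3) (Fin 3) ℝ} (h : Lifts M R)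
    (h' : Lifts M' R') : Lifts (M * M') (R * R') := fun v hv => by
  obtain ⟨h1, h2⟩ := h' v hv
  obtain ⟨h3, h4⟩ := h _ h1
  rw [← Matrix.mulVec_mulVec, mul_smul, ← h2]
  exact ⟨h3, h4⟩

/-- The matrix of the half turn about a unit vector. -/
def halfTurnGL (u : Fin 3 → ℝ) (hu : u ∈ S2) : GL (Fin 2) ℂ :=
  Matrix.GeneralLinearGroup.mkOfDetNeZero (pauli u) (by rw [pauli_det_of_mem hu]; simp)

lemma halfTurnGL_val (u : Fin 3 → ℝ) (hu : u ∈ S2) : (halfTurnGL u hu).val = pauli u := rfl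

lemma halfTurn_mulVec (u v : Fin 3 → ℝ) (i : Fin 3) :
    (halfTurn u).mulVec v i = 2 * (u 0 * v 0 + u 1 * v 1 + u 2 * v 2) * u i - v i := by
  fin_cases i <;> simp [halfTurn, Matrix.mulVec, dotProduct, Fin.sum_univ_three] <;> ring

/-- Conjugation by `pauli u` turns `pauli v` into the matrix of the rotated vector, hence moves one
eigenline to the other. -/
lemma lifts_halfTurn {u : Fin 3 → ℝ} (hu : u ∈ S2) : Lifts (halfTurnGL u hu) (halfTurn u) := by
  intro v hv
  have hu' : u 0 ^ 2 + u 1 ^ 2 + u 2 ^ 2 = 1 := hu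
  have hv' : v 0 ^ 2 + v 1 ^ 2 + v 2 ^ 2 = 1 := hv
  have hmem : (halfTurn u).mulVec v ∈ S2 := by
    change _ ^ 2 + _ ^ 2 + _ ^ 2 = 1
    rw [halfTurn_mulVec, halfTurn_mulVec, halfTurn_mulVec]
    linear_combination hv' + 4 * (u 0 * v 0 + u 1 * v 1 + u 2 * v 2) ^ 2 * hu'
  refine ⟨hmem, ?_⟩
  obtain ⟨c, hc, h⟩ := exists_mulVec_hom (halfTurnGL u hu) (stereo v)
  refine stereo_eq_of_mulVec hmem hc ?_
  have hcomm : pauli ((halfTurn u).mulVec v) * pauli u = pauli u * pauli v := by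
    have hu2 : (u 0 : ℂ) ^ 2 + u 1 ^ 2 + u 2 ^ 2 = 1 := by exact_mod_cast hu'
    have hI := Complex.I_sq
    ext i j
    fin_cases i <;> fin_cases j <;>
      simp [pauli, halfTurn_mulVec, Matrix.mul_apply, Fin.sum_univ_two] <;> grind
  rw [← h, halfTurnGL_val, Matrix.mulVec_mulVec, hcomm, ← Matrix.mulVec_mulVec,
    pauli_mulVec_hom_stereo hv]

lemma neg_mem_S2 {v : Fin 3 → ℝ} (hv : v ∈ S2) : -v ∈ S2 := by
  simpa [S2] using hv

lemma stereo_neg_ne {v : Fin 3 → ℝ} (hv : v ∈ S2) : stereo (-v) ≠ stereo v := by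
  intro h
  have h1 := stereo_injOn (neg_mem_S2 hv) hv h
  have h2 : v 0 ^ 2 + v 1 ^ 2 + v 2 ^ 2 = 1 := hv
  have h3 : ∀ i, v i = 0 := fun i => by
    have := congrFun h1 i
    simp at this
    linarith
  simp [h3] at h2

lemma trace_pauli (u : Fin 3 → ℝ) : (pauli u).trace = 0 := by
  simp [pauli, Matrix.trace_fin_two]

lemma trace_pauli_mul (u v : Fin 3 → ℝ) :
    (pauli u * pauli v).trace = 2 * ((u 0 * v 0 + u 1 * v 1 + u 2 * v 2 : ℝ) : ℂ) := by
  have hI := Complex.I_sq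
  simp [pauli, Matrix.trace_fin_two]
  grind

lemma trace_pauli_mul_mul (u v w : Fin 3 → ℝ) :
    (pauli u * (pauli v * pauli w)).trace =
      -2 * Complex.I * (((Matrix.of ![u, v, w]).det : ℝ) : ℂ) := by
  have hI := Complex.I_sq
  rw [Matrix.det_fin_three]
  simp [pauli, Matrix.trace_fin_two]
  grind

end ModuliZero
end

noncomputable section
namespace ModuliZero

/-! ### Exact coordinates for the dodecahedron -/

/-- Vectors with exact coordinates in `ℤ[√5]`. -/
abbrev Vec5 : Type := Fin 3 → ℤ√5

/-- Four times the matrix of the half turn about `(1, φ, φ²)`. -/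
def turnEntry : Fin 3 → Fin 3 → ℤ√5 :=
  ![![⟨-1, -1⟩, ⟨-1, 1⟩, 2], ![⟨-1, 1⟩, -2, ⟨1, 1⟩], ![2, ⟨1, 1⟩, ⟨-1, 1⟩]]

/-- Four times the image of a vector under the half turn. -/
def turnVecFour (z : Vec5) (i : Fin 3) : ℤ√5 :=
  turnEntry i 0 * z 0 + turnEntry i 1 * z 1 + turnEntry i 2 * z 2

/-- The image of a vector under the half turn. -/
def turnVec (z : Vec5) (i : Fin 3) : ℤ√5 :=
  -- Integer division; that nothing is lost is a clause of `IsExactOrbit`.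
  ⟨(turnVecFour z i).re / 4, (turnVecFour z i).im / 4⟩

/-- Cyclic permutation of exact coordinates. -/
def cycVec (k : Fin 3) (z : Vec5) : Vec5 := fun i => z (i + k)

/-- The signs in `ℤ[√5]`. -/
def signs : Finset (ℤ√5) := {1, -1}

/-- Pairs of signs. -/
def signs2 : Finset (ℤ√5 × ℤ√5) := signs ×ˢ signs

/-- Triples of signs. -/
def signs3 : Finset (ℤ√5 × ℤ√5 × ℤ√5) := signs ×ˢ signs ×ˢ signs

/-- The face centres in exact coordinates. -/
def faceVecs : Finset Vec5 :=
  Finset.univ.biUnion fun k => signs2.image fun s => cycVec k ![2 * s.1, 0, s.2 * ⟨1, 1⟩]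

/-- The vertices in exact coordinates. -/
def vertexVecs : Finset Vec5 :=
  signs3.image (fun s => ![2 * s.1, 2 * s.2.1, 2 * s.2.2]) ∪
  Finset.univ.biUnion fun k => signs2.image fun s => cycVec k ![0, s.1 * ⟨-1, 1⟩, s.2 * ⟨1, 1⟩]

/-- The edge midpoints in exact coordinates. -/
def edgeVecs : Finset Vec5 :=
  (Finset.univ.biUnion fun k => signs.image fun s => cycVec k ![0, 0, s * ⟨2, 2⟩]) ∪
  Finset.univ.biUnion fun k => signs3.image fun s =>
    cycVec k ![2 * s.1, s.2.1 * ⟨1, 1⟩, s.2.2 * ⟨3, 1⟩]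

/-- Add the images under the half turn and the cyclic permutation. -/
def exactStep (S : Finset Vec5) : Finset Vec5 := S ∪ S.image turnVec ∪ S.image (cycVec 1)

/-- A finite set of exact vectors is an orbit of the group generated by the half turn and the
cyclic permutation. -/
def IsExactOrbit (Z : Finset Vec5) (z₀ : Vec5) : Prop :=
  (∀ z ∈ Z, turnVec z ∈ Z ∧ cycVec 1 z ∈ Z ∧ (fun i => -z i) ∈ Z ∧
    ∀ i, 4 * turnVec z i = turnVecFour z i) ∧
  -- Eleven rounds suffice to fill each of the three orbits.
  exactStep^[11] {z₀} = Z

/-- A face centre. -/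
def faceVec : Vec5 := ![2, 0, ⟨1, 1⟩]
/-- A vertex. -/
def vertexVec : Vec5 := ![2, 2, 2]
/-- An edge midpoint. -/
def edgeVec : Vec5 := ![2, ⟨1, 1⟩, ⟨3, 1⟩]

lemma isExactOrbit_faceVecs : IsExactOrbit faceVecs faceVec := by
  unfold IsExactOrbit; decide +kernel
lemma isExactOrbit_vertexVecs : IsExactOrbit vertexVecs vertexVec := by
  unfold IsExactOrbit; decide +kernel
lemma isExactOrbit_edgeVecs : IsExactOrbit edgeVecs edgeVec := by
  unfold IsExactOrbit; decide +kernel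

lemma card_exact : faceVecs.card = 12 ∧ vertexVecs.card = 20 ∧ edgeVecs.card = 30 := by
  decide +kernel

/-- The axes of the two generators and of their product end in an edge midpoint, a vertex and a face
centre. -/
lemma exact_fixed : turnVec edgeVec = edgeVec ∧ cycVec 1 vertexVec = vertexVec ∧
    turnVec (cycVec 1 faceVec) = faceVec := by decide +kernel

/-- The coordinate sum measures the inner product with the vertex `(2, 2, 2)`. The value `2√5`
selects its three neighbours, which the cyclic permutation permutes. -/
lemma vertexVecs_neighbours : ∀ z ∈ vertexVecs, z 0 + z 1 + z 2 = ⟨0, 2⟩ →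
    ∃ k, cycVec k z = ![0, ⟨-1, 1⟩, ⟨1, 1⟩] := by decide +kernel

/-- Patterns of zero coordinates that tell the three exceptional orbits apart. -/
lemma two_le_support :
    (∀ z ∈ faceVecs, ∃ k, z k = 0) ∧ (∀ z ∈ faceVecs, z 0 ≠ 0 ∨ z 1 ≠ 0) ∧
    (∀ z ∈ vertexVecs, z 0 ≠ 0 ∨ z 1 ≠ 0) ∧ (∀ i, vertexVec i ≠ 0) ∧
    (![0, 0, ⟨2, 2⟩] : Vec5) ∈ edgeVecs := by decide +kernel

/-! ### The rotations generating the icosahedral group -/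

/-- The embedding of `ℤ[√5]` in the real numbers. -/
def toR : ℤ√5 →+* ℝ := Zsqrtd.toReal (by norm_num)

lemma toR_mk (a b : ℤ) : toR ⟨a, b⟩ = a + b * √5 := by
  simp [toR, Zsqrtd.toReal]

lemma toR_injective : Function.Injective toR :=
  Zsqrtd.toReal_injective _ fun n h => by
    have h1 : n ≤ 3 := by nlinarith
    have h2 : -3 ≤ n := by nlinarith
    interval_cases n <;> omega

/-- The real vector with the given exact coordinates, up to the factor `r`. -/
def toVec (r : ℝ) (z : Vec5) : Fin 3 → ℝ := fun i => r * toR (z i)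

lemma toVec_injective {r : ℝ} (hr : r ≠ 0) : Function.Injective (toVec r) := fun z w h => by
  funext i
  exact toR_injective (mul_left_cancel₀ hr (congrFun h i))

lemma sqrt_five_mul : √5 * √5 = (5 : ℝ) := Real.mul_self_sqrt (by norm_num)

lemma golden_eq : Real.goldenRatio = (1 + √5) / 2 := rfl

lemma golden_sq : Real.goldenRatio ^ 2 = (3 + √5) / 2 := by
  rw [golden_eq]; linear_combination sqrt_five_mul / 4

lemma golden_inv : Real.goldenRatio⁻¹ = (-1 + √5) / 2 := by
  rw [Real.inv_goldenRatio, Real.goldenConj]; ring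

lemma golden_ne : Real.goldenRatio ≠ 0 := Real.goldenRatio_ne_zero

/-- The axis of the half turn. -/
def turnAxis : Fin 3 → ℝ :=
  (2 * Real.goldenRatio)⁻¹ • ![1, Real.goldenRatio, Real.goldenRatio ^ 2]

/-- The first of two axes whose half turns compose to the cyclic permutation. -/
def cycAxis₁ : Fin 3 → ℝ :=
  (2 * Real.goldenRatio)⁻¹ • ![1, Real.goldenRatio, -Real.goldenRatio ^ 2]
/-- The second of two axes whose half turns compose to the cyclic permutation. -/
def cycAxis₂ : Fin 3 → ℝ :=
  (2 * Real.goldenRatio)⁻¹ • ![Real.goldenRatio, -Real.goldenRatio ^ 2, 1]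

lemma axis_eq : turnAxis = ![(-1 + √5) / 4, 1 / 2, (1 + √5) / 4] ∧
    cycAxis₁ = ![(-1 + √5) / 4, 1 / 2, -(1 + √5) / 4] ∧
    cycAxis₂ = ![1 / 2, -(1 + √5) / 4, (-1 + √5) / 4] := by
  have hi := golden_inv
  have h1 : (2 * Real.goldenRatio)⁻¹ = (-1 + √5) / 4 := by rw [mul_inv, hi]; ring
  have h5 := sqrt_five_mul
  refine ⟨?_, ?_, ?_⟩ <;> ext i <;> fin_cases i <;>
    simp only [turnAxis, cycAxis₁, cycAxis₂, Pi.smul_apply, smul_eq_mul, Fin.zero_eta,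
      Fin.mk_one, Fin.reduceFinMk, Matrix.cons_val, mul_neg, mul_one, h1] <;>
    rw [golden_eq] <;> grind

lemma turnAxis_mem : turnAxis ∈ S2 := by
  rw [axis_eq.1]
  change ((-1 + √5) / 4) ^ 2 + (1 / 2) ^ 2 + ((1 + √5) / 4) ^ 2 = 1
  linear_combination sqrt_five_mul / 8

lemma cycAxis₁_mem : cycAxis₁ ∈ S2 := by
  rw [axis_eq.2.1]
  change ((-1 + √5) / 4) ^ 2 + (1 / 2) ^ 2 + (-(1 + √5) / 4) ^ 2 = 1
  linear_combination sqrt_five_mul / 8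

lemma cycAxis₂_mem : cycAxis₂ ∈ S2 := by
  rw [axis_eq.2.2]
  change (1 / 2) ^ 2 + (-(1 + √5) / 4) ^ 2 + ((-1 + √5) / 4) ^ 2 = 1
  linear_combination sqrt_five_mul / 8

/-- The half turn about the edge midpoint `turnAxis`. -/
def turnRot : Matrix (Fin 3) (Fin 3) ℝ := halfTurn turnAxis

/-- The cyclic permutation of the coordinates. -/
def cycRot : Matrix (Fin 3) (Fin 3) ℝ := halfTurn cycAxis₁ * halfTurn cycAxis₂

/-- The linear fractional transformation of the half turn. -/
def turnGL : GL (Fin 2) ℂ := halfTurnGL turnAxis turnAxis_mem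
/-- The linear fractional transformation of the cyclic permutation. -/
def cycGL : GL (Fin 2) ℂ :=
  halfTurnGL cycAxis₁ cycAxis₁_mem * halfTurnGL cycAxis₂ cycAxis₂_mem

lemma lifts_turn : Lifts turnGL turnRot := lifts_halfTurn _
lemma lifts_cyc : Lifts cycGL cycRot := (lifts_halfTurn _).mul (lifts_halfTurn _)

lemma cycRot_eq : cycRot = !![0, 1, 0; 0, 0, 1; 1, 0, 0] := by
  have h5 := sqrt_five_mul
  rw [cycRot, axis_eq.2.1, axis_eq.2.2]
  ext i j
  fin_cases i <;> fin_cases j <;>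
    simp [halfTurn, Matrix.mul_apply, Fin.sum_univ_three] <;> grind

lemma turnRot_apply (i j : Fin 3) : turnRot i j = toR (turnEntry i j) / 4 := by
  have h5 := sqrt_five_mul
  have h2 : toR 2 = 2 := map_ofNat toR 2
  have h2' : toR (-2) = -2 := by rw [map_neg, h2]
  rw [turnRot, axis_eq.1]
  fin_cases i <;> fin_cases j <;> simp [halfTurn, turnEntry, toR_mk, h2, h2'] <;> grind

lemma cycRot_mulVec (v : Fin 3 → ℝ) : cycRot.mulVec v = cyc 1 v := by
  rw [cycRot_eq]
  ext i
  fin_cases i <;> simp [cyc, Matrix.mulVec, dotProduct, Fin.sum_univ_three]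

lemma cycRot_mulVec_toVec (r : ℝ) (z : Vec5) :
    cycRot.mulVec (toVec r z) = toVec r (cycVec 1 z) := by
  rw [cycRot_mulVec]; rfl

lemma turnRot_mulVec_toVec (r : ℝ) {z : Vec5} (h : ∀ i, 4 * turnVec z i = turnVecFour z i) :
    turnRot.mulVec (toVec r z) = toVec r (turnVec z) := by
  ext i
  have h1 := congrArg toR (h i)
  rw [map_mul, map_ofNat, turnVecFour, map_add, map_add, map_mul, map_mul, map_mul] at h1
  simp only [Matrix.mulVec, dotProduct, Fin.sum_univ_three, turnRot_apply, toVec]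
  linear_combination -r / 4 * h1

lemma invariant_turnGL : invariant turnGL = 0 := by
  rw [invariant, turnGL, halfTurnGL_val, trace_pauli]; simp

lemma invariant_cycGL : invariant cycGL = 1 := by
  have h5 := sqrt_five_mul
  rw [invariant, cycGL, Units.val_mul, halfTurnGL_val, halfTurnGL_val, trace_pauli_mul,
    Matrix.det_mul, pauli_det_of_mem cycAxis₁_mem, pauli_det_of_mem cycAxis₂_mem]
  have h : cycAxis₁ 0 * cycAxis₂ 0 + cycAxis₁ 1 * cycAxis₂ 1 + cycAxis₁ 2 * cycAxis₂ 2 =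
      -1 / 2 := by
    rw [axis_eq.2.1, axis_eq.2.2]
    simp
    grind
  rw [h]
  push_cast
  norm_num

/-- The trace of a product of three Pauli matrices is a triple product of the axes. The resulting
values `0`, `1`, `φ²` are those of `involution`, `threeCycle` and `fiveCycle` under an adapted
identification. -/
lemma invariant_turnGL_mul_cycGL : invariant (turnGL * cycGL) = ((1 + rootFive) / 2) ^ 2 := by
  have h5 := sqrt_five_mul
  have hI := Complex.I_sq
  rw [invariant, turnGL, cycGL, Units.val_mul, Units.val_mul, halfTurnGL_val, halfTurnGL_val,
    halfTurnGL_val, trace_pauli_mul_mul, Matrix.det_mul, Matrix.det_mul,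
    pauli_det_of_mem cycAxis₁_mem, pauli_det_of_mem cycAxis₂_mem, pauli_det_of_mem turnAxis_mem]
  have h : (Matrix.of ![turnAxis, cycAxis₁, cycAxis₂]).det ^ 2 = ((1 + √5) / 4) ^ 2 := by
    rw [Matrix.det_fin_three, axis_eq.1, axis_eq.2.1, axis_eq.2.2]
    simp
    grind
  rw [mul_pow, ← Complex.ofReal_pow, h]
  push_cast
  linear_combination -(1 + rootFive) ^ 2 / 4 * hI

end ModuliZero
end

noncomputable section
namespace ModuliZero

/-! ### The icosahedral group -/

/-- The monoid generated by the half turn and the cyclic permutation. -/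
def ico : Submonoid (Matrix (Fin 3) (Fin 3) ℝ) := Submonoid.closure {turnRot, cycRot}

lemma turnRot_mem : turnRot ∈ ico := Submonoid.subset_closure (by simp)
lemma cycRot_mem : cycRot ∈ ico := Submonoid.subset_closure (by simp)

lemma halfTurn_transpose (u : Fin 3 → ℝ) : (halfTurn u).transpose = halfTurn u := by
  ext i j
  simp only [halfTurn, Matrix.transpose_apply, Matrix.of_apply, eq_comm (a := j)]
  ring

lemma halfTurn_mul_self {u : Fin 3 → ℝ} (hu : u ∈ S2) : halfTurn u * halfTurn u = 1 := by
  have hu' : u 0 ^ 2 + u 1 ^ 2 + u 2 ^ 2 = 1 := hu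
  ext i j
  fin_cases i <;> fin_cases j <;>
    simp [halfTurn, Matrix.mul_apply, Fin.sum_univ_three] <;> grind

lemma halfTurn_det {u : Fin 3 → ℝ} (hu : u ∈ S2) : (halfTurn u).det = 1 := by
  have hu' : u 0 ^ 2 + u 1 ^ 2 + u 2 ^ 2 = 1 := hu
  rw [Matrix.det_fin_three]
  simp [halfTurn]
  linear_combination 2 * hu'

/-- Both generators have their inverse, which is the transpose, inside the monoid, so `ico` is in
fact a group of rotations. -/
lemma ico_orthogonal {h : Matrix (Fin 3) (Fin 3) ℝ} (hh : h ∈ ico) :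
    h.transpose ∈ ico ∧ h.transpose * h = 1 ∧ h.det = 1 := by
  induction hh using Submonoid.closure_induction with
  | mem x hx =>
    rcases hx with rfl | rfl
    · rw [turnRot, halfTurn_transpose]
      exact ⟨turnRot_mem, halfTurn_mul_self turnAxis_mem, halfTurn_det turnAxis_mem⟩
    · have h1 : cycRot.transpose = cycRot * cycRot := by
        rw [cycRot_eq]
        ext i j
        fin_cases i <;> fin_cases j <;> simp [Matrix.mul_apply, Fin.sum_univ_three]
      refine ⟨h1 ▸ mul_mem cycRot_mem cycRot_mem, ?_, ?_⟩
      · rw [cycRot_eq]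
        ext i j
        fin_cases i <;> fin_cases j <;> simp [Matrix.mul_apply, Fin.sum_univ_three]
      · rw [cycRot, Matrix.det_mul, halfTurn_det cycAxis₁_mem, halfTurn_det cycAxis₂_mem, one_mul]
  | one => simp
  | mul x y _ _ hx hy =>
    refine ⟨?_, ?_, ?_⟩
    · rw [Matrix.transpose_mul]; exact mul_mem hy.1 hx.1
    · rw [Matrix.transpose_mul, mul_assoc, ← mul_assoc _ x y, hx.2.1, one_mul, hy.2.1]
    · rw [Matrix.det_mul, hx.2.2, hy.2.2, one_mul]

lemma ico_transpose_mulVec {h : Matrix (Fin 3) (Fin 3) ℝ} (hh : h ∈ ico) (v : Fin 3 → ℝ) :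
    h.transpose.mulVec (h.mulVec v) = v := by
  rw [Matrix.mulVec_mulVec, (ico_orthogonal hh).2.1, Matrix.one_mulVec]

lemma ico_mulVec_transpose {h : Matrix (Fin 3) (Fin 3) ℝ} (hh : h ∈ ico) (v : Fin 3 → ℝ) :
    h.mulVec (h.transpose.mulVec v) = v := by
  rw [Matrix.mulVec_mulVec, mul_eq_one_comm.1 (ico_orthogonal hh).2.1, Matrix.one_mulVec]

lemma exists_lift {h : Matrix (Fin 3) (Fin 3) ℝ} (hh : h ∈ ico) : ∃ M, Lifts M h := by
  induction hh using Submonoid.closure_induction with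
  | mem x hx =>
    rcases hx with rfl | rfl
    · exact ⟨_, lifts_turn⟩
    · exact ⟨_, lifts_cyc⟩
  | one => exact ⟨1, Lifts.one⟩
  | mul x y _ _ hx hy =>
    obtain ⟨M, hM⟩ := hx
    obtain ⟨M', hM'⟩ := hy
    exact ⟨M * M', hM.mul hM'⟩

lemma ico_mulVec_mem_S2 {h : Matrix (Fin 3) (Fin 3) ℝ} (hh : h ∈ ico) {v : Fin 3 → ℝ}
    (hv : v ∈ S2) : h.mulVec v ∈ S2 := by
  obtain ⟨M, hM⟩ := exists_lift hh
  exact (hM v hv).1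

/-- Invariance of a set of vectors under the icosahedral group. -/
def IsIcoInvariant (S : Set (Fin 3 → ℝ)) : Prop := ∀ h ∈ ico, ∀ v ∈ S, h.mulVec v ∈ S

lemma isIcoInvariant_of_generators {S : Set (Fin 3 → ℝ)}
    (h₁ : ∀ v ∈ S, turnRot.mulVec v ∈ S) (h₂ : ∀ v ∈ S, cycRot.mulVec v ∈ S) :
    IsIcoInvariant S := by
  intro h hh
  induction hh using Submonoid.closure_induction with
  | mem x hx => rcases hx with rfl | rfl <;> assumption
  | one => intro v hv; rwa [Matrix.one_mulVec]
  | mul x y _ _ hx hy =>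
    intro v hv
    rw [← Matrix.mulVec_mulVec]
    exact hx _ (hy v hv)

lemma IsIcoInvariant.union {S T : Set (Fin 3 → ℝ)} (hS : IsIcoInvariant S)
    (hT : IsIcoInvariant T) : IsIcoInvariant (S ∪ T) := by
  rintro h hh v (hv | hv)
  · exact Or.inl (hS h hh v hv)
  · exact Or.inr (hT h hh v hv)

lemma IsIcoInvariant.diff {S T : Set (Fin 3 → ℝ)} (hS : IsIcoInvariant S)
    (hT : IsIcoInvariant T) : IsIcoInvariant (S \ T) := by
  rintro h hh v ⟨hv, hv'⟩
  refine ⟨hS h hh v hv, fun hm => hv' ?_⟩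
  rw [← ico_transpose_mulVec hh v]
  exact hT _ (ico_orthogonal hh).1 _ hm

lemma isIcoInvariant_S2 : IsIcoInvariant S2 := fun _ hh _ hv => ico_mulVec_mem_S2 hh hv

/-- A transitive invariant set of vectors, closed under negation. -/
structure IsIcoOrbit (S : Set (Fin 3 → ℝ)) (x : Fin 3 → ℝ) : Prop where
  mem : x ∈ S
  invariant : IsIcoInvariant S
  neg : ∀ v ∈ S, -v ∈ S
  transitive : ∀ v ∈ S, ∃ h ∈ ico, v = h.mulVec x

lemma IsIcoOrbit.subset {S T : Set (Fin 3 → ℝ)} {x : Fin 3 → ℝ} (hS : IsIcoOrbit S x)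
    (hT : IsIcoInvariant T) {v : Fin 3 → ℝ} (hv : v ∈ S) (hv' : v ∈ T) : S ⊆ T := by
  obtain ⟨h, hh, rfl⟩ := hS.transitive v hv
  have hx : x ∈ T := by
    rw [← ico_transpose_mulVec hh x]
    exact hT _ (ico_orthogonal hh).1 _ hv'
  intro w hw
  obtain ⟨g, hg, rfl⟩ := hS.transitive w hw
  exact hT g hg x hx

/-- An orbit meeting an invariant set lies inside it, so one point of `S` outside `T` is enough. -/
lemma IsIcoOrbit.disjoint {S T : Set (Fin 3 → ℝ)} {x y : Fin 3 → ℝ} (hS : IsIcoOrbit S x)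
    (hT : IsIcoOrbit T y) (hne : ¬ S ⊆ T) : Disjoint S T :=
  Set.disjoint_left.2 fun _ hv hv' => hne (hS.subset hT.invariant hv hv')

lemma IsIcoOrbit.subset_S2 {S : Set (Fin 3 → ℝ)} {x : Fin 3 → ℝ} (hS : IsIcoOrbit S x)
    (hx : x ∈ S2) : S ⊆ S2 := hS.subset isIcoInvariant_S2 hS.mem hx

/-- Each round of `exactStep` applies one more generator, which accounts for transitivity;
invariance and closure under negation are checked in exact coordinates. -/
lemma isIcoOrbit_toVec {Z : Finset Vec5} {z₀ : Vec5} (hZ : IsExactOrbit Z z₀) (r : ℝ) :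
    IsIcoOrbit (toVec r '' Z) (toVec r z₀) := by
  obtain ⟨h1, h2⟩ := hZ
  generalize 11 = m at h2
  have h0 : ∀ n, z₀ ∈ exactStep^[n] {z₀} := by
    intro n
    induction n with
    | zero => exact Finset.mem_singleton_self z₀
    | succ n ih =>
      rw [Function.iterate_succ_apply']
      exact Finset.mem_union_left _ (Finset.mem_union_left _ ih)
  have hz₀ : z₀ ∈ Z := h2 ▸ h0 m
  have key : ∀ n, ∀ z ∈ exactStep^[n] {z₀}, z ∈ Z ∧ ∃ h ∈ ico, toVec r z = h.mulVec (toVec r z₀) := by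
    intro n
    induction n with
    | zero =>
      intro z hz
      rw [Function.iterate_zero_apply, Finset.mem_singleton] at hz
      subst hz
      exact ⟨hz₀, 1, one_mem _, (Matrix.one_mulVec _).symm⟩
    | succ n ih =>
      intro z hz
      rw [Function.iterate_succ_apply'] at hz
      simp only [exactStep, Finset.mem_union, Finset.mem_image] at hz
      rcases hz with (hz | ⟨w, hw, rfl⟩) | ⟨w, hw, rfl⟩
      · exact ih z hz
      · obtain ⟨hwZ, h, hh, he⟩ := ih w hw
        refine ⟨(h1 w hwZ).1, turnRot * h, mul_mem turnRot_mem hh, ?_⟩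
        rw [← Matrix.mulVec_mulVec, ← he, turnRot_mulVec_toVec r (h1 w hwZ).2.2.2]
      · obtain ⟨hwZ, h, hh, he⟩ := ih w hw
        refine ⟨(h1 w hwZ).2.1, cycRot * h, mul_mem cycRot_mem hh, ?_⟩
        rw [← Matrix.mulVec_mulVec, ← he, cycRot_mulVec_toVec]
  refine ⟨⟨z₀, hz₀, rfl⟩, isIcoInvariant_of_generators ?_ ?_, ?_, ?_⟩
  · rintro _ ⟨z, hz, rfl⟩
    exact ⟨turnVec z, (h1 z hz).1, (turnRot_mulVec_toVec r (h1 z hz).2.2.2).symm⟩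
  · rintro _ ⟨z, hz, rfl⟩
    exact ⟨cycVec 1 z, (h1 z hz).2.1, (cycRot_mulVec_toVec r z).symm⟩
  · rintro _ ⟨z, hz, rfl⟩
    refine ⟨fun i => -z i, (h1 z hz).2.2.1, ?_⟩
    ext i
    simp [toVec]
  · rintro _ ⟨z, hz, rfl⟩
    have hz' : z ∈ exactStep^[m] {z₀} := h2 ▸ hz
    exact (key m z hz').2

/-! ### Vertices, faces and edges -/

lemma isSign_iff {s : ℝ} : IsSign s ↔ ∃ z ∈ signs, toR z = s := by
  simp [IsSign, signs, eq_comm]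

/-- A face centre. -/
def faceAxis : Fin 3 → ℝ := toVec (2 * √(1 + Real.goldenRatio ^ 2))⁻¹ faceVec

/-- A vertex. -/
def vertexAxis : Fin 3 → ℝ := toVec (2 * √3)⁻¹ vertexVec

/-- An edge midpoint. -/
def edgeAxis : Fin 3 → ℝ := toVec (4 * Real.goldenRatio)⁻¹ edgeVec

lemma toVec_cycVec (r : ℝ) (k : Fin 3) (z : Vec5) : toVec r (cycVec k z) = cyc k (toVec r z) := rfl

lemma toR_two : toR 2 = 2 := map_ofNat toR 2

lemma toVec_face (r : ℝ) (s t : ℤ√5) : toVec (2 * r)⁻¹ ![2 * s, 0, t * ⟨1, 1⟩] =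
    r⁻¹ • ![toR s, 0, toR t * Real.goldenRatio] := by
  ext i
  fin_cases i <;> simp [toVec, toR_mk, toR_two, golden_eq] <;> ring

lemma toVec_vertex (r : ℝ) (s t : ℤ√5) :
    toVec (2 * r)⁻¹ ![0, s * ⟨-1, 1⟩, t * ⟨1, 1⟩] =
    r⁻¹ • ![0, toR s * Real.goldenRatio⁻¹, toR t * Real.goldenRatio] := by
  rw [golden_inv, golden_eq]
  ext i
  fin_cases i <;> simp [toVec, toR_mk] <;> ring

lemma toVec_vertex' (r : ℝ) (s t u : ℤ√5) :
    toVec (2 * r)⁻¹ ![2 * s, 2 * t, 2 * u] = r⁻¹ • ![toR s, toR t, toR u] := by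
  ext i
  fin_cases i <;> simp [toVec, toR_two] <;> ring

lemma toVec_edge (r s t : ℤ√5) :
    toVec (4 * Real.goldenRatio)⁻¹ ![2 * r, s * ⟨1, 1⟩, t * ⟨3, 1⟩] =
    (2 * Real.goldenRatio)⁻¹ • ![toR r, toR s * Real.goldenRatio,
      toR t * Real.goldenRatio ^ 2] := by
  rw [golden_sq, mul_inv, mul_inv, golden_eq]
  ext i
  fin_cases i <;> simp [toVec, toR_mk, toR_two] <;> ring

lemma toVec_edge' (s : ℤ√5) :
    toVec (4 * Real.goldenRatio)⁻¹ ![0, 0, s * ⟨2, 2⟩] = ![0, 0, toR s] := by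
  have h := sqrt_five_mul
  rw [mul_inv, golden_inv]
  ext i
  fin_cases i <;> simp [toVec, toR_mk]
  grind

lemma dodecFaces_eq :
    dodecFaces = toVec (2 * √(1 + Real.goldenRatio ^ 2))⁻¹ '' faceVecs := by
  ext v
  simp only [dodecFaces, isSign_iff, faceVecs, signs2, Set.mem_ofPred_eq, Set.mem_image,
    Finset.mem_coe, Finset.mem_biUnion, Finset.mem_image, Finset.mem_product, Finset.mem_univ,
    true_and]
  constructor
  · rintro ⟨k, _, _, ⟨s, hs, rfl⟩, ⟨t, ht, rfl⟩, rfl⟩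
    exact ⟨_, ⟨k, (s, t), ⟨hs, ht⟩, rfl⟩, by rw [toVec_cycVec, toVec_face]⟩
  · rintro ⟨_, ⟨k, ⟨s, t⟩, ⟨hs, ht⟩, rfl⟩, rfl⟩
    exact ⟨k, _, _, ⟨s, hs, rfl⟩, ⟨t, ht, rfl⟩, by rw [toVec_cycVec, toVec_face]⟩

lemma dodecVertices_eq : dodecVertices = toVec (2 * √3)⁻¹ '' vertexVecs := by
  ext v
  simp only [dodecVertices, isSign_iff, vertexVecs, signs2, signs3, Set.mem_ofPred_eq,
    Set.mem_image, Finset.mem_coe, Finset.mem_union, Finset.mem_biUnion, Finset.mem_image,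
    Finset.mem_product, Finset.mem_univ, true_and]
  constructor
  · rintro (⟨_, _, _, ⟨r, hr, rfl⟩, ⟨s, hs, rfl⟩, ⟨t, ht, rfl⟩, rfl⟩ |
      ⟨k, _, _, ⟨s, hs, rfl⟩, ⟨t, ht, rfl⟩, rfl⟩)
    · exact ⟨_, Or.inl ⟨(r, s, t), ⟨hr, hs, ht⟩, rfl⟩, by rw [toVec_vertex']⟩
    · exact ⟨_, Or.inr ⟨k, (s, t), ⟨hs, ht⟩, rfl⟩, by rw [toVec_cycVec, toVec_vertex]⟩
  · rintro ⟨_, ⟨⟨r, s, t⟩, ⟨hr, hs, ht⟩, rfl⟩ | ⟨k, ⟨s, t⟩, ⟨hs, ht⟩, rfl⟩, rfl⟩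
    · exact Or.inl ⟨_, _, _, ⟨r, hr, rfl⟩, ⟨s, hs, rfl⟩, ⟨t, ht, rfl⟩, by rw [toVec_vertex']⟩
    · exact Or.inr ⟨k, _, _, ⟨s, hs, rfl⟩, ⟨t, ht, rfl⟩, by rw [toVec_cycVec, toVec_vertex]⟩

lemma dodecEdges_eq : dodecEdges = toVec (4 * Real.goldenRatio)⁻¹ '' edgeVecs := by
  ext v
  simp only [dodecEdges, isSign_iff, edgeVecs, signs3, Set.mem_ofPred_eq,
    Set.mem_image, Finset.mem_coe, Finset.mem_union, Finset.mem_biUnion, Finset.mem_image,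
    Finset.mem_product, Finset.mem_univ, true_and]
  constructor
  · rintro (⟨k, _, ⟨s, hs, rfl⟩, rfl⟩ |
      ⟨k, _, _, _, ⟨r, hr, rfl⟩, ⟨s, hs, rfl⟩, ⟨t, ht, rfl⟩, rfl⟩)
    · exact ⟨_, Or.inl ⟨k, s, hs, rfl⟩, by rw [toVec_cycVec, toVec_edge']⟩
    · exact ⟨_, Or.inr ⟨k, (r, s, t), ⟨hr, hs, ht⟩, rfl⟩, by rw [toVec_cycVec, toVec_edge]⟩
  · rintro ⟨_, ⟨k, s, hs, rfl⟩ | ⟨k, ⟨r, s, t⟩, ⟨hr, hs, ht⟩, rfl⟩, rfl⟩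
    · exact Or.inl ⟨k, _, ⟨s, hs, rfl⟩, by rw [toVec_cycVec, toVec_edge']⟩
    · exact Or.inr ⟨k, _, _, _, ⟨r, hr, rfl⟩, ⟨s, hs, rfl⟩, ⟨t, ht, rfl⟩,
        by rw [toVec_cycVec, toVec_edge]⟩

lemma face_scale_ne : (2 * √(1 + Real.goldenRatio ^ 2))⁻¹ ≠ 0 := by positivity
lemma vertex_scale_ne : (2 * √3)⁻¹ ≠ 0 := by positivity
lemma edge_scale_ne : (4 * Real.goldenRatio)⁻¹ ≠ 0 :=
  inv_ne_zero (mul_ne_zero (by norm_num) golden_ne)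

lemma isIcoOrbit_faces : IsIcoOrbit dodecFaces faceAxis := by
  rw [dodecFaces_eq]; exact isIcoOrbit_toVec isExactOrbit_faceVecs _
lemma isIcoOrbit_vertices : IsIcoOrbit dodecVertices vertexAxis := by
  rw [dodecVertices_eq]; exact isIcoOrbit_toVec isExactOrbit_vertexVecs _
lemma isIcoOrbit_edges : IsIcoOrbit dodecEdges edgeAxis := by
  rw [dodecEdges_eq]; exact isIcoOrbit_toVec isExactOrbit_edgeVecs _

lemma ncard_faces : dodecFaces.ncard = 12 := by
  rw [dodecFaces_eq, Set.ncard_image_of_injective _ (toVec_injective face_scale_ne),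
    Set.ncard_coe_finset, card_exact.1]
lemma ncard_vertices : dodecVertices.ncard = 20 := by
  rw [dodecVertices_eq, Set.ncard_image_of_injective _ (toVec_injective vertex_scale_ne),
    Set.ncard_coe_finset, card_exact.2.1]
lemma ncard_edges : dodecEdges.ncard = 30 := by
  rw [dodecEdges_eq, Set.ncard_image_of_injective _ (toVec_injective edge_scale_ne),
    Set.ncard_coe_finset, card_exact.2.2]

lemma faceAxis_mem : faceAxis ∈ S2 := by
  have h1 : √(1 + Real.goldenRatio ^ 2) ^ 2 = 1 + Real.goldenRatio ^ 2 :=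
    Real.sq_sqrt (by positivity)
  have h2 : (1 + Real.goldenRatio ^ 2) ≠ 0 := by positivity
  have h3 : faceAxis = (√(1 + Real.goldenRatio ^ 2))⁻¹ • ![1, 0, Real.goldenRatio] := by
    have := toVec_face (√(1 + Real.goldenRatio ^ 2)) 1 1
    rwa [mul_one, one_mul, map_one, one_mul] at this
  rw [h3]
  change ((√(1 + Real.goldenRatio ^ 2))⁻¹ * 1) ^ 2 + ((√(1 + Real.goldenRatio ^ 2))⁻¹ * 0) ^ 2 +
    ((√(1 + Real.goldenRatio ^ 2))⁻¹ * Real.goldenRatio) ^ 2 = 1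
  rw [mul_pow, mul_pow, mul_pow, inv_pow, h1]
  field_simp
  ring

lemma vertexAxis_mem : vertexAxis ∈ S2 := by
  have h1 : √3 ^ 2 = (3 : ℝ) := Real.sq_sqrt (by norm_num)
  have h3 : vertexAxis = (√3)⁻¹ • ![1, 1, 1] := by
    have := toVec_vertex' √3 1 1 1
    rwa [mul_one, map_one] at this
  rw [h3]
  simp [S2]
  norm_num

lemma edgeAxis_eq : edgeAxis = turnAxis := by
  have := toVec_edge 1 1 1
  rwa [mul_one, one_mul, one_mul, map_one, one_mul, one_mul] at this

lemma edgeAxis_mem : edgeAxis ∈ S2 := edgeAxis_eq ▸ turnAxis_mem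

lemma toR_eq_zero {z : ℤ√5} : toR z = 0 ↔ z = 0 := map_eq_zero_iff toR toR_injective

lemma disjoint_faces_vertices : Disjoint dodecFaces dodecVertices := by
  refine (isIcoOrbit_vertices.disjoint isIcoOrbit_faces fun h => ?_).symm
  have h1 := h isIcoOrbit_vertices.mem
  rw [dodecFaces_eq] at h1
  obtain ⟨z, hz, he⟩ := h1
  obtain ⟨k, hk⟩ := two_le_support.1 z hz
  have h2 := congrFun he k
  rw [toVec, hk, map_zero, mul_zero, vertexAxis, toVec, eq_comm, mul_eq_zero] at h2
  exact two_le_support.2.2.2.1 k (toR_eq_zero.1 (h2.resolve_left vertex_scale_ne))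

lemma not_edges_subset {Z : Finset Vec5} {r : ℝ} (hr : r ≠ 0)
    (hZ : ∀ z ∈ Z, z 0 ≠ 0 ∨ z 1 ≠ 0) : ¬ dodecEdges ⊆ toVec r '' Z := by
  intro h
  rw [dodecEdges_eq] at h
  obtain ⟨z, hz, he⟩ := h ⟨_, two_le_support.2.2.2.2, rfl⟩
  have h0 := congrFun he 0
  have h1 := congrFun he 1
  simp only [toVec, Matrix.cons_val, map_zero, mul_zero, mul_eq_zero, hr, toR_eq_zero,
    false_or] at h0 h1
  exact (hZ z hz).elim (fun h => h h0) fun h => h h1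

lemma disjoint_edges_faces : Disjoint dodecEdges dodecFaces :=
  isIcoOrbit_edges.disjoint isIcoOrbit_faces
    (dodecFaces_eq ▸ not_edges_subset face_scale_ne two_le_support.2.1)

lemma disjoint_vertices_edges : Disjoint dodecVertices dodecEdges :=
  (isIcoOrbit_edges.disjoint isIcoOrbit_vertices
    (dodecVertices_eq ▸ not_edges_subset vertex_scale_ne two_le_support.2.2.1)).symm

lemma turnRot_edgeAxis : turnRot.mulVec edgeAxis = edgeAxis := by
  have h : edgeVec ∈ edgeVecs := by decide +kernel
  rw [edgeAxis, turnRot_mulVec_toVec _ (isExactOrbit_edgeVecs.1 _ h).2.2.2, exact_fixed.1]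

lemma cycRot_vertexAxis : cycRot.mulVec vertexAxis = vertexAxis := by
  rw [vertexAxis, cycRot_mulVec_toVec, exact_fixed.2.1]

lemma turnRot_mul_cycRot_faceAxis : (turnRot * cycRot).mulVec faceAxis = faceAxis := by
  have h : cycVec 1 faceVec ∈ faceVecs := by decide +kernel
  rw [faceAxis, ← Matrix.mulVec_mulVec, cycRot_mulVec_toVec,
    turnRot_mulVec_toVec _ (isExactOrbit_faceVecs.1 _ h).2.2.2, exact_fixed.2.2]

/-! ### The rotations of the dodecahedron -/

open Matrix in
-- For every matrix `B` the cofactor matrix takes `u ⨯₃ v` to `B u ⨯₃ B v`, and a rotation is its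
-- own cofactor matrix.
lemma mulVec_cross {A : Matrix (Fin 3) (Fin 3) ℝ}
    (hA : A ∈ Matrix.specialOrthogonalGroup (Fin 3) ℝ) (u v : Fin 3 → ℝ) :
    A.mulVec (u ⨯₃ v) = A.mulVec u ⨯₃ A.mulVec v := by
  obtain ⟨h1, h2⟩ := Matrix.mem_specialOrthogonalGroup_iff.1 hA
  have h3 : A * A.transpose = 1 := (Matrix.mem_orthogonalGroup_iff (Fin 3) ℝ).1 h1
  have h4 : A.transpose = A.adjugate := by
    have h5 : A * A.adjugate = 1 := by rw [Matrix.mul_adjugate, h2, one_smul]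
    calc A.transpose = A.transpose * (A * A.adjugate) := by rw [h5, mul_one]
      _ = A.adjugate := by rw [← mul_assoc, mul_eq_one_comm.1 h3, one_mul]
  have h6 : A = A.adjugate.transpose := by rw [← h4, Matrix.transpose_transpose]
  have h7 : ∀ B : Matrix (Fin 3) (Fin 3) ℝ,
      B.adjugate.transpose.mulVec (u ⨯₃ v) = B.mulVec u ⨯₃ B.mulVec v := by
    intro B
    rw [Matrix.adjugate_fin_three]
    ext i
    fin_cases i <;>
      simp [cross_apply, Matrix.mulVec, dotProduct, Fin.sum_univ_three] <;> ring
  nth_rewrite 1 [h6]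
  exact h7 A

open Matrix in
-- The vectors `u`, `v`, `u ⨯₃ v` form a basis, with determinant `|u ⨯₃ v|²`, and all three are
-- fixed.
lemma eq_one_of_fixes {A : Matrix (Fin 3) (Fin 3) ℝ}
    (hA : A ∈ Matrix.specialOrthogonalGroup (Fin 3) ℝ) {u v : Fin 3 → ℝ}
    (hu : A.mulVec u = u) (hv : A.mulVec v = v) (huv : u ⨯₃ v ≠ 0) : A = 1 := by
  have hw : A.mulVec (u ⨯₃ v) = u ⨯₃ v := by rw [mulVec_cross hA, hu, hv]
  set w := u ⨯₃ v with hw'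
  set P : Matrix (Fin 3) (Fin 3) ℝ := Matrix.of ![u, v, w] with hP
  have hdet : P.det = w 0 ^ 2 + w 1 ^ 2 + w 2 ^ 2 := by
    rw [Matrix.det_fin_three]
    simp [hP, hw', cross_apply]
    ring
  have hdet0 : P.det ≠ 0 := by
    rw [hdet]
    intro h
    apply huv
    ext i
    have : w i ^ 2 = 0 := by
      fin_cases i <;> simp only [Fin.zero_eta, Fin.mk_one, Fin.reduceFinMk] <;>
        nlinarith [sq_nonneg (w 0), sq_nonneg (w 1), sq_nonneg (w 2)]
    simpa using this
  have hAP : A * P.transpose = P.transpose := by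
    ext i j
    have : ∀ j, A.mulVec (P j) = P j := by
      intro j
      fin_cases j
      exacts [hu, hv, hw]
    have := congrFun (this j) i
    simpa [Matrix.mul_apply, Matrix.mulVec, dotProduct] using this
  have hU : IsUnit P.transpose := by
    rw [Matrix.isUnit_iff_isUnit_det, Matrix.det_transpose]
    exact hdet0.isUnit
  exact hU.mul_right_cancel (by rw [hAP, one_mul])

lemma dotProduct_mulVec_mulVec {A : Matrix (Fin 3) (Fin 3) ℝ}
    (hA : A ∈ Matrix.specialOrthogonalGroup (Fin 3) ℝ) (u v : Fin 3 → ℝ) :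
    dotProduct (A.mulVec u) (A.mulVec v) = dotProduct u v := by
  have h1 := (Matrix.mem_specialOrthogonalGroup_iff.1 hA).1
  have h2 : A.transpose * A = 1 := (Matrix.mem_orthogonalGroup_iff' (Fin 3) ℝ).1 h1
  rw [Matrix.dotProduct_mulVec, ← Matrix.mulVec_transpose, Matrix.mulVec_mulVec, h2,
    Matrix.one_mulVec]

lemma ico_mem_special {h : Matrix (Fin 3) (Fin 3) ℝ} (hh : h ∈ ico) :
    h ∈ Matrix.specialOrthogonalGroup (Fin 3) ℝ :=
  Matrix.mem_specialOrthogonalGroup_iff.2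
    ⟨(Matrix.mem_orthogonalGroup_iff' (Fin 3) ℝ).2 (ico_orthogonal hh).2.1, (ico_orthogonal hh).2.2⟩

lemma cycRot_pow_mulVec_toVec (r : ℝ) (k : Fin 3) (z : Vec5) :
    (cycRot ^ k.val).mulVec (toVec r z) = toVec r (cycVec k z) := by
  fin_cases k
  · simp only [Fin.zero_eta, pow_zero, Matrix.one_mulVec]
    congr 1
    ext i : 1
    simp [cycVec]
  · simp only [Fin.mk_one, pow_one, cycRot_mulVec_toVec]
  · simp only [Fin.reduceFinMk, pow_two, ← Matrix.mulVec_mulVec, cycRot_mulVec_toVec]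
    congr 1
    ext i : 1
    simp only [cycVec, add_assoc]
    rfl

/-- After composition with an element of `ico`, a symmetry fixes `vertexAxis` and permutes its three
neighbours; a power of the cyclic permutation then makes it fix a neighbour too, and a rotation
fixing two independent vectors is trivial. -/
lemma icosahedralRotations_eq : icosahedralRotations = ico := by
  ext A
  constructor
  · rintro ⟨hA, hV⟩
    have hA1 : A.mulVec vertexAxis ∈ dodecVertices := hV ▸ ⟨_, isIcoOrbit_vertices.mem, rfl⟩
    obtain ⟨h, hh, he⟩ := isIcoOrbit_vertices.transitive _ hA1
    set B := h.transpose * A with hB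
    have hht := (ico_orthogonal hh).1
    have hBS : B ∈ Matrix.specialOrthogonalGroup (Fin 3) ℝ := mul_mem (ico_mem_special hht) hA
    have hB0 : B.mulVec vertexAxis = vertexAxis := by
      rw [hB, ← Matrix.mulVec_mulVec, he, ico_transpose_mulVec hh]
    set y : Vec5 := ![0, ⟨-1, 1⟩, ⟨1, 1⟩] with hy
    have hyV : y ∈ vertexVecs := by decide +kernel
    have hBy : B.mulVec (toVec (2 * √3)⁻¹ y) ∈ dodecVertices := by
      rw [hB, ← Matrix.mulVec_mulVec]
      refine isIcoOrbit_vertices.invariant _ hht _ ?_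
      rw [← hV]
      exact ⟨_, dodecVertices_eq ▸ ⟨_, hyV, rfl⟩, rfl⟩
    rw [dodecVertices_eq] at hBy
    obtain ⟨z, hz, hze⟩ := hBy
    -- Preservation of inner products with `vertexAxis` shows that the image of the neighbour `y` is
    -- again a neighbour.
    have hdot := dotProduct_mulVec_mulVec hBS (toVec (2 * √3)⁻¹ y) vertexAxis
    rw [hB0, ← hze] at hdot
    have hs : (2 * √3)⁻¹ ≠ (0 : ℝ) := vertex_scale_ne
    have hsum : z 0 + z 1 + z 2 = ⟨0, 2⟩ := by
      apply toR_injective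
      rw [map_add, map_add]
      apply mul_left_cancel₀ (mul_ne_zero hs hs)
      simp only [dotProduct, Fin.sum_univ_three, vertexAxis, vertexVec, toVec, hy,
        Matrix.cons_val, toR_two, toR_mk, map_zero] at hdot ⊢
      push_cast at hdot ⊢
      linear_combination hdot / 2
    obtain ⟨k, hk⟩ := vertexVecs_neighbours z hz hsum
    have hck := pow_mem cycRot_mem k.val
    have hone : cycRot ^ k.val * B = 1 := by
      refine eq_one_of_fixes (mul_mem (ico_mem_special hck) hBS) (u := vertexAxis)
        (v := toVec (2 * √3)⁻¹ y) ?_ ?_ fun h0 => ?_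
      · rw [← Matrix.mulVec_mulVec, hB0, vertexAxis, cycRot_pow_mulVec_toVec]
        congr 1
        ext i : 1
        simp only [cycVec, vertexVec]
        generalize i + k = j
        fin_cases i <;> fin_cases j <;> rfl
      · rw [← Matrix.mulVec_mulVec, ← hze, cycRot_pow_mulVec_toVec, hk]
      · have := congrFun h0 0
        simp only [cross_apply, vertexAxis, vertexVec, toVec, hy, Matrix.cons_val, toR_two,
          toR_mk, Pi.zero_apply] at this
        have h2 : (2 * √3)⁻¹ * (2 * √3)⁻¹ * 4 = (0 : ℝ) := by
          push_cast at this
          linear_combination this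
        exact mul_ne_zero (mul_ne_zero hs hs) (by norm_num) h2
    have hAe : A = h * (cycRot ^ k.val).transpose := by
      calc A = h * B := by
            rw [hB, ← mul_assoc, mul_eq_one_comm.1 (ico_orthogonal hh).2.1, one_mul]
        _ = h * ((cycRot ^ k.val).transpose * (cycRot ^ k.val * B)) := by
            rw [← mul_assoc _ _ B, (ico_orthogonal hck).2.1, one_mul]
        _ = _ := by rw [hone, mul_one]
    rw [hAe]
    exact mul_mem hh (ico_orthogonal hck).1
  · intro hA
    refine ⟨ico_mem_special hA, Set.Subset.antisymm ?_ fun v hv => ?_⟩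
    · rintro _ ⟨v, hv, rfl⟩
      exact isIcoOrbit_vertices.invariant A hA v hv
    · exact ⟨_, isIcoOrbit_vertices.invariant _ (ico_orthogonal hA).1 v hv,
        ico_mulVec_transpose hA v⟩

lemma mem_orbit_iff {a v : Fin 3 → ℝ} : v ∈ orbit a ↔ ∃ h ∈ ico, v = h.mulVec a := by
  rw [orbit, icosahedralRotations_eq]; rfl

lemma self_mem_orbit (a : Fin 3 → ℝ) : a ∈ orbit a :=
  mem_orbit_iff.2 ⟨1, one_mem _, (Matrix.one_mulVec a).symm⟩

lemma isIcoInvariant_orbit (a : Fin 3 → ℝ) : IsIcoInvariant (orbit a) := by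
  intro h hh v hv
  obtain ⟨g, hg, rfl⟩ := mem_orbit_iff.1 hv
  exact mem_orbit_iff.2 ⟨h * g, mul_mem hh hg, Matrix.mulVec_mulVec _ _ _⟩

lemma orbit_eq_of_mem {a v : Fin 3 → ℝ} (hv : v ∈ orbit a) : orbit v = orbit a := by
  obtain ⟨g, hg, rfl⟩ := mem_orbit_iff.1 hv
  ext w
  constructor
  · intro hw
    obtain ⟨h, hh, rfl⟩ := mem_orbit_iff.1 hw
    exact isIcoInvariant_orbit a h hh _ hv
  · intro hw
    obtain ⟨h, hh, rfl⟩ := mem_orbit_iff.1 hw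
    refine mem_orbit_iff.2 ⟨h * g.transpose, mul_mem hh (ico_orthogonal hg).1, ?_⟩
    rw [← Matrix.mulVec_mulVec, ico_transpose_mulVec hg]

lemma orbit_subset {a : Fin 3 → ℝ} {S : Set (Fin 3 → ℝ)} (hS : IsIcoInvariant S) (ha : a ∈ S) :
    orbit a ⊆ S := by
  intro v hv
  obtain ⟨h, hh, rfl⟩ := mem_orbit_iff.1 hv
  exact hS h hh a ha

lemma isIcoInvariant_genericPoints : IsIcoInvariant genericPoints :=
  isIcoInvariant_S2.diff ((isIcoOrbit_vertices.invariant.union isIcoOrbit_faces.invariant).union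
    isIcoOrbit_edges.invariant)

end ModuliZero
end

noncomputable section
namespace ModuliZero

/-! ### Symmetric configurations on the sphere -/

/-- The rotations of the five classes. -/
def classRotation : Fin 5 → Matrix (Fin 3) (Fin 3) ℝ :=
  ![1, turnRot * cycRot, (turnRot * cycRot) ^ 2, cycRot, turnRot]

/-- The linear fractional transformations of the rotations of the five classes. -/
def classLift : Fin 5 → GL (Fin 2) ℂ :=
  ![1, turnGL * cycGL, (turnGL * cycGL) ^ 2, cycGL, turnGL]

/-- Points fixed by the rotations of the five classes. -/
def classAxis : Fin 5 → Fin 3 → ℝ := ![faceAxis, faceAxis, faceAxis, vertexAxis, edgeAxis]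

lemma classRotation_mem (c : Fin 5) : classRotation c ∈ ico := by
  have h := mul_mem turnRot_mem cycRot_mem
  fin_cases c
  exacts [one_mem _, h, pow_mem h 2, cycRot_mem, turnRot_mem]

lemma lifts_classLift (c : Fin 5) : Lifts (classLift c) (classRotation c) := by
  have h := lifts_turn.mul lifts_cyc
  fin_cases c
  · exact Lifts.one
  · exact h
  · change Lifts ((turnGL * cycGL) ^ 2) ((turnRot * cycRot) ^ 2)
    rw [sq, sq]
    exact h.mul h
  · exact lifts_cyc
  · exact lifts_turn

lemma invariant_one : invariant 1 = 4 := by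
  rw [invariant, Units.val_one, Matrix.trace_one, Matrix.det_one]
  norm_num

lemma invariant_classLift (c : Fin 5) : invariant (classLift c) = classInvariant c := by
  have h5 : rootFive ^ 2 = 5 := sqrt_five_sq
  fin_cases c
  · exact invariant_one
  · change invariant (turnGL * cycGL) = (3 + rootFive) / 2
    rw [invariant_turnGL_mul_cycGL]
    linear_combination h5 / 4
  · change invariant ((turnGL * cycGL) ^ 2) = (3 - rootFive) / 2
    rw [invariant_sq, invariant_turnGL_mul_cycGL]
    grind
  · exact invariant_cycGL
  · exact invariant_turnGL

lemma classRotation_classAxis (c : Fin 5) :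
    (classRotation c).mulVec (classAxis c) = classAxis c := by
  fin_cases c
  · exact Matrix.one_mulVec _
  · exact turnRot_mul_cycRot_faceAxis
  · change ((turnRot * cycRot) ^ 2).mulVec faceAxis = faceAxis
    rw [sq, ← Matrix.mulVec_mulVec, turnRot_mul_cycRot_faceAxis, turnRot_mul_cycRot_faceAxis]
  · exact cycRot_vertexAxis
  · exact turnRot_edgeAxis

lemma classAxis_mem (c : Fin 5) : classAxis c ∈ S2 := by
  fin_cases c
  exacts [faceAxis_mem, faceAxis_mem, faceAxis_mem, vertexAxis_mem, edgeAxis_mem]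

/-- The points with nontrivial stabilizer. -/
def specialPoints : Set (Fin 3 → ℝ) := dodecVertices ∪ dodecFaces ∪ dodecEdges

lemma classAxis_special (c : Fin 5) : classAxis c ∈ specialPoints := by
  fin_cases c
  exacts [Or.inl (Or.inr isIcoOrbit_faces.mem), Or.inl (Or.inr isIcoOrbit_faces.mem),
    Or.inl (Or.inr isIcoOrbit_faces.mem), Or.inl (Or.inl isIcoOrbit_vertices.mem),
    Or.inr isIcoOrbit_edges.mem]

lemma neg_special {v : Fin 3 → ℝ} (hv : v ∈ specialPoints) : -v ∈ specialPoints := by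
  rcases hv with (hv | hv) | hv
  exacts [Or.inl (Or.inl (isIcoOrbit_vertices.neg v hv)),
    Or.inl (Or.inr (isIcoOrbit_faces.neg v hv)), Or.inr (isIcoOrbit_edges.neg v hv)]

/-- A transformation with three fixed points is the identity, whose invariant is 4. -/
lemma eq_or_eq_of_smul_eq {M : GL (Fin 2) ℂ} (hM : invariant M ≠ 4) {p q r : Sphere} (hpq : p ≠ q)
    (hp : M • p = p) (hq : M • q = q) (hr : M • r = r) : r = p ∨ r = q := by
  by_contra! h
  refine hM (invariant_one ▸ invariant_eq_of_smul_eq fun x => ?_)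
  exact smul_ext hpq h.1.symm h.2.symm (hp.trans (one_smul _ _).symm) (hq.trans (one_smul _ _).symm)
    (hr.trans (one_smul _ _).symm) x

lemma classInvariant_ne {c : Fin 5} (hc : c ≠ 0) : classInvariant c ≠ 4 := fun h =>
  hc (classInvariant_injective h)

lemma classLift_smul_axis (c : Fin 5) :
    classLift c • stereo (classAxis c) = stereo (classAxis c) ∧
      classLift c • stereo (-classAxis c) = stereo (-classAxis c) := by
  constructor
  · rw [← (lifts_classLift c _ (classAxis_mem c)).2, classRotation_classAxis]
  · rw [← (lifts_classLift c _ (neg_mem_S2 (classAxis_mem c))).2, Matrix.mulVec_neg,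
      classRotation_classAxis]

lemma eq_axis_of_smul_eq {c : Fin 5} (hc : c ≠ 0) {p : Sphere} (h : classLift c • p = p) :
    p = stereo (classAxis c) ∨ p = stereo (-classAxis c) :=
  eq_or_eq_of_smul_eq (by rw [invariant_classLift]; exact classInvariant_ne hc)
    (stereo_neg_ne (classAxis_mem c)).symm (classLift_smul_axis c).1 (classLift_smul_axis c).2 h

lemma special_of_classRotation {c : Fin 5} (hc : c ≠ 0) {v : Fin 3 → ℝ} (hv : v ∈ S2)
    (h : (classRotation c).mulVec v = v) : v ∈ specialPoints := by
  have h1 : classLift c • stereo v = stereo v := by rw [← (lifts_classLift c v hv).2, h]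
  rcases eq_axis_of_smul_eq hc h1 with h2 | h2
  · exact stereo_injOn hv (classAxis_mem c) h2 ▸ classAxis_special c
  · exact stereo_injOn hv (neg_mem_S2 (classAxis_mem c)) h2 ▸ neg_special (classAxis_special c)

lemma eq_of_mulVec_eq_on_S2 {R R' : Matrix (Fin 3) (Fin 3) ℝ}
    (h : ∀ v ∈ S2, R.mulVec v = R'.mulVec v) : R = R' := by
  ext i j
  have h1 := congrFun (h (Pi.single j 1) (by fin_cases j <;> simp [S2])) i
  simpa using h1

variable {N : ℕ} {l : K N} {h : GL (Fin 2) ℂ} {α : Set (Fin 3 → ℝ)}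

lemma mem_markGroup {M : GL (Fin 2) ℂ} (hM : ∀ k, M • mark l.1 k ∈ markedSet l.1) :
    M ∈ markGroup l := by
  choose σ hσ using hM
  have hinj : Function.Injective σ := fun i j hij => by
    have : M • mark l.1 i = M • mark l.1 j := by rw [← hσ, ← hσ, hij]
    exact mark_inj (MulAction.injective M this)
  exact ⟨Equiv.ofBijective σ (Finite.injective_iff_bijective.1 hinj), fun k => (hσ k).symm⟩

/-- The transformation `h` takes an invariant set of points of the sphere to the marked points. -/
structure Realizes (l : K N) (h : GL (Fin 2) ℂ) (α : Set (Fin 3 → ℝ)) : Prop where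
  subset : α ⊆ S2
  icoInvariant : IsIcoInvariant α
  image : (fun v => h • stereo v) '' α = markedSet l.1

lemma Realizes.exists_mark (H : Realizes l h α) {v : Fin 3 → ℝ} (hv : v ∈ α) :
    ∃ k, mark l.1 k = h • stereo v := by
  have : h • stereo v ∈ markedSet l.1 := H.image ▸ ⟨v, hv, rfl⟩
  exact this

lemma Realizes.exists_point (H : Realizes l h α) (k : Fin (N + 3)) :
    ∃ v ∈ α, h • stereo v = mark l.1 k := by
  have : mark l.1 k ∈ markedSet l.1 := ⟨k, rfl⟩
  rw [← H.image] at this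
  exact this

lemma Realizes.mem_of_mark (H : Realizes l h α) {v : Fin 3 → ℝ} (hv : v ∈ S2) {k : Fin (N + 3)}
    (hk : mark l.1 k = h • stereo v) : v ∈ α := by
  obtain ⟨w, hw, he⟩ := H.exists_point k
  rw [hk] at he
  exact stereo_injOn (H.subset hw) hv (MulAction.injective h he) ▸ hw

lemma Realizes.conj_mem (H : Realizes l h α) {M : GL (Fin 2) ℂ} {R : Matrix (Fin 3) (Fin 3) ℝ}
    (hR : R ∈ ico) (hM : Lifts M R) : h * M * h⁻¹ ∈ markGroup l := by
  refine mem_markGroup fun k => ?_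
  obtain ⟨v, hv, he⟩ := H.exists_point k
  rw [← he, mul_smul, mul_smul, inv_smul_smul, ← (hM v (H.subset hv)).2]
  exact H.exists_mark (H.icoInvariant R hR v hv)

/-- The rotation `R` corresponds to the element `g` of `A₅`. -/
def Corresponds (e : Stab l ≃* A5) (h : GL (Fin 2) ℂ) (R : Matrix (Fin 3) (Fin 3) ℝ) (g : A5) :
    Prop :=
  ∃ (M : GL (Fin 2) ℂ) (hm : h * M * h⁻¹ ∈ markGroup l), Lifts M R ∧ markHom e ⟨_, hm⟩ = g

variable {e : Stab l ≃* A5} {R R' : Matrix (Fin 3) (Fin 3) ℝ} {g g' : A5}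

lemma Realizes.exists_corresponds (H : Realizes l h α) (e : Stab l ≃* A5) (hR : R ∈ ico) :
    ∃ g, Corresponds e h R g := by
  obtain ⟨M, hM⟩ := exists_lift hR
  exact ⟨_, M, H.conj_mem hR hM, hM, rfl⟩

lemma Corresponds.mul (H : Corresponds e h R g) (H' : Corresponds e h R' g') :
    Corresponds e h (R * R') (g * g') := by
  obtain ⟨M, hm, hL, rfl⟩ := H
  obtain ⟨M', hm', hL', rfl⟩ := H'
  have he : h * (M * M') * h⁻¹ = (h * M * h⁻¹) * (h * M' * h⁻¹) := by group
  refine ⟨M * M', by rw [he]; exact mul_mem hm hm', hL.mul hL', ?_⟩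
  rw [← map_mul]
  congr 1
  exact Subtype.ext he

lemma Corresponds.one (e : Stab l ≃* A5) (h : GL (Fin 2) ℂ) : Corresponds e h 1 1 := by
  have he : h * 1 * h⁻¹ = 1 := by group
  refine ⟨1, by rw [he]; exact one_mem _, Lifts.one, ?_⟩
  rw [← map_one (markHom e)]
  congr 1
  exact Subtype.ext he

lemma conj_smul_eq_iff {M M' : GL (Fin 2) ℂ} :
    (∀ p : Sphere, (h * M * h⁻¹) • p = (h * M' * h⁻¹) • p) ↔ ∀ p : Sphere, M • p = M' • p := by
  constructor
  · intro H p
    have := H (h • p)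
    simp only [mul_smul, inv_smul_smul] at this
    exact MulAction.injective h this
  · intro H p
    simp only [mul_smul, H]

lemma Corresponds.left_unique (hN : 2 ≤ N) (H : Corresponds e h R g)
    (H' : Corresponds e h R' g) : R = R' := by
  obtain ⟨M, hm, hL, hg⟩ := H
  obtain ⟨M', hm', hL', hg'⟩ := H'
  have h0 : markHom e ⟨_, hm⟩ = markHom e ⟨_, hm'⟩ := by rw [hg, hg']
  have h1 : ∀ p : Sphere, M • p = M' • p := by
    rw [markHom_eq_iff hN] at h0
    exact conj_smul_eq_iff.1 h0
  refine eq_of_mulVec_eq_on_S2 fun v hv => stereo_injOn (hL v hv).1 (hL' v hv).1 ?_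
  rw [(hL v hv).2, (hL' v hv).2, h1]

lemma Lifts.smul_eq {M M' : GL (Fin 2) ℂ} (hL : Lifts M R) (hL' : Lifts M' R) (p : Sphere) :
    M • p = M' • p := by
  obtain ⟨v, hv, rfl⟩ := exists_stereo_eq p
  rw [← (hL v hv).2, ← (hL' v hv).2]

lemma Corresponds.right_unique (hN : 2 ≤ N) (H : Corresponds e h R g)
    (H' : Corresponds e h R g') : g = g' := by
  obtain ⟨M, hm, hL, rfl⟩ := H
  obtain ⟨M', hm', hL', rfl⟩ := H'
  exact (markHom_eq_iff hN e _ _).2 (conj_smul_eq_iff.2 (hL.smul_eq hL'))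

lemma Corresponds.inv (hN : 2 ≤ N) (H : Realizes l h α) (hR : R ∈ ico)
    (hc : Corresponds e h R g) : Corresponds e h R.transpose g⁻¹ := by
  obtain ⟨g', hg'⟩ := H.exists_corresponds e (ico_orthogonal hR).1
  have h1 := hg'.mul hc
  rw [(ico_orthogonal hR).2.1] at h1
  rwa [← eq_inv_of_mul_eq_one_left (h1.right_unique hN (Corresponds.one e h))]

lemma Corresponds.invariant_eq (hN : 2 ≤ N) (he : IsAdapted e) {M : GL (Fin 2) ℂ}
    (hM : Lifts M R) (hc : Corresponds e h R g) :
    invariant M = classInvariant (classIndex g) := by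
  obtain ⟨M', hm, hL, rfl⟩ := hc
  rw [← invariant_eq_classInvariant hN he, invariant_conj]
  exact invariant_eq_of_smul_eq (hM.smul_eq hL)

lemma Corresponds.classIndex_eq (hN : 2 ≤ N) (he : IsAdapted e) {c : Fin 5}
    (hc : Corresponds e h (classRotation c) g) : classIndex g = c :=
  classInvariant_injective
    ((hc.invariant_eq hN he (lifts_classLift c)).symm.trans (invariant_classLift c))

lemma orderOf_classRep : orderOf (classRep 1) = 5 ∧ orderOf (classRep 3) = 3 ∧
    orderOf (classRep 4) = 2 := by
  have : Fact (Nat.Prime 5) := ⟨by norm_num⟩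
  have : Fact (Nat.Prime 3) := ⟨by norm_num⟩
  exact ⟨orderOf_eq_prime classRep_pow.2.2 classRep_pow_ne_one.2.2.1,
    orderOf_eq_prime classRep_pow.2.1 classRep_pow_ne_one.2.1,
    orderOf_eq_prime classRep_pow.1 classRep_pow_ne_one.1⟩

lemma orderOf_eq_orderOf_classRep (g : A5) : orderOf g = orderOf (classRep (classIndex g)) := by
  obtain ⟨k, hk⟩ := exists_conj_classRep g
  conv_lhs => rw [← hk]
  rw [← MulAut.conj_apply, MulEquiv.orderOf_eq]

/-- The order is divisible by 30, so the index is 1 or 2. Index 2 would make the subgroup normal,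
which simplicity of `A₅` excludes. -/
lemma eq_top_of_orders {S : Subgroup A5} (h2 : ∃ g ∈ S, orderOf g = 2)
    (h3 : ∃ g ∈ S, orderOf g = 3) (h5 : ∃ g ∈ S, orderOf g = 5) : S = ⊤ := by
  have hdvd : ∀ n, (∃ g ∈ S, orderOf g = n) → n ∣ Nat.card S := by
    rintro n ⟨g, hg, rfl⟩
    exact S.orderOf_dvd_natCard hg
  have h30 : 30 ∣ Nat.card S := by
    have h6 : 2 * 3 ∣ Nat.card S :=
      Nat.Coprime.mul_dvd_of_dvd_of_dvd (by norm_num) (hdvd 2 h2) (hdvd 3 h3)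
    exact Nat.Coprime.mul_dvd_of_dvd_of_dvd (m := 2 * 3) (n := 5) (by norm_num) h6 (hdvd 5 h5)
  obtain ⟨m, hm⟩ := h30
  have hcard := S.card_mul_index
  rw [natCard_A5, hm] at hcard
  have hidx : S.index = 1 ∨ S.index = 2 := by
    have h6 : m * S.index = 2 := by nlinarith
    have h7 : S.index ∣ 2 := ⟨m, by rw [← h6, mul_comm]⟩
    exact (Nat.dvd_prime Nat.prime_two).1 h7
  rcases hidx with hidx | hidx
  · exact Subgroup.index_eq_one.1 hidx
  · have := Subgroup.normal_of_index_eq_two hidx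
    rcases this.eq_bot_or_eq_top with h | h
    · obtain ⟨g, hg, hg2⟩ := h2
      rw [h, Subgroup.mem_bot] at hg
      rw [hg, orderOf_one] at hg2
      norm_num at hg2
    · exact h

/-- The subgroup of `A₅` corresponding to the icosahedral group. -/
def Realizes.subgroup (H : Realizes l h α) (hN : 2 ≤ N) (e : Stab l ≃* A5) : Subgroup A5 where
  carrier := {g | ∃ R ∈ ico, Corresponds e h R g}
  one_mem' := ⟨1, one_mem _, Corresponds.one e h⟩
  mul_mem' := by
    rintro g g' ⟨R, hR, hc⟩ ⟨R', hR', hc'⟩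
    exact ⟨_, mul_mem hR hR', hc.mul hc'⟩
  inv_mem' := by
    rintro g ⟨R, hR, hc⟩
    exact ⟨_, (ico_orthogonal hR).1, hc.inv hN H hR⟩

/-- The elements corresponding to rotations form a subgroup with elements of orders 2, 3 and 5,
hence all of `A₅`. -/
lemma Realizes.exists_rotation (H : Realizes l h α) (hN : 2 ≤ N) (he : IsAdapted e) (g : A5) :
    ∃ R ∈ ico, Corresponds e h R g := by
  have key : ∀ c, ∃ g ∈ H.subgroup hN e, orderOf g = orderOf (classRep c) := fun c => by
    obtain ⟨g, hg⟩ := H.exists_corresponds e (classRotation_mem c)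
    exact ⟨g, ⟨_, classRotation_mem c, hg⟩,
      by rw [orderOf_eq_orderOf_classRep, hg.classIndex_eq hN he]⟩
  obtain ⟨h5, h3, h2⟩ := orderOf_classRep
  have htop : H.subgroup hN e = ⊤ := eq_top_of_orders
    ((key 4).imp fun g hg => ⟨hg.1, hg.2.trans h2⟩) ((key 3).imp fun g hg => ⟨hg.1, hg.2.trans h3⟩)
    ((key 1).imp fun g hg => ⟨hg.1, hg.2.trans h5⟩)
  have : g ∈ H.subgroup hN e := htop ▸ Subgroup.mem_top g
  exact this

/-- The order of the icosahedral group is read off from the correspondence with `A₅`, a bijection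
because both sides act faithfully on the sphere. -/
lemma Realizes.natCard_ico (H : Realizes l h α) (hN : 2 ≤ N) (he : IsAdapted e) :
    Nat.card ico = 60 := by
  choose R hR hc using H.exists_rotation hN he
  rw [← natCard_A5]
  symm
  refine Nat.card_eq_of_bijective (fun g => (⟨R g, hR g⟩ : ico)) ⟨fun g g' hg => ?_, ?_⟩
  · have h1 : R g = R g' := congrArg Subtype.val hg
    exact (hc g).right_unique hN (h1 ▸ hc g')
  · rintro ⟨S, hS⟩
    obtain ⟨g, hg⟩ := H.exists_corresponds e hS
    exact ⟨g, Subtype.ext ((hc g).left_unique hN hg)⟩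

/-- A nontrivial rotation is conjugate within `ico` to some `classRotation c`, whose fixed points on
the sphere are special, whereas `ico` preserves generic points. -/
lemma Realizes.eq_one_of_fixes (H : Realizes l h α) (hN : 2 ≤ N) (he : IsAdapted e) (hR : R ∈ ico)
    {a : Fin 3 → ℝ} (ha : a ∈ genericPoints) (hRa : R.mulVec a = a) : R = 1 := by
  obtain ⟨g, hg⟩ := H.exists_corresponds e hR
  by_cases hg1 : g = 1
  · subst hg1
    exact hg.left_unique hN (Corresponds.one e h)
  exfalso
  set c := classIndex g with hcdef
  obtain ⟨k₁, hk₁⟩ := exists_conj_classRep g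
  rw [← hcdef] at hk₁
  have hc0 : c ≠ 0 := by
    intro h0
    rw [h0] at hk₁
    exact hg1 (hk₁ ▸ by simp [classRep])
  obtain ⟨g', hg'⟩ := H.exists_corresponds e (classRotation_mem c)
  obtain ⟨k₂, hk₂⟩ := exists_conj_classRep g'
  rw [hg'.classIndex_eq hN he] at hk₂
  obtain ⟨S, hS, hSc⟩ := H.exists_rotation hN he (k₁ * k₂⁻¹)
  have h1 := (hSc.mul hg').mul (hSc.inv hN H hS)
  have h2 : k₁ * k₂⁻¹ * g' * (k₁ * k₂⁻¹)⁻¹ = g := by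
    rw [← hk₁, ← hk₂]; group
  rw [h2] at h1
  have h3 : (classRotation c).mulVec (S.transpose.mulVec a) = S.transpose.mulVec a := by
    have h4 := congrArg (fun A => S.transpose.mulVec (A.mulVec a)) (hg.left_unique hN h1)
    simp only [hRa, ← Matrix.mulVec_mulVec, ico_transpose_mulVec hS] at h4
    exact h4.symm
  have h5 := isIcoInvariant_genericPoints _ (ico_orthogonal hS).1 a ha
  exact h5.2 (special_of_classRotation hc0 h5.1 h3)

lemma Realizes.ncard_orbit (H : Realizes l h α) (hN : 2 ≤ N) (he : IsAdapted e)
    {a : Fin 3 → ℝ} (ha : a ∈ genericPoints) : (orbit a).ncard = 60 := by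
  have h1 : orbit a = (fun R : Matrix (Fin 3) (Fin 3) ℝ => R.mulVec a) '' ico := by
    ext v
    rw [mem_orbit_iff]
    exact ⟨fun ⟨h, hh, hv⟩ => ⟨h, hh, hv.symm⟩, fun ⟨h, hh, hv⟩ => ⟨h, hh, hv.symm⟩⟩
  rw [h1, Set.InjOn.ncard_image, ← H.natCard_ico hN he]
  · rfl
  · intro R hR R' hR' heq
    have h2 : R'.transpose * R = 1 := by
      refine H.eq_one_of_fixes hN he (mul_mem (ico_orthogonal hR').1 hR) ha ?_
      rw [← Matrix.mulVec_mulVec]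
      exact (congrArg _ heq).trans (ico_transpose_mulVec hR' a)
    calc R = R' * (R'.transpose * R) := by
          rw [← mul_assoc, mul_eq_one_comm.1 (ico_orthogonal hR').2.1, one_mul]
      _ = R' := by rw [h2, mul_one]

lemma trace_det_of_eigenvectors {A : Matrix (Fin 2) (Fin 2) ℂ} {u v : Fin 2 → ℂ} {a b : ℂ}
    (huv : vdet u v ≠ 0) (hu : A.mulVec u = a • u) (hv : A.mulVec v = b • v) :
    A.trace = a + b ∧ A.det = a * b := by
  have h1 := mul_columns huv A a 0 0 b (by rw [hu, zero_smul, add_zero])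
    (by rw [hv, zero_smul, zero_add])
  set P := columns u v huv
  have h2 : A = P.val * !![a, 0; 0, b] * P⁻¹.val := by
    rw [← h1, mul_assoc, ← Units.val_mul, mul_inv_cancel, Units.val_one, mul_one]
  rw [h2]
  constructor
  · rw [Matrix.trace_mul_comm, ← mul_assoc, ← Units.val_mul, inv_mul_cancel, Units.val_one, one_mul,
      Matrix.trace_fin_two_of]
  · rw [Matrix.det_mul_right_comm, ← Units.val_mul, mul_inv_cancel, Units.val_one, one_mul,
      Matrix.det_fin_two_of, mul_zero, sub_zero]

lemma tangentCharacter_zero (e : Stab l ≃* A5) : tangentCharacter e 0 = N := by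
  have h1 : e.symm (classRep 0) = 1 := by simp [classRep]
  rw [tangentCharacter, h1, Representation.char_one, Module.finrank_fin_fun]

lemma tangentCharacter_eq_trace {c : Fin 5} {M : markGroup l}
    (hM : classIndex (markHom e M) = c) : tangentCharacter e c =
      LinearMap.trace ℂ _ (fderiv ℂ (gMap (markPerm l M)) l.1 :
        (Fin N → ℂ) →ₗ[ℂ] (Fin N → ℂ)) := by
  obtain ⟨k, hk⟩ := exists_conj_classRep (markHom e M)
  have h1 : toStab l M = e.symm k * e.symm (classRep c) * (e.symm k)⁻¹ := by
    rw [← map_inv, ← map_mul, ← map_mul, ← hM, hk]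
    exact (e.symm_apply_apply _).symm
  rw [← tangentRep_apply l (toStab l M) (markPerm l M) rfl, h1]
  exact (Representation.char_conj _ _ _).symm

-- With eigenvalues `a`, `b` at two marked fixed points the trace formula gives `b/a + a/b - (a/b +
-- 1 + b/a) = -1`. With no marked fixed point only `1 - tr² / det` remains. The two implications
-- `hneg`, `hneg'` say that both ends of the axis are marked or neither is.
open Classical in
theorem Realizes.tangentCharacter_eq (H : Realizes l h α) (hN : 2 ≤ N) (he : IsAdapted e)
    {c : Fin 5} (hc : c ≠ 0) (hneg : classAxis c ∈ α → -classAxis c ∈ α)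
    (hneg' : -classAxis c ∈ α → classAxis c ∈ α) :
    tangentCharacter e c = if classAxis c ∈ α then -1 else 1 - classInvariant c := by
  have hmem := H.conj_mem (classRotation_mem c) (lifts_classLift c)
  set M : markGroup l := ⟨_, hmem⟩ with hM
  have hcorr : Corresponds e h (classRotation c) (markHom e M) :=
    ⟨_, hmem, lifts_classLift c, rfl⟩
  rw [tangentCharacter_eq_trace (hcorr.classIndex_eq hN he)]
  choose d hd0 hd using fun k => exists_mulVec_hom M.1 (mark l.1 k)
  have hd' : ∀ k, M.1.val.mulVec (homMark l.1 k) = d k • homMark l.1 (markPerm l M k) := fun k => by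
    have := hd k
    rw [smul_mark] at this
    exact this
  rw [trace_fderiv_gMap l.2 _ M.1 d hd0 hd']
  have hinv : invariant M.1 = classInvariant c := (invariant_conj _ _).trans (invariant_classLift c)
  have hfix : ∀ k, markPerm l M k = k →
      mark l.1 k = h • stereo (classAxis c) ∨ mark l.1 k = h • stereo (-classAxis c) := by
    intro k hk
    have h1 := smul_mark M k
    rw [hk, hM, mul_smul, mul_smul, smul_eq_iff_eq_inv_smul] at h1
    rcases eq_axis_of_smul_eq hc h1 with h2 | h2
    · exact Or.inl (inv_smul_eq_iff.1 h2)
    · exact Or.inr (inv_smul_eq_iff.1 h2)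
  have hfix' : ∀ k v, (v = classAxis c ∨ v = -classAxis c) → mark l.1 k = h • stereo v →
      markPerm l M k = k := by
    intro k v hv hk
    apply mark_inj (l := l)
    rw [← smul_mark, hM, mul_smul, mul_smul, hk, inv_smul_smul]
    rcases hv with rfl | rfl
    · rw [(classLift_smul_axis c).1]
    · rw [(classLift_smul_axis c).2]
  split_ifs with hα
  · obtain ⟨i, hi⟩ := H.exists_mark hα
    obtain ⟨j, hj⟩ := H.exists_mark (hneg hα)
    have hne : mark l.1 i ≠ mark l.1 j := by
      rw [hi, hj]
      exact fun h' => stereo_neg_ne (classAxis_mem c) (MulAction.injective h h').symm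
    have hij : i ≠ j := fun h' => hne (h' ▸ rfl)
    have hfi := hfix' i _ (Or.inl rfl) hi
    have hfj := hfix' j _ (Or.inr rfl) hj
    have hsum : (∑ k, if markPerm l M k = k then M.1.val.trace / d k - 1 else 0) =
        (M.1.val.trace / d i - 1) + (M.1.val.trace / d j - 1) := by
      rw [← Finset.sum_subset (Finset.subset_univ {i, j}), Finset.sum_pair hij, if_pos hfi,
        if_pos hfj]
      intro k _ hk
      refine if_neg fun hk' => hk ?_
      rcases hfix k hk' with h1 | h1
      · rw [mark_inj (h1.trans hi.symm)]; simp
      · rw [mark_inj (h1.trans hj.symm)]; simp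
    have h1 := hd' i
    have h2 := hd' j
    rw [hfi] at h1
    rw [hfj] at h2
    have huv : vdet (homMark l.1 i) (homMark l.1 j) ≠ 0 := br_ne_zero hne
    obtain ⟨ht, hdet⟩ := trace_det_of_eigenvectors huv h1 h2
    have hi0 := hd0 i
    have hj0 := hd0 j
    rw [hsum, invariant, hdet, ht]
    field_simp
    ring
  · rw [Finset.sum_eq_zero, hinv]
    · ring
    · intro k _
      refine if_neg fun hk => hα ?_
      rcases hfix k hk with h1 | h1
      · exact H.mem_of_mark (classAxis_mem c) h1
      · exact hneg' (H.mem_of_mark (neg_mem_S2 (classAxis_mem c)) h1)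

end ModuliZero
end

noncomputable section
namespace ModuliZero

/-! ### The types of invariant configurations -/

lemma mem_faces_iff : faceAxis ∈ dodecFaces ∧ faceAxis ∉ dodecVertices ∧ faceAxis ∉ dodecEdges :=
  ⟨isIcoOrbit_faces.mem, Set.disjoint_left.1 disjoint_faces_vertices isIcoOrbit_faces.mem,
    Set.disjoint_right.1 disjoint_edges_faces isIcoOrbit_faces.mem⟩

lemma mem_vertices_iff :
    vertexAxis ∈ dodecVertices ∧ vertexAxis ∉ dodecFaces ∧ vertexAxis ∉ dodecEdges :=
  ⟨isIcoOrbit_vertices.mem, Set.disjoint_right.1 disjoint_faces_vertices isIcoOrbit_vertices.mem,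
    Set.disjoint_left.1 disjoint_vertices_edges isIcoOrbit_vertices.mem⟩

lemma mem_edges_iff : edgeAxis ∈ dodecEdges ∧ edgeAxis ∉ dodecFaces ∧ edgeAxis ∉ dodecVertices :=
  ⟨isIcoOrbit_edges.mem, Set.disjoint_left.1 disjoint_edges_faces isIcoOrbit_edges.mem,
    Set.disjoint_right.1 disjoint_vertices_edges isIcoOrbit_edges.mem⟩

lemma finite_faces : dodecFaces.Finite :=
  Set.finite_of_ncard_ne_zero (by rw [ncard_faces]; norm_num)
lemma finite_vertices : dodecVertices.Finite :=
  Set.finite_of_ncard_ne_zero (by rw [ncard_vertices]; norm_num)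
lemma finite_edges : dodecEdges.Finite :=
  Set.finite_of_ncard_ne_zero (by rw [ncard_edges]; norm_num)

namespace OrbitType

lemma neg_exceptional (t : OrbitType) {v : Fin 3 → ℝ} (hv : v ∈ t.exceptional) :
    -v ∈ t.exceptional := by
  have hF := isIcoOrbit_faces.neg v
  have hV := isIcoOrbit_vertices.neg v
  have hE := isIcoOrbit_edges.neg v
  cases t <;> simp only [exceptional, Set.mem_union, Set.mem_empty_iff_false] at hv ⊢ <;> grind

lemma isIcoInvariant_exceptional (t : OrbitType) : IsIcoInvariant t.exceptional := by
  have hF := isIcoOrbit_faces.invariant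
  have hV := isIcoOrbit_vertices.invariant
  have hE := isIcoOrbit_edges.invariant
  cases t
  exacts [hF, hV, hE, hF.union hV, hV.union hE, hE.union hF, (hF.union hV).union hE,
    fun _ _ _ hv => hv.elim]

lemma exceptional_subset (t : OrbitType) : t.exceptional ⊆ specialPoints := by
  intro v hv
  cases t <;> simp only [exceptional, specialPoints, Set.mem_union, Set.mem_empty_iff_false] at * <;>
    tauto

/-- The value at the identity: the number of points is `n = N + 3`, and `N` must be the sum of the
degrees with multiplicity. -/
lemma ncard_exceptional (t : OrbitType) (m : ℕ) : t.exceptional.Finite ∧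
    t.exceptional.ncard + 60 * t.numGeneric m =
      t.multiplicity m 0 + 4 * t.multiplicity m 1 + 5 * t.multiplicity m 2 +
        3 * t.multiplicity m 3 + 3 * t.multiplicity m 4 + 3 := by
  have hF := finite_faces
  have hV := finite_vertices
  have hE := finite_edges
  have cF := ncard_faces
  have cV := ncard_vertices
  have cE := ncard_edges
  have hFV := Set.ncard_union_eq disjoint_faces_vertices hF hV
  have hVE := Set.ncard_union_eq disjoint_vertices_edges hV hE
  have hEF := Set.ncard_union_eq disjoint_edges_faces hE hF
  have hFVE := Set.ncard_union_eq
    (Set.disjoint_union_left.2 ⟨disjoint_edges_faces.symm, disjoint_vertices_edges⟩)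
    (hF.union hV) hE
  cases t <;> refine ⟨?_, ?_⟩ <;>
    first
      | simp only [exceptional]; simp [Set.finite_union, hF, hV, hE]; done
      | simp only [exceptional, numGeneric, multiplicity, Matrix.cons_val, Set.ncard_empty]; omega

end OrbitType

lemma specialPoints_subset : specialPoints ⊆ S2 := by
  rintro v ((hv | hv) | hv)
  exacts [isIcoOrbit_vertices.subset_S2 vertexAxis_mem hv, isIcoOrbit_faces.subset_S2 faceAxis_mem hv,
    isIcoOrbit_edges.subset_S2 edgeAxis_mem hv]

variable {N : ℕ} {l : K N} {h : GL (Fin 2) ℂ} {α : Set (Fin 3 → ℝ)} {t : OrbitType} {m : ℕ}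
  {e : Stab l ≃* A5}

lemma orbit_subset_generic {a : Fin 3 → ℝ} (ha : a ∈ genericPoints) : orbit a ⊆ genericPoints :=
  orbit_subset isIcoInvariant_genericPoints ha

lemma IsOfType.subset (hα : IsOfType t m α) : α ⊆ S2 := by
  obtain ⟨a, ha, -, rfl⟩ := hα
  rintro v (hv | hv)
  · exact specialPoints_subset (t.exceptional_subset hv)
  · obtain ⟨i, hi⟩ := Set.mem_iUnion.1 hv
    exact (orbit_subset_generic (ha i) hi).1

lemma IsOfType.isIcoInvariant (hα : IsOfType t m α) : IsIcoInvariant α := by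
  obtain ⟨a, ha, -, rfl⟩ := hα
  refine t.isIcoInvariant_exceptional.union fun R hR v hv => ?_
  obtain ⟨i, hi⟩ := Set.mem_iUnion.1 hv
  exact Set.mem_iUnion.2 ⟨i, isIcoInvariant_orbit _ R hR v hi⟩

lemma IsOfType.mem_iff (hα : IsOfType t m α) {v : Fin 3 → ℝ} (hv : v ∈ specialPoints) :
    v ∈ α ↔ v ∈ t.exceptional := by
  obtain ⟨a, ha, -, rfl⟩ := hα
  refine ⟨fun h => h.resolve_right fun h' => ?_, Or.inl⟩
  obtain ⟨i, hi⟩ := Set.mem_iUnion.1 h'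
  exact (orbit_subset_generic (ha i) hi).2 hv

lemma disjoint_orbit {a b : Fin 3 → ℝ} (hab : orbit a ≠ orbit b) :
    Disjoint (orbit a) (orbit b) :=
  Set.disjoint_left.2 fun _ hv hv' => hab ((orbit_eq_of_mem hv).symm.trans (orbit_eq_of_mem hv'))

lemma IsOfType.ncard_eq (hα : IsOfType t m α)
    (hcard : ∀ a ∈ genericPoints, (orbit a).ncard = 60) :
    α.ncard = t.exceptional.ncard + 60 * t.numGeneric m := by
  obtain ⟨a, ha, hne, rfl⟩ := hα
  have hfin : ∀ i, (orbit (a i)).Finite := fun i =>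
    Set.finite_of_ncard_ne_zero (by rw [hcard _ (ha i)]; norm_num)
  rw [Set.ncard_union_eq _ (t.ncard_exceptional m).1 (Set.finite_iUnion hfin),
    Set.ncard_iUnion_of_finite hfin fun i j hij => disjoint_orbit (hne i j hij)]
  · simp [hcard _ (ha _), finsum_eq_sum_of_fintype, mul_comm]
  · rw [Set.disjoint_left]
    intro v hv hv'
    obtain ⟨i, hi⟩ := Set.mem_iUnion.1 hv'
    exact (orbit_subset_generic (ha i) hi).2 (t.exceptional_subset hv)

lemma Realizes.ncard_eq (H : Realizes l h α) : α.ncard = N + 3 := by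
  have h1 : (markedSet l.1).ncard = N + 3 := by
    rw [markedSet, ← Set.image_univ, Set.ncard_image_of_injective _ ((mark_injective_iff l.1).2 l.2),
      Set.ncard_univ, Nat.card_eq_fintype_card, Fintype.card_fin]
  rw [← h1, ← H.image, Set.InjOn.ncard_image]
  intro v hv w hw hvw
  exact stereo_injOn (H.subset hv) (H.subset hw) (MulAction.injective h hvw)

lemma HasType.exists_realizes (ht : HasType l t m) :
    ∃ (h : GL (Fin 2) ℂ) (α : Set (Fin 3 → ℝ)), IsOfType t m α ∧ Realizes l h α := by
  obtain ⟨α, hα, _, ⟨h, rfl⟩, himg⟩ := ht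
  refine ⟨h, α, hα, hα.subset, hα.isIcoInvariant, ?_⟩
  rw [← himg, Set.image_image]
  rfl

lemma Realizes.hasType (H : Realizes l h α) (hα : IsOfType t m α) : HasType l t m := by
  refine ⟨α, hα, _, ⟨h, rfl⟩, ?_⟩
  rw [← H.image, Set.image_image]
  rfl

lemma IsIcoOrbit.inter_eq {S : Set (Fin 3 → ℝ)} {x : Fin 3 → ℝ} (hS : IsIcoOrbit S x)
    (hα : IsIcoInvariant α) : (∀ v ∈ S, v ∈ α) ∨ ∀ v ∈ S, v ∉ α := by
  by_cases hne : ∃ v ∈ S, v ∈ α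
  · obtain ⟨v, hv, hv'⟩ := hne
    exact Or.inl (hS.subset hα hv hv')
  · push Not at hne
    exact Or.inr hne

lemma exists_orbits {S : Set (Fin 3 → ℝ)} (hfin : S.Finite) (hS : IsIcoInvariant S) :
    ∃ (k : ℕ) (a : Fin k → Fin 3 → ℝ), (∀ i, a i ∈ S) ∧
      (∀ i j, i ≠ j → orbit (a i) ≠ orbit (a j)) ∧ S = ⋃ i, orbit (a i) := by
  have : Finite (orbit '' S) := hfin.image _
  obtain ⟨k, ⟨f⟩⟩ := Finite.exists_equiv_fin (orbit '' S)
  choose a ha hf using fun i => (f.symm i).2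
  refine ⟨k, a, ha, fun i j hij h => hij ?_, Set.Subset.antisymm ?_ ?_⟩
  · rw [hf, hf] at h
    exact f.symm.injective (Subtype.ext h)
  · intro v hv
    refine Set.mem_iUnion.2 ⟨f ⟨orbit v, v, hv, rfl⟩, ?_⟩
    rw [hf, f.symm_apply_apply]
    exact self_mem_orbit v
  · exact Set.iUnion_subset fun i => orbit_subset hS (ha i)

/-- An invariant set contains each of the three exceptional orbits entirely or not at all, which
leaves eight cases. -/
lemma exists_exceptional (hα : IsIcoInvariant α) :
    ∃ t : OrbitType, t.exceptional = α ∩ specialPoints := by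
  rcases isIcoOrbit_faces.inter_eq hα with hF | hF <;>
  rcases isIcoOrbit_vertices.inter_eq hα with hV | hV <;>
  rcases isIcoOrbit_edges.inter_eq hα with hE | hE
  on_goal 1 => refine ⟨.FVE, ?_⟩
  on_goal 2 => refine ⟨.FV, ?_⟩
  on_goal 3 => refine ⟨.EF, ?_⟩
  on_goal 4 => refine ⟨.F, ?_⟩
  on_goal 5 => refine ⟨.VE, ?_⟩
  on_goal 6 => refine ⟨.V, ?_⟩
  on_goal 7 => refine ⟨.E, ?_⟩
  on_goal 8 => refine ⟨.B, ?_⟩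
  all_goals
    ext v
    have hF := hF v
    have hV := hV v
    have hE := hE v
    simp only [OrbitType.exceptional, specialPoints, Set.mem_inter_iff, Set.mem_union,
      Set.mem_empty_iff_false]
    grind

lemma exists_isOfType (hS2 : α ⊆ S2) (hα : IsIcoInvariant α) (hfin : α.Finite)
    (hne : α.Nonempty) : ∃ t m, IsOfType t m α := by
  obtain ⟨t, ht⟩ := exists_exceptional hα
  have hspecial : IsIcoInvariant specialPoints :=
    (isIcoOrbit_vertices.invariant.union isIcoOrbit_faces.invariant).union
      isIcoOrbit_edges.invariant
  obtain ⟨k, a, ha, hdiff, hU⟩ := exists_orbits (hfin.subset Set.sdiff_subset) (hα.diff hspecial)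
  have hαe : α = t.exceptional ∪ ⋃ i, orbit (a i) := by
    rw [ht, ← hU, Set.inter_union_sdiff]
  have key : ∀ m, t.numGeneric m = k → IsOfType t m α := by
    rintro m rfl
    exact ⟨a, fun i => ⟨hS2 (ha i).1, (ha i).2⟩, hdiff, hαe⟩
  -- Without exceptional orbits the type counts `1 + m` generic ones, so nonemptiness is needed to
  -- have at least one.
  by_cases htB : t = .B
  · subst htB
    have hk : k ≠ 0 := by
      rintro rfl
      obtain ⟨v, hv⟩ := hne
      rw [hαe] at hv
      simp [OrbitType.exceptional] at hv
    exact ⟨_, k - 1, key _ (by simp only [OrbitType.numGeneric]; omega)⟩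
  · exact ⟨t, k, key k (by cases t <;> first | rfl | exact absurd rfl htB)⟩

/-- Transformations lying over `involution` and `threeCycle` have the same invariants, also for
their product, as `turnGL` and `cycGL`. A simultaneous conjugation of the two pairs turns `[λ]` into
a set invariant under both generators. -/
lemma exists_realizes (hN : 2 ≤ N) (he : IsAdapted e) : ∃ h α, Realizes l h α := by
  have hsq : rootFive ^ 2 = 5 := sqrt_five_sq
  obtain ⟨A, hA⟩ := markHom_surjective e (classRep 4)
  obtain ⟨B, hB⟩ := markHom_surjective e (classRep 3)
  have hAB : markHom e (A * B) = classRep 1 := by rw [map_mul, hA, hB]; rfl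
  have iA := invariant_eq_classInvariant hN he A
  have iB := invariant_eq_classInvariant hN he B
  have iAB := invariant_eq_classInvariant hN he (A * B)
  rw [hA, classIndex_classRep] at iA
  rw [hB, classIndex_classRep] at iB
  rw [hAB, classIndex_classRep] at iAB
  have hphi : classInvariant 1 = ((1 + rootFive) / 2) ^ 2 := by
    change (3 + rootFive) / 2 = _
    linear_combination -hsq / 4
  rw [hphi] at iAB
  have hne : ((1 + rootFive) / 2) ^ 2 ≠ 3 := fun h3 =>
    rootFive_ne.2.2.2.1 (by linear_combination 2 * h3 - hsq / 2)
  obtain ⟨h, h1, h2⟩ := exists_simultaneous_conj hne iA iB iAB invariant_turnGL invariant_cycGL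
    invariant_turnGL_mul_cycGL
  have hmark : ∀ (M : markGroup l) {p : Sphere}, p ∈ markedSet l.1 → M.1 • p ∈ markedSet l.1 := by
    rintro M _ ⟨k, rfl⟩
    exact ⟨_, (smul_mark M k).symm⟩
  refine ⟨h⁻¹, {v | v ∈ S2 ∧ h⁻¹ • stereo v ∈ markedSet l.1}, fun v hv => hv.1,
    isIcoInvariant_of_generators ?_ ?_, ?_⟩
  · rintro v ⟨hv, hv'⟩
    refine ⟨(lifts_turn v hv).1, ?_⟩
    have h3 := h1 (h⁻¹ • stereo v)
    rw [smul_inv_smul] at h3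
    rw [(lifts_turn v hv).2, ← h3, inv_smul_smul]
    exact hmark A hv'
  · rintro v ⟨hv, hv'⟩
    refine ⟨(lifts_cyc v hv).1, ?_⟩
    have h3 := h2 (h⁻¹ • stereo v)
    rw [smul_inv_smul] at h3
    rw [(lifts_cyc v hv).2, ← h3, inv_smul_smul]
    exact hmark B hv'
  · ext p
    constructor
    · rintro ⟨v, hv, rfl⟩
      exact hv.2
    · intro hp
      obtain ⟨v, hv, hs⟩ := exists_stereo_eq (h • p)
      have h3 : h⁻¹ • stereo v = p := by rw [hs, inv_smul_smul]
      exact ⟨v, ⟨hv, h3 ▸ hp⟩, h3⟩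

/-! ### The multiplicity vectors -/

-- The stated vectors solve the linear system. Both classes of five-cycles see only whether `F` is
-- present, the three-cycles `V`, and the involutions `E`.
open Classical in
lemma sum_multiplicity (t : OrbitType) (m : ℕ) {c : Fin 5} (hc : c ≠ 0) :
    ∑ i, (t.multiplicity m i : ℂ) * (charTable i c : ℂ) =
      if classAxis c ∈ t.exceptional then -1 else 1 - classInvariant c := by
  obtain ⟨f1, f2, f3⟩ := mem_faces_iff
  obtain ⟨v1, v2, v3⟩ := mem_vertices_iff
  obtain ⟨e1, e2, e3⟩ := mem_edges_iff
  rw [Fin.sum_univ_five]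
  fin_cases c
  · exact absurd rfl hc
  all_goals
    cases t <;>
    simp [OrbitType.multiplicity, OrbitType.exceptional, charTable, classAxis, classInvariant,
      f1, f2, f3, v1, v2, v3, e1, e2, e3] <;> ring

/-- The character table is invertible, by orthogonality of its rows. -/
lemma eq_of_sum_charTable_eq {p q : Fin 5 → ℕ} (hpq : ∀ c,
    ∑ i, (p i : ℂ) * (charTable i c : ℂ) = ∑ i, (q i : ℂ) * (charTable i c : ℂ)) : p = q := by
  have h0 := hpq 0
  have h1 := hpq 1
  have h2 := hpq 2
  have h3 := hpq 3
  have h4 := hpq 4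
  have hr := rootFive_ne.1
  have hsq : rootFive ^ 2 = 5 := sqrt_five_sq
  simp only [Fin.sum_univ_five, charTable, Matrix.of_apply, Matrix.cons_val] at h0 h1 h2 h3 h4
  push_cast at h0 h1 h2 h3 h4
  -- The columns of the two classes of five-cycles differ by `√5 (p₄ - p₅)`, in the numbering of the
  -- theorem. Their sum is rational, and the coefficients below are class sizes times character
  -- values.
  have hd : (p 3 : ℂ) - p 4 = q 3 - q 4 := by
    apply mul_left_cancel₀ hr
    linear_combination h1 - h2
  have hs : (p 0 : ℂ) - p 1 + (p 3 + p 4) / 2 = q 0 - q 1 + (q 3 + q 4) / 2 := by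
    linear_combination (h1 + h2) / 2
  have e0 : (p 0 : ℂ) = q 0 := by
    linear_combination (h0 + 24 * hs + 20 * h3 + 15 * h4) / 60
  have e1 : (p 1 : ℂ) = q 1 := by
    linear_combination (4 * h0 - 24 * hs + 20 * h3) / 60
  have e2 : (p 2 : ℂ) = q 2 := by
    linear_combination (5 * h0 - 20 * h3 + 15 * h4) / 60
  have e34 : (p 3 : ℂ) + p 4 = q 3 + q 4 := by
    linear_combination (6 * h0 + 24 * hs - 30 * h4) / 60
  have e3 : (p 3 : ℂ) = q 3 := by linear_combination (e34 + hd) / 2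
  have e4 : (p 4 : ℂ) = q 4 := by linear_combination (e34 - hd) / 2
  funext i
  fin_cases i
  exacts [Nat.cast_injective e0, Nat.cast_injective e1, Nat.cast_injective e2,
    Nat.cast_injective e3, Nat.cast_injective e4]

-- The character of `X_λ` is that of the stated sum: at the identity by counting points, elsewhere
-- by the trace formula.
open Classical in
theorem HasType.isMultiplicityVector_iff (hN : 2 ≤ N) (he : IsAdapted e) (ht : HasType l t m)
    (p : Fin 5 → ℕ) : IsMultiplicityVector l p ↔ p = t.multiplicity m := by
  obtain ⟨h, α, hα, H⟩ := ht.exists_realizes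
  have hcard : t.exceptional.ncard + 60 * t.numGeneric m = N + 3 := by
    rw [← hα.ncard_eq fun a ha => H.ncard_orbit hN he ha, H.ncard_eq]
  have hchar : ∀ c, tangentCharacter e c =
      ∑ i, (t.multiplicity m i : ℂ) * (charTable i c : ℂ) := by
    intro c
    by_cases hc : c = 0
    · subst hc
      rw [(t.ncard_exceptional m).2] at hcard
      have hN' : N = t.multiplicity m 0 + 4 * t.multiplicity m 1 + 5 * t.multiplicity m 2 +
        3 * t.multiplicity m 3 + 3 * t.multiplicity m 4 := by omega
      rw [tangentCharacter_zero, Fin.sum_univ_five, hN']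
      simp only [charTable, Matrix.of_apply, Matrix.cons_val]
      push_cast
      ring
    · have hax := hα.mem_iff (classAxis_special c)
      have hax' := hα.mem_iff (neg_special (classAxis_special c))
      rw [sum_multiplicity t m hc, H.tangentCharacter_eq hN he hc, if_congr hax rfl rfl]
      · rw [hax, hax']
        exact t.neg_exceptional
      · rw [hax, hax']
        intro hv
        rw [← neg_neg (classAxis c)]
        exact t.neg_exceptional hv
  rw [ModuliZero.isMultiplicityVector_iff hN he]
  constructor
  · intro hp
    exact eq_of_sum_charTable_eq fun c => (hp c).trans (hchar c)
  · rintro rfl c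
    exact (hchar c).symm

end ModuliZero
end

theorem mainTheorem10 (N : ℕ) (hN : 2 ≤ N) (l : ModuliZero.K N)
    (hl : Nonempty (ModuliZero.Stab l ≃* alternatingGroup (Fin 5))) :
    (∃ (t : ModuliZero.OrbitType) (m : ℕ), ModuliZero.HasType l t m) ∧
      ∀ (t : ModuliZero.OrbitType) (m : ℕ), ModuliZero.HasType l t m →
        ∀ p : Fin 5 → ℕ, ModuliZero.IsMultiplicityVector l p ↔ p = t.multiplicity m := by
  obtain ⟨e₀⟩ := hl
  obtain ⟨e, he⟩ := ModuliZero.exists_isAdapted hN e₀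
  refine ⟨?_, fun t m ht => ht.isMultiplicityVector_iff hN he⟩
  obtain ⟨h, α, H⟩ := ModuliZero.exists_realizes hN he
  have hcard := H.ncard_eq
  have hfin : α.Finite := Set.finite_of_ncard_ne_zero (by omega)
  have hne : α.Nonempty := Set.nonempty_of_ncard_ne_zero (by omega)
  obtain ⟨t, m, hα⟩ := ModuliZero.exists_isOfType H.subset H.icoInvariant hfin hne
  exact ⟨t, m, H.hasType hα⟩
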